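/- Let $k\ge 2$, $\mu_1,\dots,\mu_k\in\mathbb{R}$ and $\sigma_1,\dots,\sigma_k>0$, and suppose that there is a unique best arm $b$, i.e. $\mu_b>\mu_i$ for all $i\neq b$. Let $X_{i,t}\sim\mathcal N(\mu_i,\sigma_i^2)$, for arms $i=1,\dots,k$ and rounds $t=1,2,\dots$, be mutually independent; if arm $i$ is pulled in round $t$, the reward $X_{i,t}$ is observed. The knowledge gradient (KG) algorithm keeps for each arm a posterior mean and variance, starting from the non-informative prior $\theta_{i,1}=0$, $\lambda_{i,1}^2=\infty$. In round $t$ it pulls an arm $I_t\in\arg\max_i v_{i,t}$, where $$v_{i,t}=\zeta_{i,t}\,f\!\left(-\frac{|\theta_{i,t}-\max_{j\ne i}\theta_{j,t}|}{\zeta_{i,t}}\right),\qquad \zeta_{i,t}^2=\lambda_{i,t}^2-(\lambda_{i,t}^{-2}+\sigma_i^{-2})^{-1},\qquad f(x)=x\Phi(x)+\phi(x),$$ $\Phi,\phi$ are the standard normal distribution function and density, $v_{i,t}=\infty$ for an arm not pulled yet, and ties are broken by a measurable function of the current values $(\theta_{j,t},\lambda_{j,t}^2)_{j}$. Then, for $i=I_t$,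 $\theta_{i,t+1}=(\lambda_{i,t}^{-2}\theta_{i,t}+\sigma_i^{-2}X_{i,t})/(\lambda_{i,t}^{-2}+\sigma_i^{-2})$ and $\lambda_{i,t+1}^2=(\lambda_{i,t}^{-2}+\sigma_i^{-2})^{-1}$; the values of the other arms do not change. Let $N_{i,t}=\sum_{s=1}^t \mathbf 1\{I_s=i\}$ and $\alpha_{i,t}=N_{i,t}/t$. Put $\sigma_{\max}=\max_i\sigma_i$, $\sigma_{\min}=\min_i\sigma_i$, $\delta_{\max}=\max_{i\ne j}|\mu_i-\mu_j|$, $m=\max_{j\neq b}\mu_j$, $L=\max\{\ln(27\delta_{\max}^3/(8\sigma_{\min}^4)),0\}$, $q(s)=4\sigma_{\max}k^{-1/8}s^{-1/8}\exp\{-k^{1/4}s^{1/4}/(8\sigma_{\max}^2)\}$ and, for $i\ne b$, $$\underline\rho^{(1)}_{i,b,t}=\frac{\mu_b-m-(\frac34t)^{-1/4}}{\left(1+(\frac{3t}{4k})^{-3/4}\right)^2\sigma_b}\left(\frac{(\mu_b-\mu_i+(\frac34t)^{-1/4})^2}{\sigma_i^2}+\frac{16k}{\sqrt{3t}}+\frac{8kL}{3t}\right)^{-1/2},$$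 $$\underline\rho^{(2)}_{i,b,t}=\frac{\mu_b-m-t^{-1/4}}{\left(1+(\frac{t}{k})^{-3/4}\right)\sigma_b}\left(\frac{(\mu_b-\mu_i+t^{-1/4})^2}{\sigma_i^2}+\frac{8k}{\sqrt{t}}+\frac{2kL}{t}\right)^{-1/2},$$ $$\overline\rho^{(1)}_{i,b,t}=\frac{\left(1+(\frac tk)^{-3/4}\right)\sigma_i}{\mu_b-\mu_i-t^{-1/4}}\left(\frac{(\mu_b-m+t^{-1/4})^2}{\sigma_b^2}+\frac{8k}{\sqrt t}+\frac{2kL}{t}\right)^{1/2},$$ $$\overline\rho^{(2)}_{i,b,t}=\frac{\left(1+(\frac{3t}{4k})^{-3/4}\right)^2\sigma_i}{\mu_b-\mu_i-(\frac34t)^{-1/4}}\left(\frac{(\mu_b-m+(\frac34t)^{-1/4})^2}{\sigma_b^2}+\frac{16k}{\sqrt{3t}}+\frac{8kL}{3t}\right)^{1/2},$$ $\underline\rho_{i,b,t}=\min\{\underline\rho^{(1)}_{i,b,t},\underline\rho^{(2)}_{i,b,t}\}$, $\overline\rho_{i,b,t}=\max\{\overline\rho^{(1)}_{i,b,t},\overline\rho^{(2)}_{i,b,t}\}$.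 Theorem. There is a finite random time $T_0$ such that almost surely $N_{i,t}\ge (t/k)^{3/4}$ for all arms $i$ and all $t\ge T_0$, and there is a deterministic $T$ such that for every $t>T$, with probability at least $[1-q(\frac34t)]^k$, we have $t>T_0$ and $$\frac{1}{1+\sum_{i\ne b}\overline\rho_{i,b,t}}\le\alpha_{b,t}\le\frac{1}{1+\sum_{i\ne b}\underline\rho_{i,b,t}},\qquad \frac{\underline\rho_{i,b,t}}{1+\sum_{j\ne b}\overline\rho_{j,b,t}}\le\alpha_{i,t}\le\frac{\overline\rho_{i,b,t}}{1+\sum_{j\ne b}\underline\rho_{j,b,t}}\quad\text{for all } i\ne b .$$ -/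

import Mathlib

open MeasureTheory ProbabilityTheory
open scoped ENNReal

noncomputable section

namespace KGBandit

/-- The density `φ` of the standard normal distribution. -/
def phi (x : ℝ) : ℝ := gaussianPDFReal 0 1 x

/-- The cumulative distribution function `Φ` of the standard normal distribution. -/
def Phi (x : ℝ) : ℝ := (gaussianReal 0 1).real (Set.Iic x)

/-- `f(x) = x Φ(x) + φ(x)`. -/
def f (x : ℝ) : ℝ := x * Phi x + phi x

/-- The maximum of `x j` over all arms `j ≠ i` (there are at least two arms in all uses). -/
def maxOther {k : ℕ} (x : Fin k → ℝ) (i : Fin k) : ℝ := ⨆ j : {j : Fin k // j ≠ i}, x j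

/-! ### The knowledge gradient algorithm -/

/-- Knowledge: the posterior means `θ i` and the posterior variances `λ_i²`. The variances take
values in `[0, ∞]`, where `∞` is the variance of the non-informative prior. -/
abbrev Knowledge (k : ℕ) : Type := (Fin k → ℝ) × (Fin k → ℝ≥0∞)

/-- The non-informative prior: all means `0`, all variances `∞`. -/
def prior (k : ℕ) : Knowledge k := (fun _ => 0, fun _ => ∞)

/-- Posterior variance `(λ⁻² + σ⁻²)⁻¹` of an arm with variance `lam2 = λ²` after one more pull,
where `s` is the standard deviation of its rewards. -/
def postVar (s : ℝ) (lam2 : ℝ≥0∞) : ℝ≥0∞ := (lam2⁻¹ + (ENNReal.ofReal (s ^ 2))⁻¹)⁻¹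

/-- Posterior mean `(λ⁻² θ + σ⁻² x) / (λ⁻² + σ⁻²)` after observing the reward `x`. -/
def postMean (s : ℝ) (th : ℝ) (lam2 : ℝ≥0∞) (x : ℝ) : ℝ :=
  (lam2⁻¹.toReal * th + (s ^ 2)⁻¹ * x) / (lam2⁻¹.toReal + (s ^ 2)⁻¹)

/-- The knowledge after pulling arm `a` and observing the reward `x`. -/
def update {k : ℕ} (σ : Fin k → ℝ) (S : Knowledge k) (a : Fin k) (x : ℝ) : Knowledge k :=
  (Function.update S.1 a (postMean (σ a) (S.1 a) (S.2 a) x),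
    Function.update S.2 a (postVar (σ a) (S.2 a)))

/-- `ζ_i`, where `ζ_i²` is the decrease of the variance of arm `i` caused by pulling it. -/
def zeta {k : ℕ} (σ : Fin k → ℝ) (S : Knowledge k) (i : Fin k) : ℝ≥0∞ :=
  (S.2 i - postVar (σ i) (S.2 i)) ^ (1 / 2 : ℝ)

/-- The knowledge gradient `v_i = ζ_i f(-|θ_i - max_{j ≠ i} θ_j| / ζ_i)`. For an arm that has not
been pulled, `ζ_i = ∞`, the quotient is `0`, and `v_i = ∞ · f(0) = ∞`. -/
def kgValue {k : ℕ} (σ : Fin k → ℝ) (S : Knowledge k) (i : Fin k) : ℝ≥0∞ :=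
  zeta σ S i *
    ENNReal.ofReal (f (-(ENNReal.ofReal |S.1 i - maxOther S.1 i| / zeta σ S i).toReal))

/-- A knowledge gradient sampling rule: a measurable map from the knowledge to an arm that
maximizes the knowledge gradient. Ties are broken in any such way. -/
structure IsKGRule {k : ℕ} (σ : Fin k → ℝ) (rule : Knowledge k → Fin k) : Prop where
  measurable : Measurable rule
  argmax : ∀ (S : Knowledge k) (j : Fin k), kgValue σ S j ≤ kgValue σ S (rule S)

/-- The knowledge after `t` rounds (that is, at the start of round `t + 1`) when `rule` is used
and `x i s` is the reward of arm `i` in round `s = 1, 2, …`. -/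
def knowledge {k : ℕ} (σ : Fin k → ℝ) (rule : Knowledge k → Fin k) (x : Fin k → ℕ → ℝ) :
    ℕ → Knowledge k
  | 0 => prior k
  | t + 1 =>
      update σ (knowledge σ rule x t) (rule (knowledge σ rule x t))
        (x (rule (knowledge σ rule x t)) (t + 1))

/-- The arm `I_s` pulled in round `s = 1, 2, …`. -/
def pulledArm {k : ℕ} (σ : Fin k → ℝ) (rule : Knowledge k → Fin k) (x : Fin k → ℕ → ℝ)
    (s : ℕ) : Fin k :=
  rule (knowledge σ rule x (s - 1))

/-- `N_{i,t}`, the number of rounds `s = 1, …, t` in which arm `i` is pulled. -/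
def pulls {k : ℕ} (σ : Fin k → ℝ) (rule : Knowledge k → Fin k) (x : Fin k → ℕ → ℝ)
    (i : Fin k) (t : ℕ) : ℕ :=
  ((Finset.Icc 1 t).filter fun s => pulledArm σ rule x s = i).card

/-- The sampling rate `α_{i,t} = N_{i,t} / t`. -/
def rate {k : ℕ} (σ : Fin k → ℝ) (rule : Knowledge k → Fin k) (x : Fin k → ℕ → ℝ)
    (i : Fin k) (t : ℕ) : ℝ :=
  (pulls σ rule x i t : ℝ) / (t : ℝ)

/-! ### The explicit bounds -/

/-- `σ_max`. -/
def sigmaMax {k : ℕ} (σ : Fin k → ℝ) : ℝ := ⨆ i, σ i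

/-- `σ_min`. -/
def sigmaMin {k : ℕ} (σ : Fin k → ℝ) : ℝ := ⨅ i, σ i

/-- `δ_max`, the maximum of `|μ_i - μ_j|` over `i ≠ j`. -/
def deltaMax {k : ℕ} (μ : Fin k → ℝ) : ℝ :=
  ⨆ p : {p : Fin k × Fin k // p.1 ≠ p.2}, |μ p.1.1 - μ p.1.2|

/-- `q(s) = 4 σ_max k^{-1/8} s^{-1/8} exp(-k^{1/4} s^{1/4} / (8 σ_max²))`. -/
def q {k : ℕ} (σ : Fin k → ℝ) (s : ℝ) : ℝ :=
  4 * sigmaMax σ * (k : ℝ) ^ (-(1 / 8) : ℝ) * s ^ (-(1 / 8) : ℝ) *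
    Real.exp (-((k : ℝ) ^ (1 / 4 : ℝ) * s ^ (1 / 4 : ℝ) / (8 * sigmaMax σ ^ 2)))

/-- `max {ln(27 δ_max³ / (8 σ_min⁴)), 0}`. -/
def logTerm {k : ℕ} (μ σ : Fin k → ℝ) : ℝ :=
  max (Real.log (27 * deltaMax μ ^ 3 / (8 * sigmaMin σ ^ 4))) 0

/-- First lower ratio bound. -/
def rhoLow1 {k : ℕ} (μ σ : Fin k → ℝ) (b i : Fin k) (t : ℝ) : ℝ :=
  (μ b - maxOther μ b - (3 / 4 * t) ^ (-(1 / 4) : ℝ)) /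
      ((1 + (3 * t / (4 * k)) ^ (-(3 / 4) : ℝ)) ^ 2 * σ b) *
    ((μ b - μ i + (3 / 4 * t) ^ (-(1 / 4) : ℝ)) ^ 2 / σ i ^ 2 + 16 * k / Real.sqrt (3 * t) +
      8 * k * logTerm μ σ / (3 * t)) ^ (-(1 / 2) : ℝ)

/-- Second lower ratio bound. -/
def rhoLow2 {k : ℕ} (μ σ : Fin k → ℝ) (b i : Fin k) (t : ℝ) : ℝ :=
  (μ b - maxOther μ b - t ^ (-(1 / 4) : ℝ)) /
      ((1 + (t / k) ^ (-(3 / 4) : ℝ)) * σ b) *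
    ((μ b - μ i + t ^ (-(1 / 4) : ℝ)) ^ 2 / σ i ^ 2 + 8 * k / Real.sqrt t +
      2 * k * logTerm μ σ / t) ^ (-(1 / 2) : ℝ)

/-- First upper ratio bound. -/
def rhoUp1 {k : ℕ} (μ σ : Fin k → ℝ) (b i : Fin k) (t : ℝ) : ℝ :=
  (1 + (t / k) ^ (-(3 / 4) : ℝ)) * σ i / (μ b - μ i - t ^ (-(1 / 4) : ℝ)) *
    ((μ b - maxOther μ b + t ^ (-(1 / 4) : ℝ)) ^ 2 / σ b ^ 2 + 8 * k / Real.sqrt t +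
      2 * k * logTerm μ σ / t) ^ (1 / 2 : ℝ)

/-- Second upper ratio bound. -/
def rhoUp2 {k : ℕ} (μ σ : Fin k → ℝ) (b i : Fin k) (t : ℝ) : ℝ :=
  (1 + (3 * t / (4 * k)) ^ (-(3 / 4) : ℝ)) ^ 2 * σ i /
      (μ b - μ i - (3 / 4 * t) ^ (-(1 / 4) : ℝ)) *
    ((μ b - maxOther μ b + (3 / 4 * t) ^ (-(1 / 4) : ℝ)) ^ 2 / σ b ^ 2 +
      16 * k / Real.sqrt (3 * t) + 8 * k * logTerm μ σ / (3 * t)) ^ (1 / 2 : ℝ)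

/-- The lower bound of the ratio `N_{i,t} / N_{b,t}`. -/
def rhoLow {k : ℕ} (μ σ : Fin k → ℝ) (b i : Fin k) (t : ℝ) : ℝ :=
  min (rhoLow1 μ σ b i t) (rhoLow2 μ σ b i t)

/-- The upper bound of the ratio `N_{i,t} / N_{b,t}`. -/
def rhoUp {k : ℕ} (μ σ : Fin k → ℝ) (b i : Fin k) (t : ℝ) : ℝ :=
  max (rhoUp1 μ σ b i t) (rhoUp2 μ σ b i t)

/-- The bounds on all sampling rates `a i` at round `t`, where `b` is the best arm. -/
def RateBounds {k : ℕ} (μ σ : Fin k → ℝ) (b : Fin k) (t : ℝ) (a : Fin k → ℝ) : Prop :=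
  (1 / (1 + ∑ i ∈ Finset.univ.erase b, rhoUp μ σ b i t) ≤ a b ∧
    a b ≤ 1 / (1 + ∑ i ∈ Finset.univ.erase b, rhoLow μ σ b i t)) ∧
  ∀ i, i ≠ b →
    rhoLow μ σ b i t / (1 + ∑ j ∈ Finset.univ.erase b, rhoUp μ σ b j t) ≤ a i ∧
    a i ≤ rhoUp μ σ b i t / (1 + ∑ j ∈ Finset.univ.erase b, rhoLow μ σ b j t)

end KGBandit

end

/-!
Two facts about the knowledge gradient drive the proof. Write `Δ_i = |θ_i - max_{j ≠ i} θ_j|`.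

*Balance.* For `x ≥ 0` the value `f (-x)` lies between `φ (x + 2)` and `φ x`, and `ζ_i` is of order
`σ_i / N_i`. So the pulled arm minimizes the index `N_i Δ_i / σ_i` up to an error of order
`√log` (`index_le_of_pulled`), and one of its competitors has been pulled comparably often
(`exists_competitor`). Once the posterior means are accurate, the indices of all arms must agree at
their last pulls up to a small error (`pulls_balance`, `eventually_balance`). As `Δ_b` is
close to `μ_b - m` and `Δ_i` to `μ_b - μ_i` for `i ≠ b`, this determines the ratios `N_i / N_b` up to
`o(t ^ (-1 / 4))`, and the slack `t ^ (-1 / 4)` in the explicit bounds absorbs the error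
(`eventually_rateBounds`).

*No starvation.* The means are accurate only if every arm is pulled often. Suppose an arm has fewer
than `s ^ (3 / 11)` pulls at time `s`. Then some rarely pulled arm has index of order at most
`s ^ (3 / 11)` (`exists_mul_gapOf_le`), hence so has each pulled arm, and every late pull of the most
pulled arm is made while its posterior mean is within a multiple of `s ^ (3 / 11) / s` of that of
another often pulled arm (`eventually_rpow_le_pulls`). But the
difference of two posterior means performs a Gaussian random walk, which seldom stays in so narrow
a strip: the exponential of a convex function of the walk, compensated at each close pull, is a
supermartingale (`measure_closePulls_le`). So every arm has at least `s ^ (3 / 11)`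
pulls at all late times `s`, which makes the posterior means accurate up to a constant; balance then
yields a linear number of pulls of each arm (`eventually_linear_le_pulls`), and with it errors of
the means of order `t ^ (-4 / 11)`.

The concentration of the posterior means is an exponential supermartingale bound as well
(`measure_exists_deviation_le`); both go through `lintegral_prod_le_one`, in which the reward of a
round is independent of the choice made in it. All exceptional probabilities at time `s` are at most
`exp (-d s ^ (3 / 11))`. They stay so after summation over late times
(`eventually_measure_exists_le`), which yields the random time `T₀`, and they are much smaller than
`q (3 t / 4)`, of order `t ^ (-1 / 8) exp (-B t ^ (1 / 4))` (`eventually_exp_le_q`). Since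
`(1 - q) ^ k ≤ 1 - q`, the probability bound follows.
-/

noncomputable section

namespace KGBandit

/-! ### The function `f` -/

lemma phi_eq (x : ℝ) : phi x = (√(2 * Real.pi))⁻¹ * Real.exp (-x ^ 2 / 2) := by
  simp [phi, gaussianPDFReal]

lemma phi_pos (x : ℝ) : 0 < phi x := gaussianPDFReal_pos 0 1 x one_ne_zero

lemma Phi_nonneg (x : ℝ) : 0 ≤ Phi x := measureReal_nonneg

lemma phi_neg (x : ℝ) : phi (-x) = phi x := by simp [phi_eq]

lemma hasDerivAt_neg_phi (x : ℝ) : HasDerivAt (fun y => -phi y) (x * phi x) x := by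
  have h : HasDerivAt (fun y : ℝ => -((√(2 * Real.pi))⁻¹ * Real.exp (-y ^ 2 / 2)))
      (-((√(2 * Real.pi))⁻¹ * (Real.exp (-x ^ 2 / 2) * (-(2 * x) / 2)))) x := by
    have h1 : HasDerivAt (fun y : ℝ => -y ^ 2 / 2) (-(2 * x) / 2) x := by
      simpa using ((hasDerivAt_pow 2 x).neg.div_const 2)
    exact ((h1.exp).const_mul _).neg
  simp only [phi_eq]
  convert h using 1
  ring

lemma integrable_id_mul_phi : Integrable (fun x => x * phi x) := by
  have h := (integrable_mul_exp_neg_mul_sq (b := 1 / 2) (by norm_num)).const_mul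
    ((√(2 * Real.pi))⁻¹)
  refine h.congr (ae_of_all _ fun x => ?_)
  simp only [phi_eq]
  rw [show -x ^ 2 / 2 = -(1 / 2) * x ^ 2 by ring]
  ring

lemma tendsto_phi_atTop : Filter.Tendsto phi Filter.atTop (nhds 0) := by
  have h : Filter.Tendsto (fun x : ℝ => (√(2 * Real.pi))⁻¹ * Real.exp (-(x ^ 2 / 2)))
      Filter.atTop (nhds ((√(2 * Real.pi))⁻¹ * 0)) := by
    refine Filter.Tendsto.const_mul _ (Real.tendsto_exp_neg_atTop_nhds_zero.comp ?_)
    exact (Filter.tendsto_pow_atTop two_ne_zero).atTop_div_const (by norm_num)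
  rw [mul_zero] at h
  refine h.congr fun x => ?_
  rw [phi_eq, neg_div]

lemma setIntegral_id_mul_phi (a : ℝ) : ∫ x in Set.Ioi a, x * phi x = phi a := by
  have h := integral_Ioi_of_hasDerivAt_of_tendsto (f := fun y => -phi y)
    (f' := fun x => x * phi x) (a := a) (m := 0)
    (hasDerivAt_neg_phi a).continuousAt.continuousWithinAt
    (fun x _ => hasDerivAt_neg_phi x) integrable_id_mul_phi.integrableOn
    (by simpa using tendsto_phi_atTop.neg)
  simpa using h

lemma integrable_phi : Integrable phi := integrable_gaussianPDFReal 0 1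

lemma Phi_eq (z : ℝ) : Phi z = ∫ x in Set.Ioi (-z), phi x := by
  have h : Phi z = ∫ x in Set.Iic z, phi x := by
    rw [Phi, measureReal_def, gaussianReal_apply_eq_integral 0 one_ne_zero,
      ENNReal.toReal_ofReal]
    · rfl
    · exact setIntegral_nonneg measurableSet_Iic fun x _ => (phi_pos x).le
  have h2 := integral_comp_neg_Ioi (-z) phi
  rw [h, ← neg_neg z, ← h2, neg_neg]
  simp only [phi_neg]

/-- `f(z) = E (z + G)⁺` for a standard normal variable `G`. -/
lemma f_eq_integral (z : ℝ) : f z = ∫ x in Set.Ioi (-z), (z + x) * phi x := by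
  simp only [add_mul]
  rw [integral_add (integrable_phi.const_mul z).integrableOn integrable_id_mul_phi.integrableOn,
    integral_const_mul, ← Phi_eq, setIntegral_id_mul_phi, phi_neg, f]

lemma integrable_add_mul_phi (z : ℝ) : Integrable (fun x => (z + x) * phi x) := by
  simp only [add_mul]
  exact (integrable_phi.const_mul z).add integrable_id_mul_phi

lemma f_mono : Monotone f := by
  intro z w h
  rw [f_eq_integral, f_eq_integral]
  refine (setIntegral_mono_on (integrable_add_mul_phi z).integrableOn
    (integrable_add_mul_phi w).integrableOn measurableSet_Ioi fun x _ =>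
      mul_le_mul_of_nonneg_right (by linarith) (phi_pos x).le).trans ?_
  refine setIntegral_mono_set (integrable_add_mul_phi w).integrableOn ?_
    (Set.Ioi_subset_Ioi (by linarith)).eventuallyLE
  refine (ae_restrict_iff' measurableSet_Ioi).2 (ae_of_all _ fun x hx => ?_)
  exact mul_nonneg (by rw [Set.mem_Ioi] at hx; linarith) (phi_pos x).le

lemma phi_anti {x y : ℝ} (hx : 0 ≤ x) (hxy : x ≤ y) : phi y ≤ phi x := by
  rw [phi_eq, phi_eq]
  gcongr

lemma f_neg_le {x : ℝ} (hx : 0 ≤ x) : f (-x) ≤ phi x := by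
  rw [f, phi_neg]
  nlinarith [mul_nonneg hx (Phi_nonneg (-x))]

lemma phi_add_two_le {x : ℝ} (hx : 0 ≤ x) : phi (x + 2) ≤ f (-x) := by
  rw [f_eq_integral, neg_neg]
  have h1 : phi (x + 2) = ∫ _ in Set.Ioc (x + 1) (x + 2), phi (x + 2) := by
    simp; ring_nf
  rw [h1]
  refine (setIntegral_mono_on (g := fun y => (-x + y) * phi y) (by simp)
    (integrable_add_mul_phi _).integrableOn measurableSet_Ioc fun y hy => ?_).trans ?_
  · have h2 := phi_anti (x := y) (y := x + 2) (by linarith [hy.1]) hy.2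
    nlinarith [hy.1, phi_pos y]
  · refine setIntegral_mono_set (integrable_add_mul_phi _).integrableOn ?_
      (Set.Ioc_subset_Ioi_self.trans (Set.Ioi_subset_Ioi (by linarith))).eventuallyLE
    refine (ae_restrict_iff' measurableSet_Ioi).2 (ae_of_all _ fun y hy => ?_)
    exact mul_nonneg (by rw [Set.mem_Ioi] at hy; linarith) (phi_pos y).le

lemma f_neg_pos {x : ℝ} (hx : 0 ≤ x) : 0 < f (-x) := (phi_pos _).trans_le (phi_add_two_le hx)

section

/-! ### Pull counts and posteriors -/

variable {k : ℕ} {σ : Fin k → ℝ} {rule : Knowledge k → Fin k} {x : Fin k → ℕ → ℝ}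

lemma pulls_zero (i : Fin k) : pulls σ rule x i 0 = 0 := by simp [pulls]

lemma pulls_succ (i : Fin k) (r : ℕ) :
    pulls σ rule x i (r + 1) =
      pulls σ rule x i r + if rule (knowledge σ rule x r) = i then 1 else 0 := by
  unfold pulls
  rw [← Finset.insert_Icc_right_eq_Icc_add_one (by omega), Finset.filter_insert]
  have h : pulledArm σ rule x (r + 1) = rule (knowledge σ rule x r) := by simp [pulledArm]
  rw [h]
  split_ifs with h1
  · rw [Finset.card_insert_of_notMem (by simp)]
  · rfl

lemma pulls_mono (i : Fin k) : Monotone (pulls σ rule x i) :=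
  monotone_nat_of_le_succ fun r => by rw [pulls_succ]; omega

lemma pulls_le (i : Fin k) (r : ℕ) : pulls σ rule x i r ≤ r := by
  induction r with
  | zero => simp [pulls_zero]
  | succ r ih => rw [pulls_succ]; split_ifs <;> omega

lemma sum_pulls (r : ℕ) : ∑ i, pulls σ rule x i r = r := by
  induction r with
  | zero => simp [pulls_zero]
  | succ r ih => simp [pulls_succ, Finset.sum_add_distrib, ih]

lemma ofReal_sq_ne_zero {s : ℝ} (hs : 0 < s) : ENNReal.ofReal (s ^ 2) ≠ 0 :=
  (ENNReal.ofReal_pos.2 (pow_pos hs 2)).ne'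

lemma postVar_div {s : ℝ} (hs : 0 < s) (n : ℕ) :
    postVar s (ENNReal.ofReal (s ^ 2) / (n : ℝ≥0∞)) =
      ENNReal.ofReal (s ^ 2) / ((n + 1 : ℕ) : ℝ≥0∞) := by
  have h0 := ofReal_sq_ne_zero hs
  rw [postVar, ENNReal.inv_div (by simp) (by simp [h0]), ← one_div (ENNReal.ofReal (s ^ 2)),
    ENNReal.div_add_div_same, ENNReal.inv_div (by simp) (by simp)]
  simp

/-- The posterior variance after `n` pulls is `σ² / n`, which is `∞` for `n = 0`. -/
lemma knowledge_var (hσ : ∀ i, 0 < σ i) (i : Fin k) (r : ℕ) :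
    (knowledge σ rule x r).2 i = ENNReal.ofReal (σ i ^ 2) / (pulls σ rule x i r : ℝ≥0∞) := by
  have h0 : ENNReal.ofReal (σ i ^ 2) ≠ 0 := ofReal_sq_ne_zero (hσ i)
  induction r with
  | zero => simp [knowledge, prior, pulls_zero, ENNReal.div_zero h0]
  | succ r ih =>
    rw [pulls_succ]
    simp only [knowledge, update]
    split_ifs with h
    · rw [h, Function.update_self, ih, postVar_div (hσ i)]
    · rw [Function.update_of_ne (Ne.symm h), ih]
      simp

lemma knowledge_mean_of_ne {i : Fin k} {r : ℕ} (h : rule (knowledge σ rule x r) ≠ i) :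
    (knowledge σ rule x (r + 1)).1 i = (knowledge σ rule x r).1 i := by
  simp [knowledge, update, Function.update_of_ne (Ne.symm h)]

/-- The posterior mean is the running average of the observed rewards. -/
lemma knowledge_mean_of_eq (hσ : ∀ i, 0 < σ i) {i : Fin k} {r : ℕ}
    (h : rule (knowledge σ rule x r) = i) :
    (knowledge σ rule x (r + 1)).1 i =
      ((pulls σ rule x i r : ℝ) * (knowledge σ rule x r).1 i + x i (r + 1)) /
        ((pulls σ rule x i r : ℝ) + 1) := by
  have h0 : ENNReal.ofReal (σ i ^ 2) ≠ 0 := ofReal_sq_ne_zero (hσ i)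
  have hs := hσ i
  simp only [knowledge, update]
  rw [h, Function.update_self, postMean, knowledge_var hσ, ENNReal.inv_div (by simp) (by simp [h0]),
    ENNReal.toReal_div, ENNReal.toReal_natCast, ENNReal.toReal_ofReal (by positivity)]
  field_simp

/-! ### The knowledge gradient of a pulled arm -/

/-- `ζ` of an arm with standard deviation `s` after `n ≥ 1` pulls. -/
def zetaPulls (s : ℝ) (n : ℕ) : ℝ := s / √((n : ℝ) * (n + 1))

/-- `Δ_i = |θ_i - max_{j ≠ i} θ_j|`. -/
def gapOf (th : Fin k → ℝ) (i : Fin k) : ℝ := |th i - maxOther th i|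

lemma gapOf_nonneg (th : Fin k → ℝ) (i : Fin k) : 0 ≤ gapOf th i := abs_nonneg _

lemma zetaPulls_pos {s : ℝ} (hs : 0 < s) {n : ℕ} (hn : 1 ≤ n) : 0 < zetaPulls s n := by
  have : (0 : ℝ) < n := by exact_mod_cast hn
  unfold zetaPulls; positivity

lemma zeta_eq (hσ : ∀ i, 0 < σ i) {i : Fin k} {r : ℕ} (hn : 1 ≤ pulls σ rule x i r) :
    zeta σ (knowledge σ rule x r) i = ENNReal.ofReal (zetaPulls (σ i) (pulls σ rule x i r)) := by
  have hs := hσ i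
  have h0 : ENNReal.ofReal (σ i ^ 2) ≠ 0 := ofReal_sq_ne_zero (hσ i)
  rw [zeta, knowledge_var hσ, postVar_div hs]
  set n := pulls σ rule x i r
  have hn' : (0 : ℝ) < n := by exact_mod_cast hn
  have e1 : ∀ m : ℕ, 0 < m → ENNReal.ofReal (σ i ^ 2) / (m : ℝ≥0∞) =
      ENNReal.ofReal (σ i ^ 2 / m) := fun m hm => by
    rw [ENNReal.ofReal_div_of_pos (by exact_mod_cast hm), ENNReal.ofReal_natCast]
  rw [e1 n hn, e1 (n + 1) (by omega), ← ENNReal.ofReal_sub _ (by positivity),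
    ENNReal.ofReal_rpow_of_nonneg _ (by norm_num), ← Real.sqrt_eq_rpow, zetaPulls]
  · congr 1
    rw [show σ i ^ 2 / (n : ℝ) - σ i ^ 2 / ((n + 1 : ℕ) : ℝ) = σ i ^ 2 / ((n : ℝ) * (n + 1)) by
      push_cast; field_simp; ring, Real.sqrt_div (by positivity), Real.sqrt_sq hs.le]
  · push_cast
    rw [sub_nonneg]
    gcongr
    linarith

lemma kgValue_eq (hσ : ∀ i, 0 < σ i) {i : Fin k} {r : ℕ} (hn : 1 ≤ pulls σ rule x i r) :
    kgValue σ (knowledge σ rule x r) i =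
      ENNReal.ofReal (zetaPulls (σ i) (pulls σ rule x i r) *
        f (-(gapOf (knowledge σ rule x r).1 i / zetaPulls (σ i) (pulls σ rule x i r)))) := by
  have hz := zetaPulls_pos (hσ i) hn
  rw [kgValue, zeta_eq hσ hn, ENNReal.ofReal_mul hz.le, ← ENNReal.ofReal_div_of_pos hz,
    ENNReal.toReal_ofReal (div_nonneg (abs_nonneg _) hz.le)]
  rfl

lemma kgValue_of_pulls_eq_zero (hσ : ∀ i, 0 < σ i) {i : Fin k} {r : ℕ}
    (hn : pulls σ rule x i r = 0) : kgValue σ (knowledge σ rule x r) i = ∞ := by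
  have h0 : ENNReal.ofReal (σ i ^ 2) ≠ 0 := ofReal_sq_ne_zero (hσ i)
  have hz : zeta σ (knowledge σ rule x r) i = ∞ := by
    rw [zeta, knowledge_var hσ, hn, Nat.cast_zero, ENNReal.div_zero h0, postVar]
    simp only [ENNReal.inv_top, zero_add, inv_inv]
    rw [ENNReal.top_sub (by simp), ENNReal.top_rpow_of_pos (by norm_num)]
  rw [kgValue, hz, ENNReal.div_top, ENNReal.top_mul]
  have := f_neg_pos le_rfl
  simpa using this

/-- If an arm that has been pulled before is pulled, then all arms have been pulled, and its
knowledge gradient is largest. -/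
lemma value_le_of_pulled (hσ : ∀ i, 0 < σ i) (hrule : IsKGRule σ rule) {i : Fin k} {r : ℕ}
    (hi : rule (knowledge σ rule x r) = i) (hn : 1 ≤ pulls σ rule x i r) (j : Fin k) :
    1 ≤ pulls σ rule x j r ∧
    zetaPulls (σ j) (pulls σ rule x j r) *
        f (-(gapOf (knowledge σ rule x r).1 j / zetaPulls (σ j) (pulls σ rule x j r))) ≤
      zetaPulls (σ i) (pulls σ rule x i r) *
        f (-(gapOf (knowledge σ rule x r).1 i / zetaPulls (σ i) (pulls σ rule x i r))) := by
  have h := hrule.argmax (knowledge σ rule x r) j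
  rw [hi, kgValue_eq hσ hn] at h
  have hj : 1 ≤ pulls σ rule x j r := by
    by_contra hc
    rw [kgValue_of_pulls_eq_zero hσ (by omega)] at h
    exact absurd h (by simp)
  refine ⟨hj, ?_⟩
  rw [kgValue_eq hσ hj] at h
  refine (ENNReal.ofReal_le_ofReal_iff ?_).1 h
  have hz := zetaPulls_pos (hσ i) hn
  exact mul_nonneg hz.le (f_neg_pos (div_nonneg (abs_nonneg _) hz.le)).le

lemma le_sqrt_mul_succ (n : ℕ) : (n : ℝ) ≤ √((n : ℝ) * (n + 1)) :=
  Real.le_sqrt_of_sq_le (by nlinarith [(Nat.cast_nonneg n : (0 : ℝ) ≤ n)])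

lemma sqrt_mul_succ_le (n : ℕ) : √((n : ℝ) * (n + 1)) ≤ n + 1 :=
  Real.sqrt_le_iff.2 ⟨by positivity, by nlinarith [(Nat.cast_nonneg n : (0 : ℝ) ≤ n)]⟩

/-- The error in comparing knowledge gradients through `n Δ / σ` in round `r + 1`. -/
def gradErr (K : ℝ) (r : ℕ) : ℝ := 2 + √(2 * Real.log (K * (r + 1)))

/-- `f(-y) ≤ φ(y)` and `f(-x) ≥ φ(x + 2)`, so an inequality between knowledge gradients bounds
the arguments of `f` up to a logarithm. -/
lemma le_add_of_mul_f_le {zi zj xj yi L : ℝ} (hzi : 0 < zi) (hx : 0 ≤ xj) (hy : 0 ≤ yi)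
    (hL : 1 ≤ L) (hz : zi ≤ L * zj) (h : zj * f (-xj) ≤ zi * f (-yi)) :
    yi ≤ xj + (2 + √(2 * Real.log L)) := by
  have h1 : zj * phi (xj + 2) ≤ zi * phi yi := by
    have hzj : 0 < zj := by nlinarith
    calc zj * phi (xj + 2) ≤ zj * f (-xj) := by gcongr; exact phi_add_two_le hx
      _ ≤ zi * f (-yi) := h
      _ ≤ zi * phi yi := by gcongr; exact f_neg_le hy
  have hzj : 0 < zj := by nlinarith
  have h2 : phi (xj + 2) ≤ L * phi yi := by
    have : zj * phi (xj + 2) ≤ zj * (L * phi yi) := by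
      nlinarith [phi_pos yi]
    exact le_of_mul_le_mul_left this hzj
  have h3 : Real.exp (-(xj + 2) ^ 2 / 2) ≤ Real.exp (Real.log L + -yi ^ 2 / 2) := by
    rw [Real.exp_add, Real.exp_log (by linarith)]
    rw [phi_eq, phi_eq] at h2
    have hc : (0 : ℝ) < (√(2 * Real.pi))⁻¹ := by positivity
    refine le_of_mul_le_mul_left (h2.trans (le_of_eq (by ring))) hc
  have h4 := Real.exp_le_exp.1 h3
  have hlog : 0 ≤ Real.log L := Real.log_nonneg hL
  have h5 : yi ≤ √((xj + 2 + √(2 * Real.log L)) ^ 2) := by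
    refine Real.le_sqrt_of_sq_le ?_
    nlinarith [Real.sq_sqrt (show 0 ≤ 2 * Real.log L by positivity),
      Real.sqrt_nonneg (2 * Real.log L)]
  rw [Real.sqrt_sq (by positivity)] at h5
  linarith

/-- A pulled arm nearly minimizes `n Δ / σ`. -/
lemma index_le_of_pulled (hσ : ∀ i, 0 < σ i) (hrule : IsKGRule σ rule) {K : ℝ}
    (hK1 : 1 ≤ K) (hK : ∀ i j, σ i ≤ K * σ j) {i : Fin k} {r : ℕ}
    (hi : rule (knowledge σ rule x r) = i) (hn : 1 ≤ pulls σ rule x i r) (j : Fin k) :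
    (pulls σ rule x i r : ℝ) * gapOf (knowledge σ rule x r).1 i / σ i ≤
      ((pulls σ rule x j r : ℝ) + 1) * gapOf (knowledge σ rule x r).1 j / σ j + gradErr K r := by
  obtain ⟨hj, hv⟩ := value_le_of_pulled hσ hrule hi hn j
  have hg := fun i => gapOf_nonneg (knowledge σ rule x r).1 i
  have hzi := zetaPulls_pos (hσ i) hn
  have hzj := zetaPulls_pos (hσ j) hj
  have hsi := hσ i
  have hsj := hσ j
  have hni : (1 : ℝ) ≤ pulls σ rule x i r := by exact_mod_cast hn
  have hnj : (1 : ℝ) ≤ pulls σ rule x j r := by exact_mod_cast hj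
  have hr : (pulls σ rule x j r : ℝ) ≤ r := by exact_mod_cast pulls_le j r
  have hratio : zetaPulls (σ i) (pulls σ rule x i r) ≤
      K * (r + 1) * zetaPulls (σ j) (pulls σ rule x j r) := by
    have h1 : zetaPulls (σ i) (pulls σ rule x i r) ≤ σ i :=
      div_le_self hsi.le (hni.trans (le_sqrt_mul_succ _))
    have h2 : σ j / (r + 1) ≤ zetaPulls (σ j) (pulls σ rule x j r) := by
      unfold zetaPulls
      have : √((pulls σ rule x j r : ℝ) * (pulls σ rule x j r + 1)) ≤ r + 1 :=
        (sqrt_mul_succ_le _).trans (by linarith)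
      gcongr
    calc _ ≤ σ i := h1
      _ ≤ K * σ j := hK i j
      _ = K * (r + 1) * (σ j / (r + 1)) := by field_simp
      _ ≤ _ := by gcongr
  have key := le_add_of_mul_f_le hzi (div_nonneg (hg j) hzj.le) (div_nonneg (hg i) hzi.le)
    (by nlinarith) hratio hv
  have e : ∀ l, gapOf (knowledge σ rule x r).1 l / zetaPulls (σ l) (pulls σ rule x l r) =
      √((pulls σ rule x l r : ℝ) * (pulls σ rule x l r + 1)) *
        gapOf (knowledge σ rule x r).1 l / σ l := fun l => by
    unfold zetaPulls
    rw [div_div_eq_mul_div, mul_comm]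
  rw [e, e] at key
  refine le_trans ?_ (key.trans ?_)
  · have := hg i
    gcongr
    exact le_sqrt_mul_succ _
  · have := hg j
    unfold gradErr
    gcongr
    exact sqrt_mul_succ_le _

/-! ### The two leading arms -/

lemma le_maxOther (th : Fin k → ℝ) {i j : Fin k} (h : j ≠ i) : th j ≤ maxOther th i :=
  le_ciSup (f := fun j : {j : Fin k // j ≠ i} => th j) (Set.finite_range _).bddAbove ⟨j, h⟩

lemma exists_eq_maxOther (hk : 2 ≤ k) (th : Fin k → ℝ) (i : Fin k) :
    ∃ j, j ≠ i ∧ th j = maxOther th i := by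
  have : Nontrivial (Fin k) := Fin.nontrivial_iff_two_le.2 hk
  obtain ⟨j0, hj0⟩ := exists_ne i
  have : Nonempty {j : Fin k // j ≠ i} := ⟨⟨j0, hj0⟩⟩
  obtain ⟨j, hj⟩ := exists_eq_ciSup_of_finite (f := fun j : {j : Fin k // j ≠ i} => th j)
  exact ⟨j, j.2, hj⟩

lemma maxOther_le (hk : 2 ≤ k) {th : Fin k → ℝ} {i : Fin k} {c : ℝ}
    (h : ∀ j, j ≠ i → th j ≤ c) : maxOther th i ≤ c := by
  obtain ⟨j, hj, e⟩ := exists_eq_maxOther hk th i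
  exact e ▸ h j hj

/-- The strongest competitor `j` of `i` satisfies `Δ_j ≤ Δ_i`. -/
lemma gapOf_le_of_eq_maxOther (hk : 2 ≤ k) {th : Fin k → ℝ} {i j : Fin k} (hj : j ≠ i)
    (h : th j = maxOther th i) : gapOf th j ≤ |th i - th j| := by
  have h1 : th i ≤ maxOther th j := le_maxOther th hj.symm
  have h2 : maxOther th j ≤ max (th i) (th j) := maxOther_le hk fun l _ => by
    by_cases hli : l = i
    · exact hli ▸ le_max_left _ _
    · exact (h ▸ le_maxOther th hli).trans (le_max_right _ _)
  unfold gapOf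
  rcases le_total (th i) (th j) with h3 | h3
  · rw [max_eq_right h3] at h2
    rw [abs_of_nonneg (by linarith), abs_of_nonpos (by linarith)]
    linarith
  · rw [max_eq_left h3] at h2
    rw [abs_of_nonpos (by linarith), abs_of_nonneg (by linarith)]
    linarith

/-- A pulled arm has a strongest competitor that has been pulled at a comparable rate: their gaps
are ordered, so `ζ_j ≤ ζ_i`. -/
lemma exists_competitor (hk : 2 ≤ k) (hσ : ∀ i, 0 < σ i) (hrule : IsKGRule σ rule) {K : ℝ}
    (hK1 : 1 ≤ K) (hK : ∀ i j, σ i ≤ K * σ j) {i : Fin k} {r : ℕ}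
    (hi : rule (knowledge σ rule x r) = i) (hn : 1 ≤ pulls σ rule x i r) :
    ∃ j, j ≠ i ∧ |(knowledge σ rule x r).1 i - (knowledge σ rule x r).1 j| =
        gapOf (knowledge σ rule x r).1 i ∧
      (pulls σ rule x i r : ℝ) ≤ K * (pulls σ rule x j r + 1) := by
  set th := (knowledge σ rule x r).1 with hth
  obtain ⟨j, hji, hj⟩ := exists_eq_maxOther hk th i
  refine ⟨j, hji, by rw [hj, gapOf], ?_⟩
  obtain ⟨hnj, hv⟩ := value_le_of_pulled hσ hrule hi hn j
  rw [← hth] at hv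
  have hzi := zetaPulls_pos (hσ i) hn
  have hzj := zetaPulls_pos (hσ j) hnj
  have hgap : gapOf th j ≤ gapOf th i := by
    have := gapOf_le_of_eq_maxOther hk hji hj
    rwa [hj] at this
  have hz : zetaPulls (σ j) (pulls σ rule x j r) ≤ zetaPulls (σ i) (pulls σ rule x i r) := by
    by_contra! hlt
    have h0 := gapOf_nonneg th i
    have h1 : f (-(gapOf th i / zetaPulls (σ i) (pulls σ rule x i r))) ≤
        f (-(gapOf th j / zetaPulls (σ j) (pulls σ rule x j r))) :=
      f_mono (neg_le_neg (div_le_div₀ h0 hgap hzi hlt.le))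
    have h2 := f_neg_pos (div_nonneg h0 hzi.le)
    nlinarith
  unfold zetaPulls at hz
  have hni : (1 : ℝ) ≤ pulls σ rule x i r := by exact_mod_cast hn
  have hnj' : (1 : ℝ) ≤ pulls σ rule x j r := by exact_mod_cast hnj
  rw [div_le_div_iff₀ (by positivity) (by positivity)] at hz
  have h1 := le_sqrt_mul_succ (pulls σ rule x i r)
  have h2 := sqrt_mul_succ_le (pulls σ rule x j r)
  have h3 := hσ i
  have h4 := hσ j
  have h5 := hK i j
  have h6 : σ j * (pulls σ rule x i r : ℝ) ≤ σ j * (K * (pulls σ rule x j r + 1)) := by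
    calc σ j * (pulls σ rule x i r : ℝ) ≤ σ j * √((pulls σ rule x i r : ℝ) * (pulls σ rule x i r + 1)) := by
          gcongr
      _ ≤ σ i * √((pulls σ rule x j r : ℝ) * (pulls σ rule x j r + 1)) := hz
      _ ≤ (K * σ j) * (pulls σ rule x j r + 1) := by gcongr
      _ = _ := by ring
  exact le_of_mul_le_mul_left h6 h4

end

section

/-! ### Locality and measurability -/

variable {k : ℕ} {σ : Fin k → ℝ} {rule : Knowledge k → Fin k}

lemma knowledge_congr {x x' : Fin k → ℕ → ℝ} {r : ℕ} (h : ∀ i s, s ≤ r → x i s = x' i s) :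
    knowledge σ rule x r = knowledge σ rule x' r := by
  induction r with
  | zero => rfl
  | succ r ih => simp only [knowledge, ih fun i s hs => h i s (by omega), h _ (r + 1) le_rfl]

lemma pulls_congr {x x' : Fin k → ℕ → ℝ} {r : ℕ} (h : ∀ i s, s ≤ r → x i s = x' i s)
    (i : Fin k) : pulls σ rule x i r = pulls σ rule x' i r := by
  induction r with
  | zero => simp [pulls_zero]
  | succ r ih =>
    rw [pulls_succ, pulls_succ, ih fun i s hs => h i s (by omega),
      knowledge_congr fun i s hs => h i s (by omega)]

lemma measurable_knowledge (hr : Measurable rule) (r : ℕ) :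
    Measurable fun x : Fin k → ℕ → ℝ => knowledge σ rule x r := by
  induction r with
  | zero => exact measurable_const
  | succ r ih =>
    have hI : Measurable fun x : Fin k → ℕ → ℝ => rule (knowledge σ rule x r) := hr.comp ih
    have hset : ∀ i, MeasurableSet {x : Fin k → ℕ → ℝ | rule (knowledge σ rule x r) = i} :=
      fun i => hI (measurableSet_singleton i)
    have hth : ∀ i, Measurable fun x : Fin k → ℕ → ℝ => (knowledge σ rule x r).1 i :=
      fun i => (measurable_pi_apply i).comp (measurable_fst.comp ih)
    have hla : ∀ i, Measurable fun x : Fin k → ℕ → ℝ => (knowledge σ rule x r).2 i :=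
      fun i => (measurable_pi_apply i).comp (measurable_snd.comp ih)
    have hx : ∀ i, Measurable fun x : Fin k → ℕ → ℝ => x i (r + 1) :=
      fun i => (measurable_pi_apply (r + 1)).comp (measurable_pi_apply i)
    refine Measurable.prodMk (measurable_pi_lambda _ fun i => ?_)
      (measurable_pi_lambda _ fun i => ?_)
    · have e : (fun x : Fin k → ℕ → ℝ => (knowledge σ rule x (r + 1)).1 i) = fun x =>
          if rule (knowledge σ rule x r) = i then
            postMean (σ i) ((knowledge σ rule x r).1 i) ((knowledge σ rule x r).2 i) (x i (r + 1))
          else (knowledge σ rule x r).1 i := by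
        funext x
        split_ifs with h
        · simp only [knowledge, update]
          rw [h, Function.update_self]
        · exact knowledge_mean_of_ne h
      change Measurable fun x : Fin k → ℕ → ℝ => (knowledge σ rule x (r + 1)).1 i
      rw [e]
      refine Measurable.ite (hset i) ?_ (hth i)
      unfold postMean
      have h2 := (hla i).inv.ennreal_toReal
      exact ((h2.mul (hth i)).add ((hx i).const_mul _)).div (h2.add_const _)
    · have e : (fun x : Fin k → ℕ → ℝ => (knowledge σ rule x (r + 1)).2 i) = fun x =>
          if rule (knowledge σ rule x r) = i then postVar (σ i) ((knowledge σ rule x r).2 i)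
          else (knowledge σ rule x r).2 i := by
        funext x
        simp only [knowledge, update]
        split_ifs with h
        · rw [h, Function.update_self]
        · rw [Function.update_of_ne (Ne.symm h)]
      change Measurable fun x : Fin k → ℕ → ℝ => (knowledge σ rule x (r + 1)).2 i
      rw [e]
      refine Measurable.ite (hset i) ?_ (hla i)
      unfold postVar
      exact ((hla i).inv.add_const _).inv

lemma measurable_mean (hr : Measurable rule) (r : ℕ) (i : Fin k) :
    Measurable fun x : Fin k → ℕ → ℝ => (knowledge σ rule x r).1 i :=
  (measurable_pi_apply i).comp (measurable_fst.comp (measurable_knowledge hr r))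

lemma measurableSet_arm (hr : Measurable rule) (r : ℕ) (i : Fin k) :
    MeasurableSet {x : Fin k → ℕ → ℝ | rule (knowledge σ rule x r) = i} :=
  (hr.comp (measurable_knowledge hr r)) (measurableSet_singleton i)

lemma measurable_pulls (hr : Measurable rule) (i : Fin k) (r : ℕ) :
    Measurable fun x : Fin k → ℕ → ℝ => pulls σ rule x i r := by
  induction r with
  | zero => simp only [pulls_zero]; exact measurable_const
  | succ r ih =>
    simp only [pulls_succ]
    exact ih.add (Measurable.ite (measurableSet_arm hr r i) measurable_const measurable_const)

lemma measurable_observed (hr : Measurable rule) (r : ℕ) :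
    Measurable fun x : Fin k → ℕ → ℝ => x (rule (knowledge σ rule x r)) (r + 1) := by
  have e : (fun x : Fin k → ℕ → ℝ => x (rule (knowledge σ rule x r)) (r + 1)) =
      fun x => ∑ i, if rule (knowledge σ rule x r) = i then x i (r + 1) else 0 := by
    funext x; simp
  rw [e]
  refine Finset.measurable_sum _ fun i _ => Measurable.ite (measurableSet_arm hr r i) ?_
    measurable_const
  exact (measurable_pi_apply (r + 1)).comp (measurable_pi_apply i)

/-! ### Products of one-step factors -/

/-- The reward path up to round `r`, extended by `0`. -/
def truncPath (r : ℕ) (x : Fin k → ℕ → ℝ) : Fin k → ℕ → ℝ := fun i s => if s ≤ r then x i s else 0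

variable {Ω : Type*} [MeasurableSpace Ω] {P : Measure Ω}
  {X : Fin k → ℕ → Ω → ℝ}

lemma indepFun_truncPath (hX : ∀ i t, Measurable (X i t))
    (hindep : iIndepFun (fun (p : Fin k × ℕ) => X p.1 p.2) P) (R : ℕ) (i : Fin k) :
    IndepFun (fun ω => truncPath R fun i s => X i s ω) (X i (R + 1)) P := by
  have h := hindep.indepFun_finset (Finset.univ ×ˢ Finset.range (R + 1)) {(i, R + 1)}
    (by
      rw [Finset.disjoint_singleton_right]
      simp) (fun p => hX p.1 p.2)
  let ext : (({p // p ∈ (Finset.univ : Finset (Fin k)) ×ˢ Finset.range (R + 1)}) → ℝ) →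
      Fin k → ℕ → ℝ := fun v j s => if hs : s ≤ R then v ⟨(j, s), by simp; omega⟩ else 0
  have hext : Measurable ext := by
    refine measurable_pi_lambda _ fun j => measurable_pi_lambda _ fun s => ?_
    by_cases hs : s ≤ R
    · simp only [ext, hs, dif_pos]
      exact measurable_pi_apply _
    · simp only [ext, hs, dif_neg, not_false_eq_true]
      exact measurable_const
  let ev : (({p // p ∈ ({(i, R + 1)} : Finset (Fin k × ℕ))}) → ℝ) → ℝ :=
    fun v => v ⟨(i, R + 1), by simp⟩
  exact h.comp hext (measurable_pi_apply _ : Measurable ev)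

/-- A product of factors, each of which has conditional expectation at most `1` given the past,
has expectation at most `1`. The factor `h r x y` of round `r + 1` may depend on the path `x` up to
round `r` and on the reward `y` observed in round `r + 1`. -/
lemma lintegral_prod_le_one [IsProbabilityMeasure P] {μ : Fin k → ℝ}
    (hX : ∀ i t, Measurable (X i t))
    (hlaw : ∀ i t, P.map (X i t) = gaussianReal (μ i) (Real.toNNReal (σ i ^ 2)))
    (hindep : iIndepFun (fun (p : Fin k × ℕ) => X p.1 p.2) P) (hr : Measurable rule)
    (h : ℕ → (Fin k → ℕ → ℝ) → ℝ → ℝ≥0∞)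
    (hm : ∀ r, Measurable fun p : (Fin k → ℕ → ℝ) × ℝ => h r p.1 p.2)
    (hloc : ∀ r x x', (∀ i s, s ≤ r → x i s = x' i s) → h r x = h r x')
    (hint : ∀ r x i, rule (knowledge σ rule x r) = i →
      ∫⁻ y, h r x y ∂gaussianReal (μ i) (Real.toNNReal (σ i ^ 2)) ≤ 1) (R : ℕ) :
    ∫⁻ ω, ∏ r ∈ Finset.range R, h r (fun i s => X i s ω)
      (X (rule (knowledge σ rule (fun i s => X i s ω) r)) (r + 1) ω) ∂P ≤ 1 := by
  set A : ℕ → (Fin k → ℕ → ℝ) → ℝ≥0∞ := fun R x => ∏ r ∈ Finset.range R,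
    h r x (x (rule (knowledge σ rule x r)) (r + 1)) with hA
  have hAm : ∀ R, Measurable (A R) := fun R =>
    Finset.measurable_prod _ fun r _ => (hm r).comp (measurable_id.prodMk (measurable_observed hr r))
  have hAloc : ∀ R x x', (∀ i s, s ≤ R → x i s = x' i s) → A R x = A R x' := by
    intro R x x' hx
    refine Finset.prod_congr rfl fun r hrR => ?_
    have hrR' := Finset.mem_range.1 hrR
    have hx' : ∀ i s, s ≤ r → x i s = x' i s := fun i s hs => hx i s (by omega)
    rw [hloc r x x' hx', knowledge_congr hx', hx _ (r + 1) (by omega)]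
  change ∫⁻ ω, A R (fun i s => X i s ω) ∂P ≤ 1
  induction R with
  | zero => simp [hA]
  | succ R ih =>
    have hTm : Measurable fun ω => truncPath R fun i s => X i s ω := by
      refine measurable_pi_lambda _ fun i => measurable_pi_lambda _ fun s => ?_
      unfold truncPath
      split_ifs
      · exact hX i s
      · exact measurable_const
    refine le_trans ?_ ih
    set g : Fin k → (Fin k → ℕ → ℝ) × ℝ → ℝ≥0∞ := fun i p =>
      if rule (knowledge σ rule p.1 R) = i then A R p.1 * h R p.1 p.2 else 0 with hg
    have hgm : ∀ i, Measurable (g i) := fun i =>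
      Measurable.ite (measurable_fst (measurableSet_arm hr R i))
        (((hAm R).comp measurable_fst).mul (hm R)) measurable_const
    have htr : ∀ ω, ∀ i s, s ≤ R →
        truncPath R (fun i s => X i s ω) i s = (fun i s => X i s ω) i s := by
      intro ω i s hs
      simp [truncPath, hs]
    have e1 : ∀ ω, A (R + 1) (fun i s => X i s ω) =
        ∑ i, g i (truncPath R (fun i s => X i s ω), X i (R + 1) ω) := fun ω => by
      simp only [hg]
      rw [knowledge_congr (htr ω), hAloc R _ _ (htr ω), hloc R _ _ (htr ω)]
      simp [hA, Finset.prod_range_succ]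
    have e2 : ∀ ω, A R (fun i s => X i s ω) =
        ∑ i, if rule (knowledge σ rule (truncPath R fun i s => X i s ω) R) = i then
          A R (truncPath R fun i s => X i s ω) else 0 := fun ω => by
      rw [hAloc R _ _ (htr ω)]
      simp
    simp_rw [e1, e2]
    have hm1 : ∀ i ∈ Finset.univ, Measurable fun ω =>
        g i (truncPath R (fun i s => X i s ω), X i (R + 1) ω) :=
      fun i _ => (hgm i).comp (hTm.prodMk (hX i _))
    have hm2 : ∀ i ∈ Finset.univ, Measurable fun ω =>
        if rule (knowledge σ rule (truncPath R fun i s => X i s ω) R) = i then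
          A R (truncPath R fun i s => X i s ω) else 0 := fun i _ =>
      (Measurable.ite (measurableSet_arm hr R i) (hAm R) measurable_const).comp hTm
    rw [lintegral_finsetSum _ hm1, lintegral_finsetSum _ hm2]
    refine Finset.sum_le_sum fun i _ => ?_
    have hprod := (indepFun_iff_map_prod_eq_prod_map_map hTm.aemeasurable
      (hX i (R + 1)).aemeasurable).1 (indepFun_truncPath hX hindep R i)
    have : IsProbabilityMeasure (P.map (X i (R + 1))) :=
      Measure.isProbabilityMeasure_map (hX i (R + 1)).aemeasurable
    rw [← lintegral_map (f := g i) (hgm i) (hTm.prodMk (hX i (R + 1))), hprod,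
      lintegral_prod _ (hgm i).aemeasurable, hlaw,
      lintegral_map (hgm i).lintegral_prod_right' hTm]
    refine lintegral_mono fun ω => ?_
    simp only [hg]
    split_ifs with hi
    · have hm' : Measurable (h R (truncPath R fun i s => X i s ω)) :=
        (hm R).comp (measurable_const.prodMk measurable_id)
      rw [lintegral_const_mul _ hm']
      exact mul_le_of_le_one_right' (hint R _ i hi)
    · simp

/-- Markov's inequality for a variable of mean at most `1`. -/
lemma measure_exp_le_of_lintegral_le_one {Z : Ω → ℝ≥0∞} (hZ : Measurable Z)
    (h : ∫⁻ ω, Z ω ∂P ≤ 1) (c : ℝ) :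
    P {ω | ENNReal.ofReal (Real.exp c) ≤ Z ω} ≤ ENNReal.ofReal (Real.exp (-c)) := by
  have h2 := (mul_meas_ge_le_lintegral (μ := P) hZ (ENNReal.ofReal (Real.exp c))).trans h
  rw [Real.exp_neg, ENNReal.ofReal_inv_of_pos (Real.exp_pos c), ← one_div,
    ENNReal.le_div_iff_mul_le (Or.inl (by simp [Real.exp_pos])) (Or.inl (by simp)), mul_comm]
  exact h2

/-! ### Concentration of the posterior means -/

lemma lintegral_exp_gaussian {m : ℝ} {s : ℝ} (c d : ℝ) :
    ∫⁻ y, ENNReal.ofReal (Real.exp (c * (y - m) + d)) ∂gaussianReal m (Real.toNNReal (s ^ 2)) =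
      ENNReal.ofReal (Real.exp (c ^ 2 * s ^ 2 / 2 + d)) := by
  have h1 : Integrable (fun y => Real.exp (c * (y - m) + d))
      (gaussianReal m (Real.toNNReal (s ^ 2))) := by
    refine ((integrable_exp_mul_gaussianReal c).const_mul (Real.exp (d - c * m))).congr
      (ae_of_all _ fun y => ?_)
    simp only [← Real.exp_add]
    congr 1; ring
  rw [← ofReal_integral_eq_lintegral_ofReal h1 (ae_of_all _ fun _ => (Real.exp_pos _).le)]
  congr 1
  have h2 := congrFun (mgf_id_gaussianReal (μ := m) (v := Real.toNNReal (s ^ 2))) c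
  simp only [mgf, id] at h2
  have h3 : ∀ y, Real.exp (c * (y - m) + d) = Real.exp (d - c * m) * Real.exp (c * y) := fun y => by
    rw [← Real.exp_add]; congr 1; ring
  simp_rw [h3]
  rw [integral_const_mul, h2, ← Real.exp_add, Real.coe_toNNReal _ (sq_nonneg s)]
  congr 1; ring

/-- The supermartingale `exp(c S_i - c² σ_i² N_i / 2)`, `S_i` the centred sum of the observed
rewards of arm `i`, as a product of one-step factors. -/
lemma prod_exp_eq (hσ : ∀ i, 0 < σ i) (x : Fin k → ℕ → ℝ) (m : ℝ) (i : Fin k) (c v : ℝ) (R : ℕ) :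
    ∏ r ∈ Finset.range R, (if rule (knowledge σ rule x r) = i then
      ENNReal.ofReal (Real.exp (c * (x (rule (knowledge σ rule x r)) (r + 1) - m) + v)) else 1) =
    ENNReal.ofReal (Real.exp (c * (pulls σ rule x i R * ((knowledge σ rule x R).1 i - m)) +
      pulls σ rule x i R * v)) := by
  induction R with
  | zero => simp [pulls_zero]
  | succ R ih =>
    rw [Finset.prod_range_succ, ih, pulls_succ]
    split_ifs with h
    · rw [knowledge_mean_of_eq hσ h, h, ← ENNReal.ofReal_mul (Real.exp_pos _).le, ← Real.exp_add]
      have : (0 : ℝ) < (pulls σ rule x i R : ℝ) + 1 := by positivity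
      congr 2
      push_cast
      field_simp
      ring
    · rw [knowledge_mean_of_ne h]
      simp

lemma measure_mean_deviation_le [IsProbabilityMeasure P] {μ : Fin k → ℝ}
    (hX : ∀ i t, Measurable (X i t))
    (hlaw : ∀ i t, P.map (X i t) = gaussianReal (μ i) (Real.toNNReal (σ i ^ 2)))
    (hindep : iIndepFun (fun (p : Fin k × ℕ) => X p.1 p.2) P) (hr : Measurable rule)
    (hσ : ∀ i, 0 < σ i) (i : Fin k) (c a : ℝ) (R : ℕ) :
    P {ω | a < c * (pulls σ rule (fun i s => X i s ω) i R *
        ((knowledge σ rule (fun i s => X i s ω) R).1 i - μ i)) +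
          pulls σ rule (fun i s => X i s ω) i R * (-(c ^ 2 * σ i ^ 2 / 2))} ≤
      ENNReal.ofReal (Real.exp (-a)) := by
  have h := lintegral_prod_le_one hX hlaw hindep hr
    (fun r x y => if rule (knowledge σ rule x r) = i then
      ENNReal.ofReal (Real.exp (c * (y - μ i) + -(c ^ 2 * σ i ^ 2 / 2))) else 1)
    (fun r => Measurable.ite (measurable_fst (measurableSet_arm hr r i)) (by fun_prop)
      measurable_const)
    (fun r x x' hx => by simp only [knowledge_congr hx])
    (fun r x j hj => by
      simp only [hj]
      split_ifs with hji
      · subst hji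
        rw [lintegral_exp_gaussian]
        simp
      · simp) R
  simp_rw [prod_exp_eq hσ] at h
  set W : Ω → ℝ := fun ω => c * (pulls σ rule (fun i s => X i s ω) i R *
        ((knowledge σ rule (fun i s => X i s ω) R).1 i - μ i)) +
          pulls σ rule (fun i s => X i s ω) i R * (-(c ^ 2 * σ i ^ 2 / 2)) with hW
  have hWm : Measurable W := by
    have hXm : Measurable fun ω => fun i s => X i s ω :=
      measurable_pi_lambda _ fun i => measurable_pi_lambda _ fun s => hX i s
    have h1 : Measurable fun ω => ((pulls σ rule (fun i s => X i s ω) i R : ℕ) : ℝ) :=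
      measurable_from_top.comp ((measurable_pulls hr i R).comp hXm)
    have h2 : Measurable fun ω => (knowledge σ rule (fun i s => X i s ω) R).1 i :=
      (measurable_mean hr R i).comp hXm
    exact ((h1.mul (h2.sub_const _)).const_mul _).add (h1.mul_const _)
  have h2 := measure_exp_le_of_lintegral_le_one
    (ENNReal.measurable_ofReal.comp (Real.measurable_exp.comp hWm)) h a
  exact (measure_mono fun ω hω =>
    ENNReal.ofReal_le_ofReal (Real.exp_le_exp.2 (le_of_lt hω))).trans h2

/-- With exponentially small probability the mean of some arm is off by more than `e (1 + M / n)`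
after `n` pulls at some time up to `s`. -/
lemma measure_exists_deviation_le [IsProbabilityMeasure P] {μ : Fin k → ℝ}
    (hX : ∀ i t, Measurable (X i t))
    (hlaw : ∀ i t, P.map (X i t) = gaussianReal (μ i) (Real.toNNReal (σ i ^ 2)))
    (hindep : iIndepFun (fun (p : Fin k × ℕ) => X p.1 p.2) P) (hr : Measurable rule)
    (hσ : ∀ i, 0 < σ i) {S : ℝ} (hS : ∀ i, σ i ≤ S) {e M : ℝ} (he : 0 < e) (hM : 0 < M) (s : ℕ) :
    P {ω | ∃ r ≤ s, ∃ i, e * (pulls σ rule (fun i s => X i s ω) i r + M) <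
      pulls σ rule (fun i s => X i s ω) i r *
        |(knowledge σ rule (fun i s => X i s ω) r).1 i - μ i|} ≤
      ENNReal.ofReal (2 * k * (s + 1) * Real.exp (-(2 * e ^ 2 * M / S ^ 2))) := by
  set p : (Fin k → ℕ → ℝ) → Fin k → ℕ → ℝ := fun x i r => pulls σ rule x i r with hp
  set A : ℝ → ℕ → Fin k → Set Ω := fun c r i => {ω | 2 * e ^ 2 * M / σ i ^ 2 <
      c * (p (fun i s => X i s ω) i r *
        ((knowledge σ rule (fun i s => X i s ω) r).1 i - μ i)) +
          p (fun i s => X i s ω) i r * (-(c ^ 2 * σ i ^ 2 / 2))} with hA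
  have hsub : {ω | ∃ r ≤ s, ∃ i, e * (pulls σ rule (fun i s => X i s ω) i r + M) <
      pulls σ rule (fun i s => X i s ω) i r *
        |(knowledge σ rule (fun i s => X i s ω) r).1 i - μ i|} ⊆
      ⋃ r ∈ Finset.range (s + 1), ⋃ i ∈ (Finset.univ : Finset (Fin k)),
        (A (2 * e / σ i ^ 2) r i ∪ A (-(2 * e / σ i ^ 2)) r i) := by
    rintro ω ⟨r, hrs, i, h⟩
    simp only [Set.mem_iUnion, Finset.mem_range, Finset.mem_univ, exists_prop, true_and]
    refine ⟨r, by omega, i, ?_⟩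
    have hs2 : 0 < σ i ^ 2 := pow_pos (hσ i) 2
    set n : ℝ := (pulls σ rule (fun i s => X i s ω) i r : ℝ) with hn
    set d := (knowledge σ rule (fun i s => X i s ω) r).1 i - μ i with hd
    have key : 2 * e ^ 2 * M / σ i ^ 2 <
        2 * e / σ i ^ 2 * (n * |d|) + n * (-((2 * e / σ i ^ 2) ^ 2 * σ i ^ 2 / 2)) := by
      have e1 : 2 * e / σ i ^ 2 * (n * |d|) + n * (-((2 * e / σ i ^ 2) ^ 2 * σ i ^ 2 / 2)) =
          2 * e * (n * |d| - e * n) / σ i ^ 2 := by field_simp; ring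
      rw [e1]
      refine div_lt_div_of_pos_right ?_ hs2
      nlinarith
    rcases abs_cases d with ⟨h1, _⟩ | ⟨h1, _⟩
    · left
      rw [h1] at key
      exact key
    · right
      rw [h1] at key
      change (_ : ℝ) < _
      refine key.trans_le (le_of_eq ?_)
      simp only [hp, ← hn, ← hd]
      ring
  refine (measure_mono hsub).trans ((measure_biUnion_finset_le _ _).trans ?_)
  have hone : ∀ c r i, P (A c r i) ≤ ENNReal.ofReal (Real.exp (-(2 * e ^ 2 * M / S ^ 2))) := by
    intro c r i
    refine (measure_mean_deviation_le hX hlaw hindep hr hσ i c _ r).trans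
      (ENNReal.ofReal_le_ofReal (Real.exp_le_exp.2 (neg_le_neg ?_)))
    have := hσ i
    gcongr
    exact hS i
  calc _ ≤ ∑ _r ∈ Finset.range (s + 1), ∑ _i : Fin k,
        2 * ENNReal.ofReal (Real.exp (-(2 * e ^ 2 * M / S ^ 2))) := by
        refine Finset.sum_le_sum fun r _ => (measure_biUnion_finset_le _ _).trans
          (Finset.sum_le_sum fun i _ => (measure_union_le _ _).trans ?_)
        rw [two_mul (ENNReal.ofReal _)]
        exact add_le_add (hone _ _ _) (hone _ _ _)
    _ = _ := by
        rw [Finset.sum_const, Finset.sum_const, Finset.card_range, Finset.card_univ,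
          Fintype.card_fin, nsmul_eq_mul, nsmul_eq_mul, ENNReal.ofReal_mul (by positivity),
          ENNReal.ofReal_mul (by positivity), ENNReal.ofReal_mul (by positivity)]
        have e1 : ENNReal.ofReal ((s : ℝ) + 1) = ((s + 1 : ℕ) : ℝ≥0∞) := by
          rw [← ENNReal.ofReal_natCast]; push_cast; rfl
        rw [e1, ENNReal.ofReal_natCast, ENNReal.ofReal_ofNat]
        ring

end

/-! ### A random walk seldom stays in a narrow strip -/

/-- A smooth, convex, `1`-Lipschitz version of `|x|`, strictly convex near `0`. -/
def hyp (x : ℝ) : ℝ := √(1 + x ^ 2)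

lemma hyp_pos (x : ℝ) : 0 < hyp x := by unfold hyp; positivity

lemma hyp_sq (x : ℝ) : hyp x ^ 2 = 1 + x ^ 2 := Real.sq_sqrt (by positivity)

lemma continuous_hyp : Continuous hyp := by unfold hyp; fun_prop

lemma abs_div_hyp_le (x : ℝ) : |x / hyp x| ≤ 1 := by
  rw [abs_div, abs_of_pos (hyp_pos x), div_le_one (hyp_pos x)]
  exact abs_le_of_sq_le_sq (by nlinarith [hyp_sq x]) (hyp_pos x).le

lemma hyp_tangent (x d : ℝ) : hyp x + x / hyp x * d ≤ hyp (x + d) := by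
  have hx := hyp_pos x
  have hy := hyp_pos (x + d)
  have h1 : 1 + x * (x + d) ≤ hyp x * hyp (x + d) := by
    refine le_trans (le_abs_self _) (abs_le_of_sq_le_sq ?_ (by positivity))
    rw [mul_pow, hyp_sq, hyp_sq]
    nlinarith [sq_nonneg d]
  have h2 : hyp x + x / hyp x * d = (1 + x * (x + d)) / hyp x := by
    field_simp
    rw [hyp_sq]; ring
  rw [h2, div_le_iff₀ hx]
  linarith

lemma hyp_tangent_strict {x d : ℝ} (hx1 : |x| ≤ 1) (hd : |d| ≤ 1) :
    hyp x + x / hyp x * d + d ^ 2 / 10 ≤ hyp (x + d) := by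
  have hx := hyp_pos x
  have hy := hyp_pos (x + d)
  rw [abs_le] at hx1 hd
  have h2 : hyp x + x / hyp x * d = (1 + x * (x + d)) / hyp x := by
    field_simp
    rw [hyp_sq]; ring
  have hx2 : hyp x ≤ 3 / 2 := abs_le_of_sq_le_sq' (by nlinarith [hyp_sq x]) (by norm_num) |>.2
  have hy2 : hyp (x + d) ≤ 9 / 4 :=
    abs_le_of_sq_le_sq' (by nlinarith [hyp_sq (x + d)]) (by norm_num) |>.2
  have h1 : (1 + x * (x + d)) + hyp x * (d ^ 2 / 10) ≤ hyp x * hyp (x + d) := by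
    have e : (hyp x * hyp (x + d)) ^ 2 = (1 + x * (x + d)) ^ 2 + d ^ 2 := by
      rw [mul_pow, hyp_sq, hyp_sq]; ring
    have h3 : 1 + x * (x + d) ≤ 3 := by nlinarith
    have h4 : hyp x * (d ^ 2 / 10) ≤ d ^ 2 * (3 / 20) := by nlinarith [sq_nonneg d]
    have h5 : (1 + x * (x + d)) + d ^ 2 * (3 / 20) ≤ hyp x * hyp (x + d) := by
      refine le_trans (le_abs_self _) (abs_le_of_sq_le_sq ?_ (by positivity))
      rw [e]
      have h6 : d ^ 2 * d ^ 2 ≤ d ^ 2 * 1 := by gcongr; nlinarith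
      have h7 : d ^ 2 * (1 + x * (x + d)) ≤ d ^ 2 * 3 := by gcongr
      have h8 : (1 + x * (x + d) + d ^ 2 * (3 / 20)) ^ 2 = (1 + x * (x + d)) ^ 2 +
          3 / 10 * (d ^ 2 * (1 + x * (x + d))) + 9 / 400 * (d ^ 2 * d ^ 2) := by ring
      rw [h8]
      linarith [sq_nonneg d]
    linarith
  rw [h2, div_add' _ _ _ hx.ne', div_le_iff₀ hx]
  linarith

/-- The probability that a standard normal variable is in `[1, 2]`. -/
def gaussBlock : ℝ := (gaussianReal 0 1).real (Set.Icc 1 2)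

lemma gaussBlock_pos : 0 < gaussBlock := by
  unfold gaussBlock
  rw [measureReal_def, gaussianReal_apply_eq_integral 0 one_ne_zero, ENNReal.toReal_ofReal]
  · refine (setIntegral_pos_iff_support_of_nonneg_ae ?_
      (integrable_gaussianPDFReal 0 1).integrableOn).2 ?_
    · exact ae_of_all _ fun x => gaussianPDFReal_nonneg 0 1 x
    · have : Function.support (gaussianPDFReal 0 1) = Set.univ := by
        ext x; simpa using (gaussianPDFReal_pos 0 1 x one_ne_zero).ne'
      rw [this, Set.univ_inter, Real.volume_Icc]
      norm_num
  · exact setIntegral_nonneg measurableSet_Icc fun x _ => gaussianPDFReal_nonneg 0 1 x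

lemma gaussianReal_Icc_eq {m s : ℝ} (hs : 0 < s) :
    gaussianReal m (Real.toNNReal (s ^ 2)) (Set.Icc (m + s) (m + 2 * s)) =
      ENNReal.ofReal gaussBlock := by
  have h : (gaussianReal 0 1).map (fun x => s * x + m) = gaussianReal m (Real.toNNReal (s ^ 2)) := by
    have h1 : (gaussianReal 0 1).map (fun x => s * x) = gaussianReal 0 (Real.toNNReal (s ^ 2)) := by
      rw [gaussianReal_map_const_mul]
      congr 1
      · simp
      · ext; simp [Real.coe_toNNReal _ (sq_nonneg s)]
    have h2 := gaussianReal_map_add_const (μ := 0) (v := Real.toNNReal (s ^ 2)) m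
    rw [← h1, Measure.map_map (by fun_prop) (by fun_prop), zero_add] at h2
    exact h2
  rw [← h, Measure.map_apply (by fun_prop) measurableSet_Icc, gaussBlock, ofReal_measureReal]
  congr 1
  ext x
  simp only [Set.mem_preimage, Set.mem_Icc]
  constructor
  · rintro ⟨h1, h2⟩
    constructor <;> nlinarith
  · rintro ⟨h1, h2⟩
    constructor <;> nlinarith

lemma exp_hyp_le {p Y H kap : ℝ} (hp : 0 ≤ p) :
    Real.exp (-p * (hyp (Y + H) - hyp Y) - kap) ≤ Real.exp (-p * (Y / hyp Y) * H - kap) := by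
  refine Real.exp_le_exp.2 ?_
  nlinarith [mul_le_mul_of_nonneg_left (hyp_tangent Y H) hp]

lemma lintegral_exp_tangent_le {m s p Y τ θ kap : ℝ} (hp : 0 ≤ p)
    (hkap : p * |τ| * |m - θ| + p ^ 2 * τ ^ 2 * s ^ 2 / 2 ≤ kap) :
    ∫⁻ y, ENNReal.ofReal (Real.exp (-p * (Y / hyp Y) * (τ * (y - θ)) - kap))
      ∂gaussianReal m (Real.toNNReal (s ^ 2)) ≤ 1 := by
  have e : ∀ y, -p * (Y / hyp Y) * (τ * (y - θ)) - kap =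
      (-p * (Y / hyp Y) * τ) * (y - m) + (-p * (Y / hyp Y) * τ * (m - θ) - kap) := fun y => by ring
  simp_rw [e]
  rw [lintegral_exp_gaussian, ← ENNReal.ofReal_one]
  refine ENNReal.ofReal_le_ofReal (Real.exp_le_one_iff.2 ?_)
  have hu := abs_div_hyp_le Y
  set u := Y / hyp Y
  have hu2 : u ^ 2 ≤ 1 := by rw [← sq_abs]; nlinarith [abs_nonneg u]
  have h1 : -p * u * τ * (m - θ) ≤ p * |τ| * |m - θ| := by
    calc -p * u * τ * (m - θ) ≤ |-p * u * τ * (m - θ)| := le_abs_self _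
      _ = p * |u| * |τ| * |m - θ| := by simp [abs_mul, abs_of_nonneg hp]
      _ ≤ p * 1 * |τ| * |m - θ| := by gcongr
      _ = _ := by ring
  have h2 : (-p * u * τ) ^ 2 * s ^ 2 / 2 ≤ p ^ 2 * τ ^ 2 * s ^ 2 / 2 := by
    have : (-p * u * τ) ^ 2 * s ^ 2 / 2 = u ^ 2 * (p ^ 2 * τ ^ 2 * s ^ 2 / 2) := by ring
    rw [this]
    exact mul_le_of_le_one_left (by positivity) hu2
  linarith

/-- One step of the walk, anywhere: the convexity of `hyp` makes `exp (-p hyp)` a supermartingale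
up to a small factor. -/
lemma lintegral_exp_hyp_le {m s p Y τ θ kap : ℝ} (hp : 0 ≤ p)
    (hkap : p * |τ| * |m - θ| + p ^ 2 * τ ^ 2 * s ^ 2 / 2 ≤ kap) :
    ∫⁻ y, ENNReal.ofReal (Real.exp (-p * (hyp (Y + τ * (y - θ)) - hyp Y) - kap))
      ∂gaussianReal m (Real.toNNReal (s ^ 2)) ≤ 1 :=
  (lintegral_mono fun _ => ENNReal.ofReal_le_ofReal (exp_hyp_le hp)).trans
    (lintegral_exp_tangent_le hp hkap)

/-- One step of the walk from inside the strip: strict convexity gives an extra factor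
`exp (-kin)`. -/
lemma lintegral_exp_hyp_le_of_abs_le {m s p Y τ θ kap kin : ℝ} (hs : 0 < s) (hp : 0 ≤ p)
    (hp1 : p ≤ 1 / 2) (hY : |Y| ≤ 1) (hkap1 : kap ≤ 1 / 2)
    (hkap : p * |τ| * |m - θ| + p ^ 2 * τ ^ 2 * s ^ 2 / 2 ≤ kap)
    (hθ : |m - θ| ≤ s / 2) (hτ : |τ| * s ≤ 2 / 5)
    (hkin : kin ≤ p * τ ^ 2 * s ^ 2 / 320 * gaussBlock) :
    ∫⁻ y, ENNReal.ofReal (Real.exp (-p * (hyp (Y + τ * (y - θ)) - hyp Y) + kin - kap))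
      ∂gaussianReal m (Real.toNNReal (s ^ 2)) ≤ 1 := by
  set I := ∫⁻ y, ENNReal.ofReal (Real.exp (-p * (hyp (Y + τ * (y - θ)) - hyp Y) - kap))
      ∂gaussianReal m (Real.toNNReal (s ^ 2)) with hI
  set δ := p * τ ^ 2 * s ^ 2 / 320 with hδ
  have hδ0 : 0 ≤ δ := by positivity
  set A := Set.Icc (m + s) (m + 2 * s) with hA
  have hpt : ∀ y, ENNReal.ofReal (Real.exp (-p * (hyp (Y + τ * (y - θ)) - hyp Y) - kap)) +
      A.indicator (fun _ => ENNReal.ofReal δ) y ≤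
      ENNReal.ofReal (Real.exp (-p * (Y / hyp Y) * (τ * (y - θ)) - kap)) := by
    intro y
    by_cases hy : y ∈ A
    · rw [Set.indicator_of_mem hy, ← ENNReal.ofReal_add (Real.exp_pos _).le hδ0]
      refine ENNReal.ofReal_le_ofReal ?_
      rw [abs_le] at hθ
      have hy1 : s / 2 ≤ y - θ := by linarith [hy.1]
      have hy2 : y - θ ≤ 5 / 2 * s := by linarith [hy.2]
      set H := τ * (y - θ) with hH
      have hHabs : |H| = |τ| * (y - θ) := by rw [hH, abs_mul, abs_of_nonneg (by linarith : 0 ≤ y - θ)]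
      have hH1 : |H| ≤ 1 := by
        rw [hHabs]
        nlinarith [abs_nonneg τ]
      have hH2 : τ ^ 2 * s ^ 2 / 4 ≤ H ^ 2 := by
        rw [hH, mul_pow]
        nlinarith [sq_nonneg τ, mul_le_mul_of_nonneg_left
          (show (s / 2) ^ 2 ≤ (y - θ) ^ 2 by gcongr) (sq_nonneg τ)]
      have hH3 : H ^ 2 ≤ 1 := by rw [← sq_abs]; nlinarith [abs_nonneg H]
      have hu := abs_div_hyp_le Y
      have h1 : -p * (hyp (Y + H) - hyp Y) - kap ≤
          (-p * (Y / hyp Y) * H - kap) + -(p * H ^ 2 / 10) := by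
        nlinarith [mul_le_mul_of_nonneg_left (hyp_tangent_strict hY hH1) hp]
      have h2 : Real.exp (-(p * H ^ 2 / 10)) ≤ 1 - p * H ^ 2 / 20 := by
        have h3 : p * H ^ 2 / 10 ≤ 1 := by nlinarith [sq_nonneg H]
        have h4 := Real.exp_bound_div_one_sub_of_interval (x := p * H ^ 2 / 10) (by positivity)
        have hz : 0 ≤ p * H ^ 2 / 10 := by positivity
        set z := p * H ^ 2 / 10
        have h5 : Real.exp (-z) ≤ 1 / (1 + z) := by
          rw [Real.exp_neg, ← one_div]
          exact one_div_le_one_div_of_le (by positivity) (by linarith [Real.add_one_le_exp z])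
        have h6 : 1 / (1 + z) ≤ 1 - z / 2 := by
          rw [div_le_iff₀ (by positivity)]; nlinarith
        have : p * H ^ 2 / 20 = z / 2 := by simp only [z]; ring
        linarith
      have h7 : (1 / 4 : ℝ) ≤ Real.exp (-p * (Y / hyp Y) * H - kap) := by
        have h8 : -(1 : ℝ) ≤ -p * (Y / hyp Y) * H - kap := by
          have : |-p * (Y / hyp Y) * H| ≤ 1 / 2 := by
            rw [abs_mul, abs_mul, abs_neg, abs_of_nonneg hp]
            calc p * |Y / hyp Y| * |H| ≤ 1 / 2 * 1 * 1 := by gcongr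
              _ = 1 / 2 := by norm_num
          linarith [(abs_le.1 this).1]
        refine le_trans ?_ (Real.exp_le_exp.2 h8)
        rw [Real.exp_neg, one_div]
        gcongr
        linarith [Real.exp_one_lt_d9]
      calc Real.exp (-p * (hyp (Y + H) - hyp Y) - kap) + δ
          ≤ Real.exp (-p * (Y / hyp Y) * H - kap) * (1 - p * H ^ 2 / 20) + δ := by
            gcongr
            refine (Real.exp_le_exp.2 h1).trans ?_
            rw [Real.exp_add]
            gcongr
        _ ≤ _ := by
            have h9 : δ ≤ 1 / 4 * (p * H ^ 2 / 20) := by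
              rw [hδ]
              nlinarith
            have h10 : 1 / 4 * (p * H ^ 2 / 20) ≤
                Real.exp (-p * (Y / hyp Y) * H - kap) * (p * H ^ 2 / 20) := by gcongr
            nlinarith
    · rw [Set.indicator_of_notMem hy, add_zero]
      exact ENNReal.ofReal_le_ofReal (exp_hyp_le hp)
  have hsum : I + ENNReal.ofReal (δ * gaussBlock) ≤ 1 := by
    have h1 := (lintegral_mono (μ := gaussianReal m (Real.toNNReal (s ^ 2))) hpt).trans
      (lintegral_exp_tangent_le hp hkap)
    rw [lintegral_add_right _ (measurable_const.indicator measurableSet_Icc),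
      lintegral_indicator measurableSet_Icc, setLIntegral_const, gaussianReal_Icc_eq hs,
      ← ENNReal.ofReal_mul hδ0] at h1
    exact h1
  have hI1 : I ≤ ENNReal.ofReal (1 - δ * gaussBlock) := by
    have h0 : 0 ≤ δ * gaussBlock := mul_nonneg hδ0 gaussBlock_pos.le
    rw [ENNReal.ofReal_sub _ h0, ENNReal.ofReal_one]
    exact ENNReal.le_sub_of_add_le_right (by simp) hsum
  have e : ∀ y, ENNReal.ofReal (Real.exp (-p * (hyp (Y + τ * (y - θ)) - hyp Y) + kin - kap)) =
      ENNReal.ofReal (Real.exp kin) *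
        ENNReal.ofReal (Real.exp (-p * (hyp (Y + τ * (y - θ)) - hyp Y) - kap)) := fun y => by
    rw [← ENNReal.ofReal_mul (Real.exp_pos _).le, ← Real.exp_add]
    congr 2; ring
  have hm : Measurable fun y =>
      ENNReal.ofReal (Real.exp (-p * (hyp (Y + τ * (y - θ)) - hyp Y) - kap)) := by
    have := continuous_hyp.measurable
    fun_prop
  simp_rw [e]
  rw [lintegral_const_mul _ hm, ← hI]
  calc ENNReal.ofReal (Real.exp kin) * I
      ≤ ENNReal.ofReal (Real.exp kin) * ENNReal.ofReal (Real.exp (-kin)) := by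
        gcongr
        refine hI1.trans (ENNReal.ofReal_le_ofReal ?_)
        linarith [Real.add_one_le_exp (-kin)]
    _ = 1 := by
        rw [← ENNReal.ofReal_mul (Real.exp_pos _).le, ← Real.exp_add]
        simp

section

/-! ### Close pulls of a pair of arms -/

variable {k : ℕ} {σ : Fin k → ℝ} {rule : Knowledge k → Fin k}

/-- Both arms `i` and `j` have been pulled at least `N` times after `r` rounds. -/
def BothPulled (σ : Fin k → ℝ) (rule : Knowledge k → Fin k) (x : Fin k → ℕ → ℝ) (i j : Fin k)
    (N : ℝ) (r : ℕ) : Prop :=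
  N ≤ pulls σ rule x i r ∧ N ≤ pulls σ rule x j r

/-- The posterior means of arms `i` and `j` after `r` rounds are off by at most `η`. -/
def BothAccurate (μ σ : Fin k → ℝ) (rule : Knowledge k → Fin k) (x : Fin k → ℕ → ℝ) (i j : Fin k)
    (η : ℝ) (r : ℕ) : Prop :=
  |μ i - (knowledge σ rule x r).1 i| ≤ η ∧ |μ j - (knowledge σ rule x r).1 j| ≤ η

/-- The difference of the posterior means of arms `i` and `j`, magnified by `a`. -/
def meanDiff (σ : Fin k → ℝ) (rule : Knowledge k → Fin k) (x : Fin k → ℕ → ℝ) (i j : Fin k)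
    (a : ℝ) (r : ℕ) : ℝ :=
  a * ((knowledge σ rule x r).1 i - (knowledge σ rule x r).1 j)

open Classical in
/-- The number of rounds up to `R` in which arm `i` is pulled while both arms have been pulled at
least `N` times and their posterior means differ by at most `1 / a`. -/
def closePulls (σ : Fin k → ℝ) (rule : Knowledge k → Fin k) (x : Fin k → ℕ → ℝ) (i j : Fin k)
    (N a : ℝ) (R : ℕ) : ℕ :=
  ((Finset.range R).filter fun r => rule (knowledge σ rule x r) = i ∧
    BothPulled σ rule x i j N r ∧ |meanDiff σ rule x i j a r| ≤ 1).card

open Classical in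
lemma closePulls_succ (x : Fin k → ℕ → ℝ) (i j : Fin k) (N a : ℝ) (R : ℕ) :
    closePulls σ rule x i j N a (R + 1) = closePulls σ rule x i j N a R +
      if rule (knowledge σ rule x R) = i ∧
        BothPulled σ rule x i j N R ∧ |meanDiff σ rule x i j a R| ≤ 1 then 1 else 0 := by
  unfold closePulls
  rw [Finset.range_add_one, Finset.filter_insert]
  split_ifs with h
  · rw [Finset.card_insert_of_notMem (by simp)]
  · rfl

lemma BothPulled.mono {x : Fin k → ℕ → ℝ} {i j : Fin k} {N : ℝ} {r r' : ℕ} (hrr : r ≤ r')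
    (h : BothPulled σ rule x i j N r) : BothPulled σ rule x i j N r' :=
  ⟨h.1.trans (by exact_mod_cast pulls_mono i hrr), h.2.trans (by exact_mod_cast pulls_mono j hrr)⟩

lemma closePulls_eq_zero {x : Fin k → ℕ → ℝ} {i j : Fin k} {N a : ℝ} {R : ℕ}
    (h : ¬ BothPulled σ rule x i j N R) : closePulls σ rule x i j N a R = 0 := by
  classical
  unfold closePulls
  rw [Finset.card_eq_zero, Finset.filter_eq_empty_iff]
  rintro r hr ⟨-, h1, -⟩
  exact h (h1.mono (Finset.mem_range.1 hr).le)

/-- The last close pull. -/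
lemma exists_last_closePull {x : Fin k → ℕ → ℝ} {i j : Fin k} {N a : ℝ} {R : ℕ}
    (h : 1 ≤ closePulls σ rule x i j N a R) :
    ∃ r < R, BothPulled σ rule x i j N r ∧ |meanDiff σ rule x i j a r| ≤ 1 ∧
      closePulls σ rule x i j N a R = closePulls σ rule x i j N a r + 1 := by
  classical
  induction R with
  | zero => simp [closePulls] at h
  | succ R ih =>
    rw [closePulls_succ] at h ⊢
    split_ifs at h ⊢ with h1
    · exact ⟨R, by omega, h1.2.1, h1.2.2, rfl⟩
    · obtain ⟨r, hr, h2⟩ := ih h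
      exact ⟨r, by omega, h2⟩

lemma meanDiff_succ_left (hσ : ∀ i, 0 < σ i) {x : Fin k → ℕ → ℝ} {i j : Fin k} (hij : i ≠ j)
    {a : ℝ} {r : ℕ} (h : rule (knowledge σ rule x r) = i) :
    meanDiff σ rule x i j a (r + 1) = meanDiff σ rule x i j a r +
      a / (pulls σ rule x i r + 1) * (x i (r + 1) - (knowledge σ rule x r).1 i) := by
  have h0 : (0 : ℝ) < (pulls σ rule x i r : ℝ) + 1 := by positivity
  rw [meanDiff, meanDiff, knowledge_mean_of_eq hσ h, knowledge_mean_of_ne (h ▸ hij)]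
  field_simp
  ring

lemma meanDiff_succ_right (hσ : ∀ i, 0 < σ i) {x : Fin k → ℕ → ℝ} {i j : Fin k} (hij : i ≠ j)
    {a : ℝ} {r : ℕ} (h : rule (knowledge σ rule x r) = j) :
    meanDiff σ rule x i j a (r + 1) = meanDiff σ rule x i j a r +
      -(a / (pulls σ rule x j r + 1)) * (x j (r + 1) - (knowledge σ rule x r).1 j) := by
  have h0 : (0 : ℝ) < (pulls σ rule x j r : ℝ) + 1 := by positivity
  rw [meanDiff, meanDiff, knowledge_mean_of_eq hσ h, knowledge_mean_of_ne (h ▸ hij.symm)]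
  field_simp
  ring

lemma meanDiff_succ_of_ne {x : Fin k → ℕ → ℝ} {i j : Fin k} {a : ℝ} {r : ℕ}
    (hi : rule (knowledge σ rule x r) ≠ i) (hj : rule (knowledge σ rule x r) ≠ j) :
    meanDiff σ rule x i j a (r + 1) = meanDiff σ rule x i j a r := by
  rw [meanDiff, meanDiff, knowledge_mean_of_ne hi, knowledge_mean_of_ne hj]

open Classical in
/-- The factor of round `r + 1` in the supermartingale
`exp (-p hyp(Y) + kin · (close pulls) - kap · (rounds))`, where `Y = a (θ_i - θ_j)`. It is `1` until
both arms have been pulled `N` times. -/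
def stripFactor (μ σ : Fin k → ℝ) (rule : Knowledge k → Fin k) (i j : Fin k)
    (N a η p kin kap : ℝ) (s r : ℕ) (x : Fin k → ℕ → ℝ) (y : ℝ) : ℝ≥0∞ :=
  if r < s ∧ BothPulled σ rule x i j N r ∧ BothAccurate μ σ rule x i j η r then
    if rule (knowledge σ rule x r) = i then
      if |meanDiff σ rule x i j a r| ≤ 1 then
        ENNReal.ofReal (Real.exp (-p * (hyp (meanDiff σ rule x i j a r +
          a / (pulls σ rule x i r + 1) * (y - (knowledge σ rule x r).1 i)) -
            hyp (meanDiff σ rule x i j a r)) + kin - kap))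
      else
        ENNReal.ofReal (Real.exp (-p * (hyp (meanDiff σ rule x i j a r +
          a / (pulls σ rule x i r + 1) * (y - (knowledge σ rule x r).1 i)) -
            hyp (meanDiff σ rule x i j a r)) - kap))
    else if rule (knowledge σ rule x r) = j then
      ENNReal.ofReal (Real.exp (-p * (hyp (meanDiff σ rule x i j a r +
        -(a / (pulls σ rule x j r + 1)) * (y - (knowledge σ rule x r).1 j)) -
          hyp (meanDiff σ rule x i j a r)) - kap))
    else 1
  else 1

variable {μ : Fin k → ℝ} {N a η p kin kap : ℝ} {s : ℕ} {i j : Fin k}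

lemma measurable_pulls_real (hr : Measurable rule) (i : Fin k) (r : ℕ) :
    Measurable fun x : Fin k → ℕ → ℝ => (pulls σ rule x i r : ℝ) :=
  measurable_from_top.comp (measurable_pulls hr i r)

lemma measurable_meanDiff (hr : Measurable rule) (i j : Fin k) (a : ℝ) (r : ℕ) :
    Measurable fun x : Fin k → ℕ → ℝ => meanDiff σ rule x i j a r :=
  ((measurable_mean hr r i).sub (measurable_mean hr r j)).const_mul a

lemma measurableSet_bothPulled (hr : Measurable rule) (i j : Fin k) (N : ℝ) (r : ℕ) :
    MeasurableSet {x : Fin k → ℕ → ℝ | BothPulled σ rule x i j N r} :=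
  (measurableSet_le measurable_const (measurable_pulls_real hr i r)).inter
    (measurableSet_le measurable_const (measurable_pulls_real hr j r))

lemma measurableSet_bothAccurate (hr : Measurable rule) (i j : Fin k) (η : ℝ) (r : ℕ) :
    MeasurableSet {x : Fin k → ℕ → ℝ | BothAccurate μ σ rule x i j η r} :=
  (measurableSet_le ((measurable_const.sub (measurable_mean hr r i)).abs) measurable_const).inter
    (measurableSet_le ((measurable_const.sub (measurable_mean hr r j)).abs) measurable_const)

lemma measurable_stripFactor (hr : Measurable rule) (r : ℕ) :
    Measurable fun q : (Fin k → ℕ → ℝ) × ℝ =>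
      stripFactor μ σ rule i j N a η p kin kap s r q.1 q.2 := by
  have hY := (measurable_meanDiff (σ := σ) hr i j a r).comp
    (measurable_fst : Measurable (Prod.fst : (Fin k → ℕ → ℝ) × ℝ → _))
  have hn := fun i => (measurable_pulls_real (σ := σ) hr i r).comp
    (measurable_fst : Measurable (Prod.fst : (Fin k → ℕ → ℝ) × ℝ → _))
  have hm := fun i => (measurable_mean (σ := σ) hr r i).comp
    (measurable_fst : Measurable (Prod.fst : (Fin k → ℕ → ℝ) × ℝ → _))
  have hh := continuous_hyp.measurable
  have hstep : ∀ (i' : Fin k) (c : ℝ), Measurable fun q : (Fin k → ℕ → ℝ) × ℝ =>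
      hyp (meanDiff σ rule q.1 i j a r +
        c * (a / (pulls σ rule q.1 i' r + 1)) * (q.2 - (knowledge σ rule q.1 r).1 i')) -
          hyp (meanDiff σ rule q.1 i j a r) := fun i' c =>
    (hh.comp (hY.add (((((hn i').add_const 1).const_div a).const_mul c).mul
      (measurable_snd.sub (hm i'))))).sub (hh.comp hY)
  unfold stripFactor
  refine Measurable.ite ((MeasurableSet.const (r < s)).inter
    (measurable_fst ((measurableSet_bothPulled hr i j N r).inter
      (measurableSet_bothAccurate hr i j η r)))) ?_ measurable_const
  refine Measurable.ite (measurable_fst (measurableSet_arm hr r i)) ?_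
    (Measurable.ite (measurable_fst (measurableSet_arm hr r j)) ?_ measurable_const)
  · refine Measurable.ite (measurableSet_le hY.abs measurable_const) ?_ ?_
    · have := hstep i 1
      simp only [one_mul] at this
      exact ENNReal.measurable_ofReal.comp
        (Real.measurable_exp.comp (((this.const_mul _).add_const _).sub_const _))
    · have := hstep i 1
      simp only [one_mul] at this
      exact ENNReal.measurable_ofReal.comp (Real.measurable_exp.comp ((this.const_mul _).sub_const _))
  · have := hstep j (-1)
    simp only [neg_one_mul] at this
    exact ENNReal.measurable_ofReal.comp (Real.measurable_exp.comp ((this.const_mul _).sub_const _))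

lemma measurable_prod_stripFactor (hr : Measurable rule) (R : ℕ) :
    Measurable fun x : Fin k → ℕ → ℝ => ∏ r ∈ Finset.range R,
      stripFactor μ σ rule i j N a η p kin kap s r x
        (x (rule (knowledge σ rule x r)) (r + 1)) := by
  refine Finset.measurable_fun_prod _ fun r _ => ?_
  have h1 := measurable_stripFactor (μ := μ) (σ := σ) (rule := rule) (N := N) (a := a) (η := η)
    (p := p) (kin := kin) (kap := kap) (s := s) (i := i) (j := j) hr r
  have h2 := h1.comp (measurable_id.prodMk (measurable_observed (σ := σ) hr r))
  simp only [Function.comp_def, id] at h2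
  exact h2

lemma stripFactor_congr {r : ℕ} {x x' : Fin k → ℕ → ℝ} (h : ∀ i s, s ≤ r → x i s = x' i s) :
    stripFactor μ σ rule i j N a η p kin kap s r x =
      stripFactor μ σ rule i j N a η p kin kap s r x' := by
  funext y
  simp only [stripFactor, meanDiff, BothPulled, BothAccurate, knowledge_congr h, pulls_congr h]
  split_ifs <;> first | rfl | simp_all

/-- Smallness conditions under which `stripFactor` has conditional mean at most `1`. -/
structure StripParams (σ : Fin k → ℝ) (lo hi N a η p kin kap : ℝ) (s : ℕ) : Prop where
  lo_pos : 0 < lo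
  lo_le : ∀ i, lo ≤ σ i
  le_hi : ∀ i, σ i ≤ hi
  N_pos : 0 < N
  a_pos : 0 < a
  p_nonneg : 0 ≤ p
  p_le : p ≤ 1 / 2
  kap_le : kap ≤ 1 / 2
  drift : p * (a / N) * η + p ^ 2 * (a / N) ^ 2 * hi ^ 2 / 2 ≤ kap
  eta_le : η ≤ lo / 2
  step_le : a / N * hi ≤ 2 / 5
  kin_le : kin ≤ p * (a / s) ^ 2 * lo ^ 2 / 320 * gaussBlock

lemma lintegral_stripFactor_le {lo hi : ℝ} (hP : StripParams σ lo hi N a η p kin kap s)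
    (r : ℕ) (x : Fin k → ℕ → ℝ) (l : Fin k) (hl : rule (knowledge σ rule x r) = l) :
    ∫⁻ y, stripFactor μ σ rule i j N a η p kin kap s r x y
      ∂gaussianReal (μ l) (Real.toNNReal (σ l ^ 2)) ≤ 1 := by
  obtain ⟨hlo, hloσ, hσhi, hN, ha, hp, hp1, hkap1, hdrift, heta, hstep, hkin⟩ := hP
  unfold stripFactor
  split_ifs with h1 h2 h3 h4
  all_goals try simp only [lintegral_one, measure_univ, le_refl]
  all_goals obtain ⟨hrs, hpull, hacc⟩ := h1
  all_goals
    have hnN : N ≤ pulls σ rule x l r := by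
      first
      | exact (h2.symm.trans hl) ▸ hpull.1
      | exact (h4.symm.trans hl) ▸ hpull.2
    have hac : |μ l - (knowledge σ rule x r).1 l| ≤ η := by
      first
      | exact (h2.symm.trans hl) ▸ hacc.1
      | exact (h4.symm.trans hl) ▸ hacc.2
    have hσl := hlo.trans_le (hloσ l)
    have hτ0 : 0 < a / (pulls σ rule x l r + 1) := by positivity
    have hτ1 : a / (pulls σ rule x l r + 1) ≤ a / N := by gcongr; linarith
    have hdr : p * |a / (pulls σ rule x l r + 1)| * |μ l - (knowledge σ rule x r).1 l| +
        p ^ 2 * (a / (pulls σ rule x l r + 1)) ^ 2 * σ l ^ 2 / 2 ≤ kap := by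
      refine le_trans ?_ hdrift
      rw [abs_of_pos hτ0]
      gcongr
      exact hσhi l
  · have hi' : i = l := h2.symm.trans hl
    subst hi'
    refine lintegral_exp_hyp_le_of_abs_le hσl hp hp1 h3 hkap1 hdr ?_ ?_ ?_
    · linarith [hloσ i]
    · rw [abs_of_pos hτ0]
      refine le_trans ?_ hstep
      gcongr
      exact hσhi i
    · refine hkin.trans ?_
      have hg := gaussBlock_pos
      have hsr : (pulls σ rule x i r : ℝ) + 1 ≤ s := by
        have := pulls_le (σ := σ) (rule := rule) (x := x) i r
        exact_mod_cast (by omega : pulls σ rule x i r + 1 ≤ s)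
      gcongr
      exact hloσ i
  · have hi' : i = l := h2.symm.trans hl
    subst hi'
    exact lintegral_exp_hyp_le hp hdr
  · have hj' : j = l := h4.symm.trans hl
    subst hj'
    refine lintegral_exp_hyp_le hp ?_
    rwa [abs_neg, neg_sq]

/-- On paths along which both means stay accurate, the product of the factors telescopes. -/
lemma le_prod_stripFactor (hσ : ∀ i, 0 < σ i) (hij : i ≠ j) (hp : 0 ≤ p) (hkap : 0 ≤ kap)
    {x : Fin k → ℕ → ℝ}
    (hacc : ∀ r < s, BothPulled σ rule x i j N r → BothAccurate μ σ rule x i j η r)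
    (R : ℕ) (hR : R ≤ s) :
    (BothPulled σ rule x i j N R →
      ENNReal.ofReal (Real.exp (-p * hyp (meanDiff σ rule x i j a R) +
        kin * closePulls σ rule x i j N a R - kap * R)) ≤
      ∏ r ∈ Finset.range R, stripFactor μ σ rule i j N a η p kin kap s r x
        (x (rule (knowledge σ rule x r)) (r + 1))) ∧
    (¬ BothPulled σ rule x i j N R →
      ∏ r ∈ Finset.range R, stripFactor μ σ rule i j N a η p kin kap s r x
        (x (rule (knowledge σ rule x r)) (r + 1)) = 1) := by
  classical
  induction R with
  | zero =>
    refine ⟨fun _ => ?_, fun _ => by simp⟩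
    simp only [closePulls, Finset.range_zero, Finset.filter_empty, Finset.card_empty,
      Finset.prod_empty]
    rw [← ENNReal.ofReal_one]
    refine ENNReal.ofReal_le_ofReal (Real.exp_le_one_iff.2 ?_)
    have := mul_nonneg hp (hyp_pos (meanDiff σ rule x i j a 0)).le
    push_cast
    linarith
  | succ R ih =>
    obtain ⟨ih1, ih2⟩ := ih (by omega)
    rw [Finset.prod_range_succ]
    by_cases hb : BothPulled σ rule x i j N R
    · refine ⟨fun _ => ?_, fun h => absurd (hb.mono (Nat.le_succ R)) h⟩
      refine le_trans ?_ (mul_le_mul_left (ih1 hb) _)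
      have hs : R < s ∧ BothPulled σ rule x i j N R ∧ BothAccurate μ σ rule x i j η R :=
        ⟨by omega, hb, hacc R (by omega) hb⟩
      rw [stripFactor, if_pos hs, closePulls_succ]
      by_cases h1 : rule (knowledge σ rule x R) = i
      · rw [if_pos h1, h1, ← meanDiff_succ_left hσ hij h1]
        by_cases h2 : |meanDiff σ rule x i j a R| ≤ 1
        · rw [if_pos h2, if_pos ⟨rfl, hb, h2⟩, ← ENNReal.ofReal_mul (Real.exp_pos _).le,
            ← Real.exp_add]
          refine ENNReal.ofReal_le_ofReal (Real.exp_le_exp.2 (le_of_eq ?_))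
          push_cast; ring
        · rw [if_neg h2, if_neg (fun h => h2 h.2.2), ← ENNReal.ofReal_mul (Real.exp_pos _).le,
            ← Real.exp_add]
          refine ENNReal.ofReal_le_ofReal (Real.exp_le_exp.2 (le_of_eq ?_))
          push_cast; ring
      · rw [if_neg h1, if_neg (fun h => h1 h.1)]
        by_cases h2 : rule (knowledge σ rule x R) = j
        · rw [if_pos h2, h2, ← meanDiff_succ_right hσ hij h2,
            ← ENNReal.ofReal_mul (Real.exp_pos _).le, ← Real.exp_add]
          refine ENNReal.ofReal_le_ofReal (Real.exp_le_exp.2 (le_of_eq ?_))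
          push_cast; ring
        · rw [if_neg h2, meanDiff_succ_of_ne h1 h2, mul_one]
          refine ENNReal.ofReal_le_ofReal (Real.exp_le_exp.2 ?_)
          push_cast; linarith
    · rw [ih2 hb, one_mul, stripFactor, if_neg (fun h => hb h.2.1)]
      refine ⟨fun h => ?_, fun _ => rfl⟩
      rw [closePulls_succ, closePulls_eq_zero hb, if_neg (fun h => hb h.2.1), ← ENNReal.ofReal_one]
      refine ENNReal.ofReal_le_ofReal (Real.exp_le_one_iff.2 ?_)
      have h1 := mul_nonneg hp (hyp_pos (meanDiff σ rule x i j a (R + 1))).le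
      have h2 : 0 ≤ kap * ((R + 1 : ℕ) : ℝ) := by positivity
      simp only [add_zero, Nat.cast_zero, mul_zero]
      linarith

variable {Ω : Type*} [MeasurableSpace Ω] {P : Measure Ω} {X : Fin k → ℕ → Ω → ℝ}

/-- Two arms whose means are accurately known rarely have many close pulls. -/
lemma measure_closePulls_le [IsProbabilityMeasure P]
    (hX : ∀ i t, Measurable (X i t))
    (hlaw : ∀ i t, P.map (X i t) = gaussianReal (μ i) (Real.toNNReal (σ i ^ 2)))
    (hindep : iIndepFun (fun (p : Fin k × ℕ) => X p.1 p.2) P) (hr : Measurable rule)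
    {lo hi : ℝ} (hP : StripParams σ lo hi N a η p kin kap s) (hkap : 0 ≤ kap) (hkin : 0 ≤ kin)
    (hkin1 : kin ≤ 1) (hij : i ≠ j) {c : ℝ} (hc : 0 < c) :
    P {ω | (∀ r < s, BothPulled σ rule (fun i s => X i s ω) i j N r →
        BothAccurate μ σ rule (fun i s => X i s ω) i j η r) ∧
        c ≤ closePulls σ rule (fun i s => X i s ω) i j N a s} ≤
      ENNReal.ofReal (s * Real.exp (2 - kin * c + kap * s)) := by
  have hσ : ∀ i, 0 < σ i := fun i => hP.lo_pos.trans_le (hP.lo_le i)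
  set Z : ℕ → (Fin k → ℕ → ℝ) → ℝ≥0∞ := fun R x => ∏ r ∈ Finset.range R,
    stripFactor μ σ rule i j N a η p kin kap s r x (x (rule (knowledge σ rule x r)) (r + 1)) with hZ
  set v := ENNReal.ofReal (Real.exp (-(2 - kin * c + kap * s))) with hv
  have hsub : {ω | (∀ r < s, BothPulled σ rule (fun i s => X i s ω) i j N r →
        BothAccurate μ σ rule (fun i s => X i s ω) i j η r) ∧
        c ≤ closePulls σ rule (fun i s => X i s ω) i j N a s} ⊆
      ⋃ R ∈ Finset.range s, {ω | v ≤ Z R (fun i s => X i s ω)} := by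
    rintro ω ⟨hacc, hcl⟩
    have h1 : 1 ≤ closePulls σ rule (fun i s => X i s ω) i j N a s := by
      have : (0 : ℝ) < closePulls σ rule (fun i s => X i s ω) i j N a s := hc.trans_le hcl
      exact_mod_cast this
    obtain ⟨R, hRs, hb, hY, hcR⟩ := exists_last_closePull h1
    simp only [Set.mem_iUnion, Finset.mem_range, exists_prop]
    refine ⟨R, hRs, ?_⟩
    refine le_trans (ENNReal.ofReal_le_ofReal (Real.exp_le_exp.2 ?_))
      ((le_prod_stripFactor hσ hij hP.p_nonneg hkap hacc R hRs.le).1 hb)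
    rw [hcR] at hcl
    push_cast at hcl
    have h2 : hyp (meanDiff σ rule (fun i s => X i s ω) i j a R) ≤ 2 := by
      refine (abs_le_of_sq_le_sq' ?_ (by norm_num)).2
      rw [hyp_sq, ← sq_abs]
      linarith [pow_le_one₀ (n := 2) (abs_nonneg _) hY]
    have h3 : kap * R ≤ kap * s := by gcongr
    have h4 := mul_le_mul_of_nonneg_left hcl hkin
    have h5 := mul_le_mul hP.p_le h2 (hyp_pos _).le (by norm_num)
    rw [mul_add, mul_one] at h4
    linarith
  have hone : ∀ R, P {ω | v ≤ Z R (fun i s => X i s ω)} ≤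
      ENNReal.ofReal (Real.exp (2 - kin * c + kap * s)) := by
    intro R
    have h := lintegral_prod_le_one hX hlaw hindep hr
      (fun r => stripFactor μ σ rule i j N a η p kin kap s r)
      (fun r => measurable_stripFactor hr r) (fun r x x' h => stripFactor_congr h)
      (fun r x l hl => lintegral_stripFactor_le hP r x l hl) R
    have hXm : Measurable fun ω => fun i s => X i s ω :=
      measurable_pi_lambda _ fun i => measurable_pi_lambda _ fun s => hX i s
    have hZm : Measurable (Z R) := measurable_prod_stripFactor hr R
    have h2 : ∫⁻ ω, (Z R ∘ fun ω => fun i s => X i s ω) ω ∂P ≤ 1 := by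
      simpa only [hZ, Function.comp_def] using h
    have h3 := measure_exp_le_of_lintegral_le_one (hZm.comp hXm) h2 (-(2 - kin * c + kap * s))
    rw [neg_neg] at h3
    exact h3
  refine (measure_mono hsub).trans ((measure_biUnion_finset_le _ _).trans
    ((Finset.sum_le_sum fun R _ => hone R).trans (le_of_eq ?_)))
  rw [Finset.sum_const, Finset.card_range, nsmul_eq_mul, ENNReal.ofReal_mul (by positivity),
    ENNReal.ofReal_natCast]

end

open Filter

section

variable {k : ℕ} {σ : Fin k → ℝ} {rule : Knowledge k → Fin k}

/-! ### Asymptotics of the error terms -/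

lemma eventually_le_mul_rpow (c₁ : ℝ) {c α β : ℝ} (hc : 0 < c) (h : α < β) :
    ∀ᶠ s : ℕ in atTop, c₁ * (s : ℝ) ^ α ≤ c * (s : ℝ) ^ β := by
  have h1 := ((tendsto_rpow_atTop (sub_pos.2 h)).comp
    tendsto_natCast_atTop_atTop).eventually_ge_atTop (c₁ / c)
  filter_upwards [h1, eventually_gt_atTop 0] with s hs hs0
  have hs0' : (0 : ℝ) < s := by exact_mod_cast hs0
  have e : (s : ℝ) ^ β = (s : ℝ) ^ (β - α) * (s : ℝ) ^ α := by
    rw [← Real.rpow_add hs0']; congr 1; ring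
  rw [e, ← mul_assoc]
  have h2 : c₁ / c ≤ (s : ℝ) ^ (β - α) := hs
  have h3 : c₁ ≤ c * (s : ℝ) ^ (β - α) := by
    rw [div_le_iff₀ hc] at h2; linarith
  gcongr

lemma eventually_le_rpow (c₁ : ℝ) {c β : ℝ} (hc : 0 < c) (h : 0 < β) :
    ∀ᶠ s : ℕ in atTop, c₁ ≤ c * (s : ℝ) ^ β := by
  simpa using eventually_le_mul_rpow c₁ hc h

lemma eventually_le_linear (c₁ : ℝ) {c : ℝ} (hc : 0 < c) :
    ∀ᶠ s : ℕ in atTop, c₁ ≤ c * (s : ℝ) := by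
  simpa using eventually_le_rpow c₁ hc one_pos

lemma gradErr_mono {K : ℝ} (hK : 1 ≤ K) {r s : ℕ} (h : r ≤ s) : gradErr K r ≤ gradErr K s := by
  have : (r : ℝ) ≤ s := by exact_mod_cast h
  unfold gradErr
  gcongr

lemma eventually_gradErr_le {K : ℝ} (hK : 1 ≤ K) {c α : ℝ} (hc : 0 < c) (hα : 0 < α) :
    ∀ᶠ s : ℕ in atTop, gradErr K s ≤ c * (s : ℝ) ^ α := by
  have h1 := ((isLittleO_log_rpow_atTop (r := 2 * α) (by positivity)).bound
    (show 0 < (c / 2) ^ 2 / 4 by positivity))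
  have h2 := tendsto_natCast_atTop_atTop.eventually h1
  filter_upwards [h2, eventually_le_rpow 2 (half_pos hc) hα, eventually_le_linear (2 * K) one_pos,
    eventually_ge_atTop 1] with s h3 h4 h5 hs
  have hs1 : (1 : ℝ) ≤ s := by exact_mod_cast hs
  have h6 : Real.log (K * (s + 1)) ≤ 2 * Real.log s := by
    have : K * ((s : ℝ) + 1) ≤ (s : ℝ) ^ 2 := by nlinarith
    calc Real.log (K * (s + 1)) ≤ Real.log ((s : ℝ) ^ 2) := Real.log_le_log (by positivity) this
      _ = 2 * Real.log s := by rw [Real.log_pow]; norm_num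
  rw [Real.norm_of_nonneg (Real.log_nonneg hs1), Real.norm_of_nonneg (by positivity)] at h3
  have h7 : √(2 * Real.log (K * (s + 1))) ≤ c / 2 * (s : ℝ) ^ α := by
    refine Real.sqrt_le_iff.2 ⟨by positivity, ?_⟩
    have : (c / 2 * (s : ℝ) ^ α) ^ 2 = (c / 2) ^ 2 * (s : ℝ) ^ (2 * α) := by
      rw [mul_pow, ← Real.rpow_natCast ((s : ℝ) ^ α), ← Real.rpow_mul (by positivity)]
      congr 2
      push_cast; ring
    rw [this]
    linarith
  unfold gradErr
  linarith

/-! ### Every arm is pulled often -/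

lemma exists_pulls_ge (hk : 2 ≤ k) (x : Fin k → ℕ → ℝ) (s : ℕ) :
    ∃ i, (s : ℝ) / k ≤ pulls σ rule x i s := by
  by_contra! h
  have : Nonempty (Fin k) := ⟨⟨0, by omega⟩⟩
  have h1 : ∑ i, (pulls σ rule x i s : ℝ) < ∑ _i : Fin k, (s : ℝ) / k :=
    Finset.sum_lt_sum_of_nonempty Finset.univ_nonempty fun i _ => h i
  have hk0 : (k : ℝ) ≠ 0 := by positivity
  rw [← Nat.cast_sum, sum_pulls, Finset.sum_const, Finset.card_univ, Fintype.card_fin,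
    nsmul_eq_mul, mul_div_cancel₀ _ hk0] at h1
  exact lt_irrefl _ h1

lemma exists_last_pull {x : Fin k → ℕ → ℝ} {i : Fin k} {s : ℕ} (h : 1 ≤ pulls σ rule x i s) :
    ∃ r < s, rule (knowledge σ rule x r) = i ∧ pulls σ rule x i s = pulls σ rule x i r + 1 := by
  induction s with
  | zero => simp [pulls_zero] at h
  | succ s ih =>
    rw [pulls_succ] at h ⊢
    split_ifs at h ⊢ with h1
    · exact ⟨s, by omega, h1, rfl⟩
    · obtain ⟨r, hr, h2⟩ := ih h
      exact ⟨r, by omega, h2⟩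

/-- If every late pull of arm `i` is a close pull with some partner, then there are about as many
close pulls as pulls. -/
lemma pulls_le_sum_closePulls {x : Fin k → ℕ → ℝ} {i : Fin k} {N a M : ℝ} {s : ℕ} (hM : 0 ≤ M)
    (h : ∀ r < s, rule (knowledge σ rule x r) = i → M ≤ pulls σ rule x i r →
      ∃ j, j ≠ i ∧ BothPulled σ rule x i j N r ∧ |meanDiff σ rule x i j a r| ≤ 1)
    (R : ℕ) (hR : R ≤ s) :
    (pulls σ rule x i R : ℝ) ≤
      M + 1 + ∑ j ∈ Finset.univ.erase i, (closePulls σ rule x i j N a R : ℝ) := by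
  classical
  induction R with
  | zero =>
    rw [pulls_zero]
    push_cast
    positivity
  | succ R ih =>
    have ih' := ih (by omega)
    rw [pulls_succ]
    simp only [closePulls_succ]
    push_cast
    rw [Finset.sum_add_distrib]
    have hnn : ∀ j, (0 : ℝ) ≤ if rule (knowledge σ rule x R) = i ∧ BothPulled σ rule x i j N R ∧
        |meanDiff σ rule x i j a R| ≤ 1 then (1 : ℝ) else 0 := fun j => by split_ifs <;> norm_num
    have hs := Finset.sum_nonneg (s := Finset.univ.erase i) fun j _ => hnn j
    split_ifs with h1
    · rcases lt_or_ge (pulls σ rule x i R : ℝ) M with h2 | h2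
      · have h3 : (0 : ℝ) ≤ ∑ j ∈ Finset.univ.erase i, (closePulls σ rule x i j N a R : ℝ) := by
          positivity
        linarith
      · obtain ⟨j, hj, hb, hY⟩ := h R (by omega) h1 h2
        have h3 := Finset.single_le_sum (s := Finset.univ.erase i) (fun j _ => hnn j)
          (Finset.mem_erase.2 ⟨hj, Finset.mem_univ j⟩)
        rw [if_pos ⟨h1, hb, hY⟩] at h3
        linarith
    · linarith

variable {μ : Fin k → ℝ}

/-- If some arm `a` has fewer than `m` pulls and another one at least `m`, then an arm with fewer
than `m` pulls has `n Δ` of order `m`. This arm is `a`, unless the largest posterior mean is far too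
large; then it is the arm with that mean, which must have been pulled rarely. -/
lemma exists_mul_gapOf_le (hk : 2 ≤ k) {B m : ℝ} (hB : ∀ i, |μ i| ≤ B) (hm : 0 < m)
    {x : Fin k → ℕ → ℝ} {r : ℕ}
    (hE : ∀ i, (pulls σ rule x i r : ℝ) * |(knowledge σ rule x r).1 i - μ i| ≤
      pulls σ rule x i r + m)
    {i a : Fin k} (hi : m ≤ pulls σ rule x i r) (ha : (pulls σ rule x a r : ℝ) < m) :
    ∃ j, (pulls σ rule x j r : ℝ) * gapOf (knowledge σ rule x r).1 j ≤ (2 * B + 4) * m := by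
  set th := (knowledge σ rule x r).1 with hth
  have hB0 : 0 ≤ B := (abs_nonneg _).trans (hB i)
  have hacc : ∀ j, m ≤ pulls σ rule x j r → |th j| ≤ B + 2 := fun j hj => by
    have h1 : (pulls σ rule x j r : ℝ) * |th j - μ j| ≤ pulls σ rule x j r * 2 :=
      (hE j).trans (by linarith)
    have h2 := le_of_mul_le_mul_left h1 (hm.trans_le hj)
    have h3 := abs_sub_abs_le_abs_sub (th j) (μ j)
    linarith [hB j]
  have hmain : ∀ j, (pulls σ rule x j r : ℝ) < m → maxOther th j ≤ max (th j) (B + 2) →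
      (pulls σ rule x j r : ℝ) * gapOf th j ≤ (2 * B + 4) * m := by
    intro j hj hmax
    have hne : i ≠ j := by rintro rfl; linarith
    have h1 : -(B + 2) ≤ maxOther th j := (abs_le.1 (hacc i hi)).1.trans (le_maxOther th hne)
    have h2 : gapOf th j ≤ |th j - μ j| + (2 * B + 2) := by
      have h3 := hB j
      have h4 := le_abs_self (th j - μ j)
      have h5 := neg_abs_le (th j - μ j)
      rw [abs_le] at h3
      unfold gapOf
      rw [abs_le]
      constructor
      · rcases max_cases (th j) (B + 2) with ⟨h6, _⟩ | ⟨h6, _⟩ <;> rw [h6] at hmax <;> linarith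
      · linarith
    have h0 : (0 : ℝ) ≤ pulls σ rule x j r := by positivity
    nlinarith [hE j, mul_le_mul_of_nonneg_left h2 h0]
  have : Nonempty (Fin k) := ⟨i⟩
  obtain ⟨p, hp⟩ := Finite.exists_max th
  rcases le_or_gt (th p) (B + 2) with h | h
  · exact ⟨a, hmain a ha (maxOther_le hk fun j _ => ((hp j).trans h).trans (le_max_right _ _))⟩
  · refine ⟨p, hmain p ?_ (maxOther_le hk fun j _ => (hp j).trans (le_max_left _ _))⟩
    by_contra! hc
    linarith [hacc p hc, le_abs_self (th p)]

/-- Without many close pulls, all arms have been pulled at least `s ^ (3 / 11)` times: otherwise,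
by `exists_mul_gapOf_le`, all late pulls of the most pulled arm would be close pulls. -/
lemma eventually_rpow_le_pulls (hk : 2 ≤ k) (hrule : IsKGRule σ rule) {lo hi K B : ℝ}
    (hlo : 0 < lo) (hloσ : ∀ i, lo ≤ σ i) (hσhi : ∀ i, σ i ≤ hi) (hK1 : 1 ≤ K)
    (hK : ∀ i j, σ i ≤ K * σ j) (hB : ∀ i, |μ i| ≤ B) :
    ∃ C : ℝ, 0 < C ∧ ∀ᶠ s : ℕ in atTop, ∀ x : Fin k → ℕ → ℝ,
      (∀ r ≤ s, ∀ i, (pulls σ rule x i r : ℝ) * |(knowledge σ rule x r).1 i - μ i| ≤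
        pulls σ rule x i r + (s : ℝ) ^ (3 / 11 : ℝ)) →
      (∀ i j, i ≠ j → (closePulls σ rule x i j (s / (4 * k * K))
        (s / (C * (s : ℝ) ^ (3 / 11 : ℝ))) s : ℝ) < s / (4 * k ^ 2)) →
      ∀ i, (s : ℝ) ^ (3 / 11 : ℝ) ≤ pulls σ rule x i s := by
  have hσ : ∀ i, 0 < σ i := fun i => hlo.trans_le (hloσ i)
  have hk0 : (0 : ℝ) < k := by positivity
  have i0 : Fin k := ⟨0, by omega⟩
  have hhi : 0 < hi := (hσ i0).trans_le (hσhi i0)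
  have hB0 : 0 ≤ B := (abs_nonneg _).trans (hB i0)
  refine ⟨2 * k * (hi * (2 * (2 * B + 4) / lo + 1)), by positivity, ?_⟩
  set C := 2 * k * (hi * (2 * (2 * B + 4) / lo + 1)) with hC
  filter_upwards [eventually_gradErr_le hK1 one_pos (show (0 : ℝ) < 3 / 11 by norm_num),
    eventually_le_mul_rpow 1 (show (0 : ℝ) < 1 / (2 * k) by positivity)
      (show (3 / 11 : ℝ) < 1 by norm_num),
    eventually_le_linear 1 (show (0 : ℝ) < 1 / (4 * k * K) by positivity),
    eventually_le_linear 2 (show (0 : ℝ) < 1 / (4 * k) by positivity),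
    eventually_ge_atTop 1] with s hgrad hm2 hs2 hs3 hs1 x hE hF
  have hs0 : (0 : ℝ) < s := by exact_mod_cast hs1
  set m := (s : ℝ) ^ (3 / 11 : ℝ) with hm
  have hm0 : 0 < m := by positivity
  rw [one_mul] at hgrad hm2
  rw [Real.rpow_one] at hm2
  intro a
  by_contra! ha
  obtain ⟨i, hi'⟩ := exists_pulls_ge (σ := σ) (rule := rule) hk x s
  have hclose : ∀ r < s, rule (knowledge σ rule x r) = i →
      1 / (2 * k) * (s : ℝ) ≤ pulls σ rule x i r →
      ∃ j, j ≠ i ∧ BothPulled σ rule x i j (s / (4 * k * K)) r ∧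
        |meanDiff σ rule x i j (s / (C * m)) r| ≤ 1 := by
    intro r hrs hri hn
    have hnm := hm2.trans hn
    have hn0 : (0 : ℝ) < pulls σ rule x i r := hm0.trans_le hnm
    have hn1 : 1 ≤ pulls σ rule x i r := by exact_mod_cast hn0
    have har : (pulls σ rule x a r : ℝ) < m :=
      lt_of_le_of_lt (by exact_mod_cast pulls_mono a hrs.le) ha
    obtain ⟨j', hj'⟩ := exists_mul_gapOf_le hk hB hm0 (hE r hrs.le) hnm har
    have hj1 := (value_le_of_pulled hσ hrule hri hn1 j').1
    have hj1' : (1 : ℝ) ≤ pulls σ rule x j' r := by exact_mod_cast hj1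
    have hidx := index_le_of_pulled hσ hrule hK1 hK hri hn1 j'
    obtain ⟨j, hji, hgap, hnj⟩ := exists_competitor hk hσ hrule hK1 hK hri hn1
    have hKn : (s : ℝ) / (4 * k * K) ≤ pulls σ rule x j r := by
      have h1 : 1 / (2 * k) * (s : ℝ) ≤ K * (pulls σ rule x j r + 1) := hn.trans hnj
      have h2 : 1 / (2 * k) * (s : ℝ) = K * (2 * (1 / (4 * k * K) * s)) := by field_simp; norm_num
      rw [h2] at h1
      have h3 := le_of_mul_le_mul_left h1 (by linarith)
      have h4 : (s : ℝ) / (4 * k * K) = 1 / (4 * k * K) * s := by ring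
      rw [h4]
      linarith
    refine ⟨j, hji, ⟨le_trans ?_ hn, hKn⟩, ?_⟩
    · rw [div_mul_eq_mul_div, one_mul]
      exact div_le_div_of_nonneg_left hs0.le (by positivity) (by nlinarith)
    · have hg := gapOf_nonneg (knowledge σ rule x r).1 i
      have h1 : ((pulls σ rule x j' r : ℝ) + 1) * gapOf (knowledge σ rule x r).1 j' / σ j' ≤
          2 * (2 * B + 4) / lo * m := by
        have hg' := gapOf_nonneg (knowledge σ rule x r).1 j'
        have h2 : ((pulls σ rule x j' r : ℝ) + 1) * gapOf (knowledge σ rule x r).1 j' ≤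
            2 * ((2 * B + 4) * m) := by nlinarith
        calc _ ≤ 2 * ((2 * B + 4) * m) / lo := by gcongr; exact hloσ j'
          _ = _ := by ring
      have h2 : gradErr K r ≤ m := (gradErr_mono hK1 hrs.le).trans hgrad
      have h3 : 1 / (2 * k) * (s : ℝ) * gapOf (knowledge σ rule x r).1 i / hi ≤
          2 * (2 * B + 4) / lo * m + m := by
        refine le_trans ?_ (hidx.trans (add_le_add h1 h2))
        have := hσ i
        gcongr
        exact hσhi i
      have h4 : s * gapOf (knowledge σ rule x r).1 i ≤ C * m := by
        rw [div_le_iff₀ hhi] at h3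
        have e : s * gapOf (knowledge σ rule x r).1 i =
            2 * k * (1 / (2 * k) * (s : ℝ) * gapOf (knowledge σ rule x r).1 i) := by
          field_simp
        rw [e]
        calc _ ≤ 2 * k * ((2 * (2 * B + 4) / lo * m + m) * hi) := by gcongr
          _ = C * m := by rw [hC]; ring
      rw [meanDiff, abs_mul, hgap, abs_of_pos (by positivity), div_mul_eq_mul_div,
        div_le_one (by positivity)]
      exact h4
  have hcount := pulls_le_sum_closePulls (by positivity) hclose s le_rfl
  have hsum : ∑ j ∈ Finset.univ.erase i, (closePulls σ rule x i j (s / (4 * k * K))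
      (s / (C * m)) s : ℝ) ≤ k * (s / (4 * k ^ 2)) := by
    calc _ ≤ ∑ _j ∈ Finset.univ.erase i, (s : ℝ) / (4 * k ^ 2) :=
          Finset.sum_le_sum fun j hj => (hF i j (Finset.ne_of_mem_erase hj).symm).le
      _ ≤ ∑ _j : Fin k, (s : ℝ) / (4 * k ^ 2) :=
          Finset.sum_le_sum_of_subset_of_nonneg (Finset.erase_subset _ _)
            fun _ _ _ => by positivity
      _ = _ := by simp
  have e1 : (s : ℝ) / k = 4 * (1 / (4 * k) * s) := by field_simp
  have e2 : (k : ℝ) * (s / (4 * k ^ 2)) = 1 / (4 * k) * s := by field_simp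
  have e3 : 1 / (2 * k) * (s : ℝ) = 2 * (1 / (4 * k) * s) := by field_simp; norm_num
  rw [e1] at hi'
  rw [e2] at hsum
  rw [e3] at hcount
  linarith

/-! ### Accurate means -/

lemma abs_maxOther_sub_le (hk : 2 ≤ k) {th μ : Fin k → ℝ} {δ : ℝ} (h : ∀ j, |th j - μ j| ≤ δ)
    (i : Fin k) : |maxOther th i - maxOther μ i| ≤ δ := by
  have h1 : maxOther th i ≤ maxOther μ i + δ := maxOther_le hk fun j hj => by
    linarith [le_maxOther μ hj, (abs_le.1 (h j)).2]
  have h2 : maxOther μ i ≤ maxOther th i + δ := maxOther_le hk fun j hj => by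
    linarith [le_maxOther th hj, (abs_le.1 (h j)).1]
  rw [abs_le]
  constructor <;> linarith

lemma abs_gapOf_sub_le (hk : 2 ≤ k) {th μ : Fin k → ℝ} {δ : ℝ} (h : ∀ j, |th j - μ j| ≤ δ)
    (i : Fin k) : |gapOf th i - gapOf μ i| ≤ 2 * δ := by
  refine (abs_abs_sub_abs_le_abs_sub _ _).trans ?_
  have h1 := abs_maxOther_sub_le hk h i
  have h2 := h i
  rw [abs_le] at h1 h2 ⊢
  constructor <;> linarith

lemma maxOther_lt (hk : 2 ≤ k) {b : Fin k} (hb : ∀ i, i ≠ b → μ i < μ b) :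
    maxOther μ b < μ b := by
  obtain ⟨j, hj, e⟩ := exists_eq_maxOther hk μ b
  exact e ▸ hb j hj

lemma maxOther_of_ne (hk : 2 ≤ k) {b : Fin k} (hb : ∀ i, i ≠ b → μ i < μ b) {i : Fin k}
    (hi : i ≠ b) : maxOther μ i = μ b := by
  refine le_antisymm (maxOther_le hk fun j _ => ?_) (le_maxOther μ hi.symm)
  by_cases h : j = b
  · rw [h]
  · exact (hb j h).le

lemma gapOf_best (hk : 2 ≤ k) {b : Fin k} (hb : ∀ i, i ≠ b → μ i < μ b) :
    gapOf μ b = μ b - maxOther μ b :=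
  abs_of_pos (sub_pos.2 (maxOther_lt hk hb))

lemma gapOf_of_ne (hk : 2 ≤ k) {b : Fin k} (hb : ∀ i, i ≠ b → μ i < μ b) {i : Fin k}
    (hi : i ≠ b) : gapOf μ i = μ b - μ i := by
  rw [gapOf, maxOther_of_ne hk hb hi, abs_of_neg (sub_neg.2 (hb i hi)), neg_sub]

lemma gapOf_best_le (hk : 2 ≤ k) {b : Fin k} (hb : ∀ i, i ≠ b → μ i < μ b) (i : Fin k) :
    gapOf μ b ≤ gapOf μ i := by
  by_cases hi : i = b
  · rw [hi]
  · rw [gapOf_best hk hb, gapOf_of_ne hk hb hi]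
    linarith [le_maxOther μ hi]

lemma gapOf_le (hk : 2 ≤ k) {B : ℝ} (hB : ∀ i, |μ i| ≤ B) (i : Fin k) : gapOf μ i ≤ 2 * B := by
  obtain ⟨j, -, e⟩ := exists_eq_maxOther hk μ i
  rw [gapOf, ← e]
  linarith [abs_sub (μ i) (μ j), hB i, hB j]

/-- Balance of pulls: at the last pull of arm `i` its `n Δ / σ` was nearly minimal. -/
lemma pulls_balance (hk : 2 ≤ k) (hσ : ∀ i, 0 < σ i) (hrule : IsKGRule σ rule) {K : ℝ}
    (hK1 : 1 ≤ K) (hK : ∀ i j, σ i ≤ K * σ j) {x : Fin k → ℕ → ℝ} {t : ℕ} {i j : Fin k} {δ : ℝ}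
    (hi : 2 ≤ pulls σ rule x i t)
    (hacc : ∀ r ≤ t, (pulls σ rule x i t : ℝ) - 1 ≤ r →
      ∀ l, |(knowledge σ rule x r).1 l - μ l| ≤ δ) :
    ((pulls σ rule x i t : ℝ) - 1) * (gapOf μ i - 2 * δ) / σ i ≤
      ((pulls σ rule x j t : ℝ) + 1) * (gapOf μ j + 2 * δ) / σ j + gradErr K t := by
  obtain ⟨r, hrt, hri, hn⟩ := exists_last_pull (by omega : 1 ≤ pulls σ rule x i t)
  have hidx := index_le_of_pulled hσ hrule hK1 hK hri (by omega) j
  have hle : (pulls σ rule x i t : ℝ) - 1 ≤ r := by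
    have := pulls_le (σ := σ) (rule := rule) (x := x) i r
    rw [hn]; push_cast; simpa using this
  have ha := hacc r hrt.le hle
  have hgi := (abs_le.1 (abs_gapOf_sub_le hk ha i)).1
  have hgj := (abs_le.1 (abs_gapOf_sub_le hk ha j)).2
  have hsi := hσ i
  have hsj := hσ j
  have hnj : (pulls σ rule x j r : ℝ) ≤ pulls σ rule x j t := by
    exact_mod_cast pulls_mono j hrt.le
  have e : (pulls σ rule x i t : ℝ) - 1 = pulls σ rule x i r := by rw [hn]; push_cast; ring
  rw [e]
  have hg := gapOf_nonneg (knowledge σ rule x r).1 j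
  calc _ ≤ (pulls σ rule x i r : ℝ) * gapOf (knowledge σ rule x r).1 i / σ i := by
        gcongr; linarith
    _ ≤ _ := hidx
    _ ≤ _ := by
        refine add_le_add ?_ (gradErr_mono hK1 hrt.le)
        gcongr
        linarith

end

section

variable {k : ℕ} {σ : Fin k → ℝ} {rule : Knowledge k → Fin k} {μ : Fin k → ℝ}

/-! ### Sampling rates on typical paths -/

/-- Paths that are typical up to time `s`: the posterior means are close to the true means, both
for arms with `s ^ (3 / 11)` pulls and, more accurately, for arms with order `s` pulls, and no pair
of arms has many close pulls. The constants `ε`, `C` and `K` depend on the instance only.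

On the choice of the exponents: as `3 / 11 > 1 / 4`, the failure probability
`exp (-d s ^ (3 / 11))` is smaller than `q`. As `3 / 11 ≤ 1 / 3`, staying in a strip of relative
width `s ^ (3 / 11) / s` for order `s` rounds costs a factor `exp (-d s ^ (1 - 6 / 11))`, which is
small enough, and the drift that errors `s ^ (-4 / 11)` of the means give to the walk is negligible
since `4 / 11 > 3 / 11`. As `4 / 11 > 1 / 4`, an error `s ^ (-4 / 11)` of the means is absorbed by the slack in
the explicit bounds, and `4 / 11 = (1 - 3 / 11) / 2` is the largest exponent for which such errors
are exceeded with probability at most `exp (-d s ^ (3 / 11))`. -/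
structure IsTypical (μ σ : Fin k → ℝ) (rule : Knowledge k → Fin k) (ε C K : ℝ) (s : ℕ)
    (x : Fin k → ℕ → ℝ) : Prop where
  coarse : ∀ r ≤ s, ∀ i, (pulls σ rule x i r : ℝ) * |(knowledge σ rule x r).1 i - μ i| ≤
    ε * (pulls σ rule x i r + (s : ℝ) ^ (3 / 11 : ℝ))
  fine : ∀ r ≤ s, ∀ i, (pulls σ rule x i r : ℝ) * |(knowledge σ rule x r).1 i - μ i| ≤
    (s : ℝ) ^ (-(4 / 11) : ℝ) * (pulls σ rule x i r + s)
  close : ∀ i j, i ≠ j → (closePulls σ rule x i j (s / (4 * k * K))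
    (s / (C * (s : ℝ) ^ (3 / 11 : ℝ))) s : ℝ) < s / (4 * k ^ 2)

/-- On typical paths each arm is pulled at a linear rate. -/
lemma eventually_linear_le_pulls (hk : 2 ≤ k) (hrule : IsKGRule σ rule) {b : Fin k}
    (hb : ∀ i, i ≠ b → μ i < μ b) {lo hi K B : ℝ}
    (hlo : 0 < lo) (hloσ : ∀ i, lo ≤ σ i) (hσhi : ∀ i, σ i ≤ hi) (hK1 : 1 ≤ K)
    (hK : ∀ i j, σ i ≤ K * σ j) (hB : ∀ i, |μ i| ≤ B) :
    ∃ ε C c : ℝ, 0 < ε ∧ 0 < C ∧ 0 < c ∧ ∀ᶠ t : ℕ in atTop, ∀ x : Fin k → ℕ → ℝ,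
      (∀ s : ℕ, s ≤ t → 1 / (2 * k) * (t : ℝ) ≤ s → IsTypical μ σ rule ε C K s x) →
      ∀ i, c * (t : ℝ) ≤ pulls σ rule x i t := by
  have hσ : ∀ i, 0 < σ i := fun i => hlo.trans_le (hloσ i)
  have hk0 : (0 : ℝ) < k := by positivity
  have hhi : 0 < hi := (hσ b).trans_le (hσhi b)
  have hB0 : 0 ≤ B := (abs_nonneg _).trans (hB b)
  set g := gapOf μ b with hg
  have hg0 : 0 < g := by rw [hg, gapOf_best hk hb]; exact sub_pos.2 (maxOther_lt hk hb)
  obtain ⟨C, hC, hev⟩ := eventually_rpow_le_pulls hk hrule hlo hloσ hσhi hK1 hK hB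
  obtain ⟨S, hS⟩ := eventually_atTop.1 hev
  set D := (2 * B + g) / lo with hD
  have hD0 : 0 < D := by positivity
  set c₀ := 1 / (2 * k) * (g / 2) / hi with hc₀
  have hc₀0 : 0 < c₀ := by positivity
  refine ⟨min 1 (g / 16), C, c₀ / 4 / D, by positivity, hC, by positivity, ?_⟩
  filter_upwards [eventually_le_linear (S : ℝ) (show (0 : ℝ) < 1 / (2 * k) by positivity),
    eventually_le_linear 2 (show (0 : ℝ) < 1 / (2 * k) by positivity),
    eventually_gradErr_le hK1 (show 0 < c₀ / 2 by positivity) one_pos,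
    eventually_le_linear D (show (0 : ℝ) < c₀ / 4 by positivity),
    eventually_ge_atTop 1] with t hS' ht2 hgrad hDt ht1 x hgood a
  have ht0 : (0 : ℝ) < t := by exact_mod_cast ht1
  rw [Real.rpow_one] at hgrad
  have hacc : ∀ r : ℕ, r ≤ t → 1 / (2 * k) * (t : ℝ) ≤ r → ∀ l,
      |(knowledge σ rule x r).1 l - μ l| ≤ g / 8 := by
    intro r hrt hr l
    have hr0 : (0 : ℝ) < r := lt_of_lt_of_le (by positivity) hr
    have hG := hgood r hrt hr
    have hm0 : 0 < (r : ℝ) ^ (3 / 11 : ℝ) := by positivity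
    have h1 := hS r (by exact_mod_cast hS'.trans hr) x (fun r' hr' i => ?_) hG.close l
    · have hn0 := hm0.trans_le h1
      have h2 := hG.coarse r le_rfl l
      have h3 : (pulls σ rule x l r : ℝ) * |(knowledge σ rule x r).1 l - μ l| ≤
          pulls σ rule x l r * (g / 8) := by
        refine h2.trans ?_
        calc min 1 (g / 16) * (pulls σ rule x l r + (r : ℝ) ^ (3 / 11 : ℝ))
            ≤ g / 16 * (pulls σ rule x l r + pulls σ rule x l r) := by
              gcongr; exact min_le_right _ _
          _ = _ := by ring
      exact le_of_mul_le_mul_left h3 hn0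
    · refine (hG.coarse r' hr' i).trans ?_
      exact mul_le_of_le_one_left (by positivity) (min_le_left _ _)
  obtain ⟨i, hi'⟩ := exists_pulls_ge (σ := σ) (rule := rule) hk x t
  have e1 : (t : ℝ) / k = 2 * (1 / (2 * k) * t) := by field_simp
  rw [e1] at hi'
  have hn2 : 2 ≤ pulls σ rule x i t := by
    have : (2 : ℝ) ≤ pulls σ rule x i t := by linarith
    exact_mod_cast this
  have hbal := pulls_balance hk hσ hrule hK1 hK (j := a) hn2
    fun r hrt hr => hacc r hrt (by linarith)
  have hgi := gapOf_best_le hk hb i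
  have hga := gapOf_le hk hB a
  have hga0 := gapOf_nonneg μ a
  have h1 : c₀ * t ≤ ((pulls σ rule x i t : ℝ) - 1) * (gapOf μ i - 2 * (g / 8)) / σ i := by
    have : c₀ * t = (1 / (2 * k) * t) * (g / 2) / hi := by rw [hc₀]; ring
    rw [this]
    have h2 := hσ i
    refine div_le_div₀ ?_ ?_ h2 (hσhi i)
    · exact mul_nonneg (by linarith) (by linarith)
    · exact mul_le_mul (by linarith) (by linarith) (by positivity) (by linarith)
  have h2 : ((pulls σ rule x a t : ℝ) + 1) * (gapOf μ a + 2 * (g / 8)) / σ a ≤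
      (pulls σ rule x a t + 1) * D := by
    rw [hD, mul_div_assoc]
    gcongr
    · linarith
    · exact hloσ a
  have h3 : c₀ / 4 * t ≤ pulls σ rule x a t * D := by linarith
  rw [div_mul_eq_mul_div, div_le_iff₀ hD0]
  exact h3

/-- On typical paths all `N_i Δ_i / σ_i` agree up to `o(t ^ (3 / 4))`. -/
lemma eventually_balance (hk : 2 ≤ k) (hrule : IsKGRule σ rule) {lo K B : ℝ}
    (hlo : 0 < lo) (hloσ : ∀ i, lo ≤ σ i) (hK1 : 1 ≤ K)
    (hK : ∀ i j, σ i ≤ K * σ j) (hB : ∀ i, |μ i| ≤ B) {ε C c c' : ℝ} (hc : 0 < c) (hc1 : c ≤ 1)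
    (hc' : 0 < c') :
    ∀ᶠ t : ℕ in atTop, ∀ x : Fin k → ℕ → ℝ,
      (∀ s : ℕ, s ≤ t → c / 2 * (t : ℝ) ≤ s →
        IsTypical μ σ rule ε C K s x ∧ ∀ i, c * (s : ℝ) ≤ pulls σ rule x i s) →
      ∀ i j, pulls σ rule x i t * (gapOf μ i / σ i) ≤
        pulls σ rule x j t * (gapOf μ j / σ j) + c' * (t : ℝ) ^ (3 / 4 : ℝ) := by
  have hσ : ∀ i, 0 < σ i := fun i => hlo.trans_le (hloσ i)
  set A := (1 + 1 / c) * (c / 2) ^ (-(4 / 11) : ℝ) with hA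
  have hA0 : 0 < A := by positivity
  filter_upwards [eventually_gradErr_le hK1 (show 0 < c' / 3 by positivity)
      (show (0 : ℝ) < 3 / 4 by norm_num),
    eventually_le_linear 2 (show (0 : ℝ) < c by positivity),
    eventually_le_rpow (4 * (B / lo)) (show 0 < c' / 3 by positivity)
      (show (0 : ℝ) < 3 / 4 by norm_num),
    eventually_le_mul_rpow (8 * A / lo) (show 0 < c' / 3 by positivity)
      (show (7 / 11 : ℝ) < 3 / 4 by norm_num),
    eventually_ge_atTop 1] with t hgrad hct hBt hAt ht1 x hgood i j
  have ht0 : (0 : ℝ) < t := by exact_mod_cast ht1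
  set δ := A * (t : ℝ) ^ (-(4 / 11) : ℝ) with hδ
  have hδ0 : 0 < δ := by positivity
  have hacc : ∀ r : ℕ, r ≤ t → c / 2 * (t : ℝ) ≤ r → ∀ l,
      |(knowledge σ rule x r).1 l - μ l| ≤ δ := by
    intro r hrt hr l
    have hr0 : (0 : ℝ) < r := lt_of_lt_of_le (by positivity) hr
    obtain ⟨hG, hlin⟩ := hgood r hrt hr
    have hn := hlin l
    have hn0 : (0 : ℝ) < pulls σ rule x l r := lt_of_lt_of_le (by positivity) hn
    have h3 : (pulls σ rule x l r : ℝ) * |(knowledge σ rule x r).1 l - μ l| ≤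
        pulls σ rule x l r * ((r : ℝ) ^ (-(4 / 11) : ℝ) * (1 + 1 / c)) := by
      refine (hG.fine r le_rfl l).trans ?_
      have h4 : (r : ℝ) ≤ pulls σ rule x l r * (1 / c) := by
        rw [mul_one_div, le_div_iff₀ hc]; linarith
      calc (r : ℝ) ^ (-(4 / 11) : ℝ) * (pulls σ rule x l r + r)
          ≤ (r : ℝ) ^ (-(4 / 11) : ℝ) *
            (pulls σ rule x l r + pulls σ rule x l r * (1 / c)) := by gcongr
        _ = _ := by ring
    refine (le_of_mul_le_mul_left h3 hn0).trans ?_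
    have h5 : (r : ℝ) ^ (-(4 / 11) : ℝ) ≤ (c / 2 * t) ^ (-(4 / 11) : ℝ) :=
      Real.rpow_le_rpow_of_nonpos (by positivity) hr (by norm_num)
    rw [Real.mul_rpow (by positivity) ht0.le] at h5
    calc (r : ℝ) ^ (-(4 / 11) : ℝ) * (1 + 1 / c)
        ≤ ((c / 2) ^ (-(4 / 11) : ℝ) * (t : ℝ) ^ (-(4 / 11) : ℝ)) * (1 + 1 / c) := by gcongr
      _ = δ := by rw [hδ, hA]; ring
  have hit := (hgood t le_rfl (by nlinarith)).2 i
  have hn2 : 2 ≤ pulls σ rule x i t := by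
    have : (2 : ℝ) ≤ pulls σ rule x i t := by linarith
    exact_mod_cast this
  have hbal := pulls_balance hk hσ hrule hK1 hK (j := j) hn2
    fun r hrt hr => hacc r hrt (by linarith)
  have hpi : (pulls σ rule x i t : ℝ) ≤ t := by exact_mod_cast pulls_le i t
  have hpj : (pulls σ rule x j t : ℝ) ≤ t := by exact_mod_cast pulls_le j t
  have ht1' : (1 : ℝ) ≤ t := by exact_mod_cast ht1
  have hw : ∀ l, gapOf μ l / σ l ≤ 2 * (B / lo) := fun l => by
    rw [← mul_div_assoc]
    have := gapOf_nonneg μ l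
    exact div_le_div₀ (this.trans (gapOf_le hk hB l)) (gapOf_le hk hB l) hlo (hloσ l)
  have hd : ∀ l, δ / σ l ≤ δ / lo := fun l => by gcongr; exact hloσ l
  have hd0 : ∀ l, 0 ≤ δ / σ l := fun l => div_nonneg hδ0.le (hσ l).le
  have e1 : ((pulls σ rule x i t : ℝ) - 1) * (gapOf μ i - 2 * δ) / σ i =
      pulls σ rule x i t * (gapOf μ i / σ i) - gapOf μ i / σ i -
        2 * (pulls σ rule x i t - 1) * (δ / σ i) := by ring
  have e2 : ((pulls σ rule x j t : ℝ) + 1) * (gapOf μ j + 2 * δ) / σ j =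
      pulls σ rule x j t * (gapOf μ j / σ j) + gapOf μ j / σ j +
        2 * (pulls σ rule x j t + 1) * (δ / σ j) := by ring
  have h1 : 2 * ((pulls σ rule x i t : ℝ) - 1) * (δ / σ i) ≤ 2 * t * (δ / lo) := by
    refine mul_le_mul (by linarith) (hd i) (hd0 i) (by positivity)
  have h2 : 2 * ((pulls σ rule x j t : ℝ) + 1) * (δ / σ j) ≤ 4 * t * (δ / lo) := by
    refine mul_le_mul (by linarith) (hd j) (hd0 j) (by positivity)
  have h3 : 8 * t * (δ / lo) = 8 * A / lo * (t : ℝ) ^ (7 / 11 : ℝ) := by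
    have : (t : ℝ) ^ (7 / 11 : ℝ) = t * (t : ℝ) ^ (-(4 / 11) : ℝ) := by
      rw [← Real.rpow_one_add' ht0.le (by norm_num)]
      norm_num
    rw [this, hδ]; ring
  have h4 : 0 ≤ t * (δ / lo) := by positivity
  rw [e1, e2] at hbal
  linarith [hw i, hw j]

end

section

variable {k : ℕ} {σ : Fin k → ℝ} {rule : Knowledge k → Fin k} {μ : Fin k → ℝ}

/-! ### From balanced pulls to the explicit bounds -/

lemma logTerm_nonneg (μ σ : Fin k → ℝ) : 0 ≤ logTerm μ σ := le_max_right _ _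

lemma le_rhoUp1 {b i : Fin k} {t : ℝ} (ht : 0 < t) (hσ : ∀ i, 0 < σ i)
    (hi : t ^ (-(1 / 4) : ℝ) < μ b - μ i) (hb : maxOther μ b ≤ μ b) :
    σ i / (μ b - μ i) * ((μ b - maxOther μ b + t ^ (-(1 / 4) : ℝ)) / σ b) ≤
      rhoUp1 μ σ b i t := by
  have hε : 0 < t ^ (-(1 / 4) : ℝ) := by positivity
  have hsi := hσ i
  have hsb := hσ b
  have hL := logTerm_nonneg μ σ
  unfold rhoUp1
  set ε := t ^ (-(1 / 4) : ℝ)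
  have h1 : σ i / (μ b - μ i) ≤
      (1 + (t / k) ^ (-(3 / 4) : ℝ)) * σ i / (μ b - μ i - ε) := by
    have : 0 ≤ (t / k) ^ (-(3 / 4) : ℝ) := by positivity
    refine div_le_div₀ (by positivity) ?_ (by linarith) (by linarith)
    nlinarith
  have hnum : 0 ≤ (μ b - maxOther μ b + ε) / σ b := div_nonneg (by linarith) hsb.le
  have h2 : (μ b - maxOther μ b + ε) / σ b ≤ ((μ b - maxOther μ b + ε) ^ 2 / σ b ^ 2 +
      8 * k / √t + 2 * k * logTerm μ σ / t) ^ (1 / 2 : ℝ) := by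
    rw [← Real.sqrt_eq_rpow]
    refine Real.le_sqrt_of_sq_le ?_
    rw [div_pow]
    have h3 : 0 ≤ 8 * k / √t := by positivity
    have h4 : 0 ≤ 2 * k * logTerm μ σ / t := by positivity
    linarith
  exact mul_le_mul h1 h2 hnum ((div_nonneg hsi.le (by linarith)).trans h1)

lemma rhoLow2_le {b i : Fin k} {t : ℝ} (ht : 0 < t) (hσ : ∀ i, 0 < σ i)
    (hi : μ i < μ b) (hb : t ^ (-(1 / 4) : ℝ) ≤ μ b - maxOther μ b) :
    rhoLow2 μ σ b i t ≤
      (μ b - maxOther μ b - t ^ (-(1 / 4) : ℝ)) / σ b * (σ i / (μ b - μ i)) := by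
  have hε : 0 < t ^ (-(1 / 4) : ℝ) := by positivity
  have hsi := hσ i
  have hsb := hσ b
  have hL := logTerm_nonneg μ σ
  unfold rhoLow2
  set ε := t ^ (-(1 / 4) : ℝ)
  have h0 : 0 ≤ (t / k) ^ (-(3 / 4) : ℝ) := by positivity
  have hd : 0 < μ b - μ i := by linarith
  refine mul_le_mul ?_ ?_ (by positivity) (div_nonneg (by linarith) hsb.le)
  · refine div_le_div_of_nonneg_left (by linarith) hsb ?_
    nlinarith
  · have h1 : ((μ b - μ i) / σ i) ^ 2 ≤ (μ b - μ i + ε) ^ 2 / σ i ^ 2 + 8 * k / √t +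
        2 * k * logTerm μ σ / t := by
      rw [div_pow]
      have h3 : 0 ≤ 8 * k / √t := by positivity
      have h4 : 0 ≤ 2 * k * logTerm μ σ / t := by positivity
      have h5 : (μ b - μ i) ^ 2 / σ i ^ 2 ≤ (μ b - μ i + ε) ^ 2 / σ i ^ 2 := by
        gcongr; linarith
      linarith
    have h2 := Real.rpow_le_rpow_of_nonpos (z := -(1 / 2)) (by positivity) h1 (by norm_num)
    refine h2.trans (le_of_eq ?_)
    rw [Real.rpow_neg (by positivity), ← Real.sqrt_eq_rpow, Real.sqrt_sq (by positivity), inv_div]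

lemma rhoLow_nonneg {b i : Fin k} {t : ℝ} (ht : 0 < t) (hσ : ∀ i, 0 < σ i)
    (hb : (3 / 4 * t) ^ (-(1 / 4) : ℝ) ≤ μ b - maxOther μ b) : 0 ≤ rhoLow μ σ b i t := by
  have hsb := hσ b
  have hsi := hσ i
  have hL := logTerm_nonneg μ σ
  have hb' : t ^ (-(1 / 4) : ℝ) ≤ μ b - maxOther μ b :=
    (Real.rpow_le_rpow_of_nonpos (by positivity) (by linarith) (by norm_num)).trans hb
  refine le_min ?_ ?_
  · unfold rhoLow1
    exact mul_nonneg (div_nonneg (sub_nonneg.2 hb) (by positivity)) (by positivity)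
  · unfold rhoLow2
    exact mul_nonneg (div_nonneg (sub_nonneg.2 hb') (by positivity)) (by positivity)

/-- Bounds on the ratios `N_i / N_b` give bounds on the sampling rates, which sum to `1`. -/
lemma rateBounds_of_ratio {x : Fin k → ℕ → ℝ} {b : Fin k} {t : ℕ}
    (hN : 0 < pulls σ rule x b t)
    (hlow0 : ∀ i, i ≠ b → 0 ≤ rhoLow μ σ b i t)
    (hlow : ∀ i, i ≠ b → rhoLow μ σ b i t ≤ (pulls σ rule x i t : ℝ) / pulls σ rule x b t)
    (hup : ∀ i, i ≠ b → (pulls σ rule x i t : ℝ) / pulls σ rule x b t ≤ rhoUp μ σ b i t) :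
    RateBounds μ σ b t (fun i => rate σ rule x i t) := by
  have hN0 : (0 : ℝ) < pulls σ rule x b t := by exact_mod_cast hN
  have ht : (t : ℝ) = pulls σ rule x b t *
      (1 + ∑ i ∈ Finset.univ.erase b, (pulls σ rule x i t : ℝ) / pulls σ rule x b t) := by
    have h1 : (t : ℝ) = ∑ i, (pulls σ rule x i t : ℝ) := by
      rw [← Nat.cast_sum, sum_pulls]
    rw [h1, ← Finset.add_sum_erase _ _ (Finset.mem_univ b), ← Finset.sum_div]
    field_simp
  set R : Fin k → ℝ := fun i => (pulls σ rule x i t : ℝ) / pulls σ rule x b t with hR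
  have hS1 : ∑ i ∈ Finset.univ.erase b, rhoLow μ σ b i t ≤ ∑ i ∈ Finset.univ.erase b, R i :=
    Finset.sum_le_sum fun i hi => hlow i (Finset.ne_of_mem_erase hi)
  have hS2 : ∑ i ∈ Finset.univ.erase b, R i ≤ ∑ i ∈ Finset.univ.erase b, rhoUp μ σ b i t :=
    Finset.sum_le_sum fun i hi => hup i (Finset.ne_of_mem_erase hi)
  have hS0 : 0 ≤ ∑ i ∈ Finset.univ.erase b, rhoLow μ σ b i t :=
    Finset.sum_nonneg fun i hi => hlow0 i (Finset.ne_of_mem_erase hi)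
  have hrb : rate σ rule x b t = 1 / (1 + ∑ i ∈ Finset.univ.erase b, R i) := by
    rw [rate, ht]
    field_simp
  have hri : ∀ i, rate σ rule x i t = R i / (1 + ∑ i ∈ Finset.univ.erase b, R i) := fun i => by
    rw [rate, ht, hR]
    field_simp
  have hR0 : ∀ i, 0 ≤ R i := fun i => by simp only [hR]; positivity
  refine ⟨⟨?_, ?_⟩, fun i hi => ⟨?_, ?_⟩⟩
  · beta_reduce
    rw [hrb]
    exact one_div_le_one_div_of_le (by linarith) (by linarith)
  · beta_reduce
    rw [hrb]
    exact one_div_le_one_div_of_le (by linarith) (by linarith)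
  · beta_reduce
    rw [hri]
    exact div_le_div₀ (hR0 i) (hlow i hi) (by linarith) (by linarith)
  · beta_reduce
    rw [hri]
    exact div_le_div₀ ((hR0 i).trans (hup i hi)) (hup i hi) (by linarith) (by linarith)

lemma eventually_rateBounds (hk : 2 ≤ k) (hσ : ∀ i, 0 < σ i) {b : Fin k}
    (hb : ∀ i, i ≠ b → μ i < μ b) {c : ℝ} (hc : 0 < c) :
    ∀ᶠ t : ℕ in atTop, ∀ x : Fin k → ℕ → ℝ,
      (∀ i, c * (t : ℝ) ≤ pulls σ rule x i t) →
      (∀ i j, pulls σ rule x i t * (gapOf μ i / σ i) ≤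
        pulls σ rule x j t * (gapOf μ j / σ j) + c / σ b * (t : ℝ) ^ (3 / 4 : ℝ)) →
      RateBounds μ σ b t (fun i => rate σ rule x i t) := by
  have hg : 0 < μ b - maxOther μ b := sub_pos.2 (maxOther_lt hk hb)
  have hsb := hσ b
  have hlim : Tendsto (fun t : ℕ => (3 / 4 * (t : ℝ)) ^ (-(1 / 4) : ℝ)) atTop (nhds 0) :=
    (tendsto_rpow_neg_atTop (show (0 : ℝ) < 1 / 4 by norm_num)).comp
      (tendsto_natCast_atTop_atTop.const_mul_atTop (by norm_num))
  filter_upwards [hlim.eventually_lt_const hg, eventually_ge_atTop 1] with t hε ht1 x hlin hbal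
  have ht0 : (0 : ℝ) < t := by exact_mod_cast ht1
  have hε' : (t : ℝ) ^ (-(1 / 4) : ℝ) < μ b - maxOther μ b :=
    (Real.rpow_le_rpow_of_nonpos (by positivity) (by linarith) (by norm_num)).trans_lt hε
  set ε := (t : ℝ) ^ (-(1 / 4) : ℝ) with hεdef
  have hε0 : 0 < ε := by positivity
  have hNb0 : (0 : ℝ) < pulls σ rule x b t := lt_of_lt_of_le (by positivity) (hlin b)
  have hε3 : c / σ b * (t : ℝ) ^ (3 / 4 : ℝ) ≤ pulls σ rule x b t * (ε / σ b) := by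
    have e : (t : ℝ) ^ (3 / 4 : ℝ) = t * ε := by
      rw [hεdef, ← Real.rpow_one_add' ht0.le (by norm_num)]
      norm_num
    calc c / σ b * (t : ℝ) ^ (3 / 4 : ℝ) = (c * t) * (ε / σ b) := by rw [e]; ring
      _ ≤ _ := by gcongr; exact hlin b
  refine rateBounds_of_ratio (by exact_mod_cast hNb0) (fun i _ => rhoLow_nonneg ht0 hσ hε.le) ?_ ?_
  · intro i hi
    have hd : 0 < μ b - μ i := sub_pos.2 (hb i hi)
    have hsi := hσ i
    refine (min_le_right _ _).trans ((rhoLow2_le ht0 hσ (hb i hi) hε'.le).trans ?_)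
    have h := hbal b i
    rw [gapOf_best hk hb, gapOf_of_ne hk hb hi] at h
    rw [le_div_iff₀ hNb0]
    have h2 : (pulls σ rule x b t : ℝ) * ((μ b - maxOther μ b - ε) / σ b) ≤
        pulls σ rule x i t * ((μ b - μ i) / σ i) := by
      have : (pulls σ rule x b t : ℝ) * ((μ b - maxOther μ b - ε) / σ b) =
        pulls σ rule x b t * ((μ b - maxOther μ b) / σ b) - pulls σ rule x b t * (ε / σ b) := by ring
      linarith
    calc (μ b - maxOther μ b - ε) / σ b * (σ i / (μ b - μ i)) * pulls σ rule x b t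
        = (pulls σ rule x b t * ((μ b - maxOther μ b - ε) / σ b)) * (σ i / (μ b - μ i)) := by ring
      _ ≤ (pulls σ rule x i t * ((μ b - μ i) / σ i)) * (σ i / (μ b - μ i)) := by gcongr
      _ = _ := by field_simp
  · intro i hi
    have hd : 0 < μ b - μ i := sub_pos.2 (hb i hi)
    have hsi := hσ i
    have hεi : ε < μ b - μ i := hε'.trans_le (by linarith [le_maxOther μ hi])
    refine le_trans ?_ ((le_rhoUp1 ht0 hσ hεi (maxOther_lt hk hb).le).trans (le_max_left _ _))
    have h := hbal i b
    rw [gapOf_best hk hb, gapOf_of_ne hk hb hi] at h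
    rw [div_le_iff₀ hNb0]
    have h2 : pulls σ rule x i t * ((μ b - μ i) / σ i) ≤
        (pulls σ rule x b t : ℝ) * ((μ b - maxOther μ b + ε) / σ b) := by
      have : (pulls σ rule x b t : ℝ) * ((μ b - maxOther μ b + ε) / σ b) =
        pulls σ rule x b t * ((μ b - maxOther μ b) / σ b) + pulls σ rule x b t * (ε / σ b) := by ring
      linarith
    calc (pulls σ rule x i t : ℝ)
        = (pulls σ rule x i t * ((μ b - μ i) / σ i)) * (σ i / (μ b - μ i)) := by field_simp
      _ ≤ (pulls σ rule x b t * ((μ b - maxOther μ b + ε) / σ b)) * (σ i / (μ b - μ i)) := by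
          gcongr
      _ = _ := by ring

/-- Both claims hold on paths that are typical from time `c t` on. -/
lemma eventually_of_isTypical (hk : 2 ≤ k) (hrule : IsKGRule σ rule) {b : Fin k}
    (hb : ∀ i, i ≠ b → μ i < μ b) {lo hi K B : ℝ}
    (hlo : 0 < lo) (hloσ : ∀ i, lo ≤ σ i) (hσhi : ∀ i, σ i ≤ hi) (hK1 : 1 ≤ K)
    (hK : ∀ i j, σ i ≤ K * σ j) (hB : ∀ i, |μ i| ≤ B) :
    ∃ ε C c : ℝ, 0 < ε ∧ 0 < C ∧ 0 < c ∧ ∀ᶠ t : ℕ in atTop, ∀ x : Fin k → ℕ → ℝ,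
      (∀ s : ℕ, c * (t : ℝ) ≤ s → IsTypical μ σ rule ε C K s x) →
      (∀ s : ℕ, t ≤ s + 1 → ∀ i, ((s : ℝ) / k) ^ (3 / 4 : ℝ) ≤ pulls σ rule x i s) ∧
      RateBounds μ σ b t (fun i => rate σ rule x i t) := by
  have hσ : ∀ i, 0 < σ i := fun i => hlo.trans_le (hloσ i)
  have hk0 : (0 : ℝ) < k := by positivity
  have hk2 : (2 : ℝ) ≤ k := by exact_mod_cast hk
  obtain ⟨ε, C, c₁, hε, hC, hc₁, hev⟩ :=
    eventually_linear_le_pulls hk hrule hb hlo hloσ hσhi hK1 hK hB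
  obtain ⟨S, hS⟩ := eventually_atTop.1 hev
  set c := min c₁ 1 with hc
  have hc0 : 0 < c := by positivity
  have hbal := eventually_balance (μ := μ) (rule := rule) (ε := ε) (C := C) (c := c)
    (c' := c / σ b) hk hrule hlo hloσ hK1 hK hB hc0 (min_le_right _ _) (div_pos hc0 (hσ b))
  have hrate := eventually_rateBounds (rule := rule) hk hσ hb hc0
  have hpow : ∀ᶠ s : ℕ in atTop, ((s : ℝ) / k) ^ (3 / 4 : ℝ) ≤ c₁ * s := by
    filter_upwards [eventually_le_mul_rpow (((1 : ℝ) / k) ^ (3 / 4 : ℝ)) hc₁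
      (show (3 / 4 : ℝ) < 1 by norm_num)] with s hs
    rw [Real.rpow_one, ← Real.mul_rpow (by positivity) (by positivity)] at hs
    rwa [div_eq_mul_one_div, mul_comm (s : ℝ)]
  obtain ⟨S', hS'⟩ := eventually_atTop.1 hpow
  refine ⟨ε, C, c / (8 * k), hε, hC, by positivity, ?_⟩
  filter_upwards [hbal, hrate, eventually_le_linear (S : ℝ) (show 0 < c / 2 by positivity),
    eventually_ge_atTop (S + 1), eventually_ge_atTop (S' + 1), eventually_ge_atTop 2] with
    t hbal' hrate' hSt hS1 hS2 ht2 x hx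
  have ht2' : (2 : ℝ) ≤ t := by exact_mod_cast ht2
  have hc1 : c ≤ 1 := min_le_right _ _
  have hlin : ∀ s : ℕ, c / 2 * (t : ℝ) ≤ s → S ≤ s → ∀ i, c₁ * (s : ℝ) ≤ pulls σ rule x i s := by
    intro s hs hSs i
    refine hS s hSs x (fun s' _ hs' => hx s' (le_trans ?_ hs')) i
    calc c / (8 * k) * t ≤ c / (4 * k) * t := by gcongr; norm_num
      _ = 1 / (2 * k) * (c / 2 * t) := by field_simp; norm_num
      _ ≤ 1 / (2 * k) * s := by gcongr
  have htyp : ∀ s : ℕ, c / 2 * (t : ℝ) ≤ s → IsTypical μ σ rule ε C K s x := fun s hs =>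
    hx s (le_trans (by gcongr; linarith) hs)
  have hct : c / 2 * (t : ℝ) ≤ t := by nlinarith
  refine ⟨fun s hs i => ?_, hrate' x (fun i => ?_) (hbal' x fun s _ hs => ⟨htyp s hs, fun i => ?_⟩)⟩
  · have hts : (t : ℝ) ≤ s + 1 := by exact_mod_cast hs
    exact (hS' s (by omega)).trans (hlin s (by nlinarith) (by omega) i)
  · refine le_trans ?_ (hlin t hct (by omega) i)
    gcongr
    exact min_le_left _ _
  · refine le_trans ?_ (hlin s hs ?_ i)
    · gcongr
      exact min_le_left _ _
    · exact_mod_cast hSt.trans hs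

end

section

variable {k : ℕ} {σ : Fin k → ℝ} {rule : Knowledge k → Fin k} {μ : Fin k → ℝ}
  {Ω : Type*} [MeasurableSpace Ω] {P : Measure Ω} {X : Fin k → ℕ → Ω → ℝ}

/-! ### Most paths are typical -/

lemma eventually_mul_cube_le_exp (A : ℝ) {c : ℝ} (hc : 0 < c) :
    ∀ᶠ s : ℕ in atTop, A * (s : ℝ) ^ 3 ≤ Real.exp (c * (s : ℝ) ^ (3 / 11 : ℝ)) := by
  have h1 := (isLittleO_pow_exp_pos_mul_atTop (k := 11) hc).bound
    (show 0 < (|A| + 1)⁻¹ by positivity)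
  have h2 := ((tendsto_rpow_atTop (show (0 : ℝ) < 3 / 11 by norm_num)).comp
    tendsto_natCast_atTop_atTop).eventually h1
  filter_upwards [h2] with s hs
  simp only [Function.comp_apply] at hs
  have e : ((s : ℝ) ^ (3 / 11 : ℝ)) ^ 11 = (s : ℝ) ^ 3 := by
    rw [← Real.rpow_natCast ((s : ℝ) ^ (3 / 11 : ℝ)), ← Real.rpow_mul (by positivity),
      ← Real.rpow_natCast]
    norm_num
  rw [e, Real.norm_of_nonneg (by positivity), Real.norm_of_nonneg (Real.exp_pos _).le,
    le_inv_mul_iff₀ (by positivity)] at hs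
  refine le_trans ?_ hs
  gcongr
  linarith [le_abs_self A]

/-- The probability of inaccurate means, with the exponent bounded below by `d s ^ (3 / 11)`. -/
lemma measure_deviation_le_exp [IsProbabilityMeasure P] (hX : ∀ i t, Measurable (X i t))
    (hlaw : ∀ i t, P.map (X i t) = gaussianReal (μ i) (Real.toNNReal (σ i ^ 2)))
    (hindep : iIndepFun (fun (p : Fin k × ℕ) => X p.1 p.2) P) (hr : Measurable rule)
    (hσ : ∀ i, 0 < σ i) {S : ℝ} (hS : ∀ i, σ i ≤ S) {e M v : ℝ} (he : 0 < e) (hM : 0 < M)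
    {s : ℕ} (hs : 1 ≤ s) (hv : v ≤ 2 * e ^ 2 * M / S ^ 2) :
    P {ω | ∃ r ≤ s, ∃ i, e * (pulls σ rule (fun i s => X i s ω) i r + M) <
      pulls σ rule (fun i s => X i s ω) i r *
        |(knowledge σ rule (fun i s => X i s ω) r).1 i - μ i|} ≤
      ENNReal.ofReal (4 * k * s * Real.exp (-v)) := by
  refine (measure_exists_deviation_le hX hlaw hindep hr hσ hS he hM s).trans
    (ENNReal.ofReal_le_ofReal ?_)
  have h1 : (1 : ℝ) ≤ s := by exact_mod_cast hs
  have h2 : (2 : ℝ) * k * (s + 1) ≤ 4 * k * s := by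
    have : (0 : ℝ) ≤ k := by positivity
    nlinarith
  exact mul_le_mul h2 (Real.exp_le_exp.2 (by linarith)) (Real.exp_pos _).le (by positivity)

/-- The parameters of the strip estimate at scale `s`. -/
lemma eventually_stripParams {lo hi A C H L : ℝ} (hlo : 0 < lo) (hloσ : ∀ i, lo ≤ σ i)
    (hσhi : ∀ i, σ i ≤ hi) (hhi : 0 < hi) (hA : 0 < A) (hC : 0 < C) (hH : 0 < H) (hL : 0 < L) :
    ∃ p d : ℝ, 0 < p ∧ 0 < d ∧ ∀ᶠ s : ℕ in atTop, ∃ kin kap : ℝ,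
      StripParams σ lo hi (s / A) (s / (C * (s : ℝ) ^ (3 / 11 : ℝ)))
        ((s : ℝ) ^ (-(4 / 11) : ℝ) * H) p kin kap s ∧ 0 ≤ kap ∧ 0 ≤ kin ∧ kin ≤ 1 ∧
      2 - kin * (s / L) + kap * s ≤ 2 - d * (s : ℝ) ^ (3 / 11 : ℝ) := by
  have hg := gaussBlock_pos
  set κ := lo ^ 2 * gaussBlock / (320 * C ^ 2) with hκ
  have hκ0 : 0 < κ := by positivity
  set E := (A / C) ^ 2 * hi ^ 2 with hE
  have hE0 : 0 < E := by positivity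
  -- `p` is so small that the loss `p² E` is at most half of the gain `p κ / L`
  set p := min (1 / 2) (κ / (2 * L * E)) with hp
  have hp0 : 0 < p := by positivity
  have hpE : p * E ≤ κ / (2 * L) := by
    calc p * E ≤ κ / (2 * L * E) * E := by gcongr; exact min_le_right _ _
      _ = κ / (2 * L) := by field_simp
  refine ⟨p, p * κ / (2 * L), hp0, by positivity, ?_⟩
  filter_upwards [eventually_ge_atTop 1,
    eventually_le_rpow (max (2 * (p ^ 2 * E)) (p * κ)) one_pos (show (0 : ℝ) < 6 / 11 by norm_num),
    eventually_le_rpow H (show 0 < lo / 2 by positivity) (show (0 : ℝ) < 4 / 11 by norm_num),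
    eventually_le_rpow (A / C * hi) (show (0 : ℝ) < 2 / 5 by norm_num)
      (show (0 : ℝ) < 3 / 11 by norm_num),
    eventually_le_rpow (p * (A / C) * H) (show 0 < p ^ 2 * E / 2 by positivity)
      (show (0 : ℝ) < 1 / 11 by norm_num)] with s hs1 hs2 hs3 hs4 hs5
  have hs0 : (0 : ℝ) < s := by exact_mod_cast hs1
  have hs1' : (1 : ℝ) ≤ s := by exact_mod_cast hs1
  set m := (s : ℝ) ^ (3 / 11 : ℝ) with hm
  have hm0 : 0 < m := by positivity
  have hm2 : m ^ 2 = (s : ℝ) ^ (6 / 11 : ℝ) := by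
    rw [hm, ← Real.rpow_natCast, ← Real.rpow_mul hs0.le]; norm_num
  rw [one_mul, ← hm2] at hs2
  have haN : s / (C * m) / (s / A) = A / C / m := by field_simp
  have has : s / (C * m) / (s : ℝ) = 1 / (C * m) := by field_simp
  have hη : (s : ℝ) ^ (-(4 / 11) : ℝ) = ((s : ℝ) ^ (4 / 11 : ℝ))⁻¹ := Real.rpow_neg hs0.le _
  refine ⟨p * κ / m ^ 2, p ^ 2 * E / m ^ 2, ⟨hlo, hloσ, hσhi, by positivity, by positivity, hp0.le,
    min_le_left _ _, ?_, ?_, ?_, ?_, ?_⟩, by positivity, by positivity, ?_, ?_⟩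
  · rw [div_le_iff₀ (by positivity)]
    linarith [(le_max_left _ _).trans hs2]
  · rw [haN, hη]
    have e1 : (s : ℝ) ^ (4 / 11 : ℝ) = m * (s : ℝ) ^ (1 / 11 : ℝ) := by
      rw [hm, ← Real.rpow_add hs0]; norm_num
    have h1 : p * (A / C / m) * (((s : ℝ) ^ (4 / 11 : ℝ))⁻¹ * H) ≤ p ^ 2 * E / 2 / m ^ 2 := by
      rw [e1]
      have : p * (A / C / m) * ((m * (s : ℝ) ^ (1 / 11 : ℝ))⁻¹ * H) =
          p * (A / C) * H / (s : ℝ) ^ (1 / 11 : ℝ) / m ^ 2 := by field_simp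
      rw [this]
      refine div_le_div_of_nonneg_right ?_ (by positivity)
      rw [div_le_iff₀ (by positivity)]
      exact hs5
    have h2 : p ^ 2 * (A / C / m) ^ 2 * hi ^ 2 / 2 = p ^ 2 * E / 2 / m ^ 2 := by
      rw [hE]; field_simp
    rw [h2]
    calc _ ≤ p ^ 2 * E / 2 / m ^ 2 + p ^ 2 * E / 2 / m ^ 2 := by gcongr
      _ = _ := by ring
  · rw [hη, inv_mul_le_iff₀ (by positivity)]
    linarith
  · rw [haN, div_mul_eq_mul_div, div_le_iff₀ hm0]
    exact hs4
  · rw [has, hκ]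
    refine le_of_eq ?_
    field_simp
  · rw [div_le_one (by positivity)]
    exact (le_max_right _ _).trans hs2
  · have h1 : p ^ 2 * E ≤ p * (κ / (2 * L)) := by nlinarith
    have h2 : m ≤ s / m ^ 2 := by
      rw [le_div_iff₀ (by positivity), ← pow_succ', hm, ← Real.rpow_natCast, ← Real.rpow_mul hs0.le]
      exact (Real.rpow_le_rpow_of_exponent_le hs1' (by norm_num)).trans (Real.rpow_one _).le
    have h3 : p * κ / m ^ 2 * (s / L) = 2 * (p * (κ / (2 * L))) * (s / m ^ 2) := by field_simp
    have h4 : p ^ 2 * E / m ^ 2 * s = p ^ 2 * E * (s / m ^ 2) := by ring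
    have h5 : p * κ / (2 * L) * m = p * (κ / (2 * L)) * m := by ring
    rw [h3, h4, h5]
    have h6 : 0 ≤ p * (κ / (2 * L)) := by positivity
    have h7 := mul_le_mul_of_nonneg_left h2 h6
    have h8 := mul_le_mul_of_nonneg_right h1 (hm0.le.trans h2)
    linarith

lemma eventually_measure_not_isTypical [IsProbabilityMeasure P] (hX : ∀ i t, Measurable (X i t))
    (hlaw : ∀ i t, P.map (X i t) = gaussianReal (μ i) (Real.toNNReal (σ i ^ 2)))
    (hindep : iIndepFun (fun (p : Fin k × ℕ) => X p.1 p.2) P) (hr : Measurable rule) (hk : 2 ≤ k)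
    {lo hi K : ℝ} (hlo : 0 < lo) (hloσ : ∀ i, lo ≤ σ i) (hσhi : ∀ i, σ i ≤ hi) (hK1 : 1 ≤ K)
    {ε C : ℝ} (hε : 0 < ε) (hC : 0 < C) :
    ∃ d : ℝ, 0 < d ∧ ∀ᶠ s : ℕ in atTop,
      P {ω | ¬ IsTypical μ σ rule ε C K s (fun i s => X i s ω)} ≤
        ENNReal.ofReal (Real.exp (-(d * (s : ℝ) ^ (3 / 11 : ℝ)))) := by
  have hσ : ∀ i, 0 < σ i := fun i => hlo.trans_le (hloσ i)
  have hk0 : (0 : ℝ) < k := by positivity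
  have hhi : 0 < hi := (hσ ⟨0, by omega⟩).trans_le (hσhi _)
  obtain ⟨p, d₀, -, hd₀, hev⟩ := eventually_stripParams (A := 4 * k * K) (C := C)
    (H := 1 + 4 * k * K) (L := 4 * k ^ 2) hlo hloσ hσhi hhi (by positivity) hC (by positivity)
    (by positivity)
  set d₁ := 2 * ε ^ 2 / hi ^ 2 with hd₁
  set d₂ := 2 / hi ^ 2 with hd₂
  set d := min d₀ (min d₁ d₂) with hd
  have hd0 : 0 < d := by positivity
  refine ⟨d / 2, by positivity, ?_⟩
  filter_upwards [hev, eventually_ge_atTop 1,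
    eventually_mul_cube_le_exp (8 * k + k * k * Real.exp 2) (half_pos hd0)] with s hs hs1 hexp
  obtain ⟨kin, kap, hpar, hkap, hkin, hkin1, hexpo⟩ := hs
  have hs0 : (0 : ℝ) < s := by exact_mod_cast hs1
  have hs1' : (1 : ℝ) ≤ s := by exact_mod_cast hs1
  set m := (s : ℝ) ^ (3 / 11 : ℝ) with hm
  have hm0 : 0 < m := by positivity
  set A₁ : Set Ω := {ω | ∃ r ≤ s, ∃ i, ε * (pulls σ rule (fun i s => X i s ω) i r + m) <
      pulls σ rule (fun i s => X i s ω) i r *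
        |(knowledge σ rule (fun i s => X i s ω) r).1 i - μ i|} with hA₁
  set A₂ : Set Ω := {ω | ∃ r ≤ s, ∃ i,
      (s : ℝ) ^ (-(4 / 11) : ℝ) * (pulls σ rule (fun i s => X i s ω) i r + s) <
      pulls σ rule (fun i s => X i s ω) i r *
        |(knowledge σ rule (fun i s => X i s ω) r).1 i - μ i|} with hA₂
  set A₃ : Fin k × Fin k → Set Ω := fun q => {ω | q.1 ≠ q.2 ∧
      (∀ r < s, BothPulled σ rule (fun i s => X i s ω) q.1 q.2 (s / (4 * k * K)) r →
        BothAccurate μ σ rule (fun i s => X i s ω) q.1 q.2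
          ((s : ℝ) ^ (-(4 / 11) : ℝ) * (1 + 4 * k * K)) r) ∧
      (s : ℝ) / (4 * k ^ 2) ≤ closePulls σ rule (fun i s => X i s ω) q.1 q.2 (s / (4 * k * K))
        (s / (C * m)) s} with hA₃
  have hsub : {ω | ¬ IsTypical μ σ rule ε C K s (fun i s => X i s ω)} ⊆
      A₁ ∪ A₂ ∪ ⋃ q ∈ (Finset.univ : Finset (Fin k × Fin k)), A₃ q := by
    intro ω hω
    by_contra hc
    simp only [Set.mem_union, not_or] at hc
    obtain ⟨⟨h1, h2⟩, h3⟩ := hc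
    simp only [hA₁, hA₂, Set.mem_ofPred_eq] at h1 h2
    push Not at h1 h2
    refine hω ⟨h1, h2, fun i j hij => ?_⟩
    by_contra! hcl
    refine h3 (Set.mem_biUnion (Finset.mem_univ (i, j)) ⟨hij, fun r hr hb => ?_, hcl⟩)
    have hacc : ∀ l, (s : ℝ) / (4 * k * K) ≤ pulls σ rule (fun i s => X i s ω) l r →
        |μ l - (knowledge σ rule (fun i s => X i s ω) r).1 l| ≤
          (s : ℝ) ^ (-(4 / 11) : ℝ) * (1 + 4 * k * K) := by
      intro l hl
      have hn0 : (0 : ℝ) < pulls σ rule (fun i s => X i s ω) l r :=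
        lt_of_lt_of_le (by positivity) hl
      rw [abs_sub_comm]
      refine le_of_mul_le_mul_left ((h2 r hr.le l).trans ?_) hn0
      rw [div_le_iff₀ (by positivity)] at hl
      calc (s : ℝ) ^ (-(4 / 11) : ℝ) * (pulls σ rule (fun i s => X i s ω) l r + s)
          ≤ (s : ℝ) ^ (-(4 / 11) : ℝ) * (pulls σ rule (fun i s => X i s ω) l r +
            pulls σ rule (fun i s => X i s ω) l r * (4 * k * K)) := by gcongr
        _ = _ := by ring
    exact ⟨hacc i hb.1, hacc j hb.2⟩
  have hP₁ : P A₁ ≤ ENNReal.ofReal (4 * k * s * Real.exp (-(d * m))) := by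
    refine (measure_deviation_le_exp hX hlaw hindep hr hσ hσhi hε hm0 hs1 (v := d₁ * m)
      (le_of_eq (by rw [hd₁]; ring))).trans (ENNReal.ofReal_le_ofReal ?_)
    gcongr
    exact (min_le_right _ _).trans (min_le_left _ _)
  have hP₂ : P A₂ ≤ ENNReal.ofReal (4 * k * s * Real.exp (-(d * m))) := by
    refine (measure_deviation_le_exp hX hlaw hindep hr hσ hσhi
      (show 0 < (s : ℝ) ^ (-(4 / 11) : ℝ) by positivity) hs0 hs1 (v := d₂ * m)
      (le_of_eq ?_)).trans (ENNReal.ofReal_le_ofReal ?_)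
    · have : ((s : ℝ) ^ (-(4 / 11) : ℝ)) ^ 2 * s = m := by
        rw [hm, ← Real.rpow_natCast, ← Real.rpow_mul hs0.le, ← Real.rpow_add_one hs0.ne']
        norm_num
      rw [hd₂, ← this]; ring
    · gcongr
      exact (min_le_right _ _).trans (min_le_right _ _)
  have hP₃ : ∀ q, P (A₃ q) ≤ ENNReal.ofReal (s * (Real.exp 2 * Real.exp (-(d * m)))) := by
    intro q
    by_cases hq : q.1 = q.2
    · have : A₃ q = ∅ := by
        ext ω
        simp [hA₃, hq]
      rw [this, measure_empty]
      exact zero_le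
    · refine (measure_mono fun ω hω => hω.2).trans ((measure_closePulls_le hX hlaw hindep hr hpar
        hkap hkin hkin1 hq (c := s / (4 * k ^ 2)) (by positivity)).trans
          (ENNReal.ofReal_le_ofReal ?_))
      rw [← Real.exp_add]
      refine mul_le_mul_of_nonneg_left (Real.exp_le_exp.2 ?_) hs0.le
      have : d * m ≤ d₀ * m := by gcongr; exact min_le_left _ _
      linarith
  refine (measure_mono hsub).trans ((measure_union_le _ _).trans
    ((add_le_add ((measure_union_le _ _).trans (add_le_add hP₁ hP₂))
      ((measure_biUnion_finset_le _ _).trans (Finset.sum_le_sum fun q _ => hP₃ q))).trans ?_))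
  rw [Finset.sum_const, Finset.card_univ, Fintype.card_prod, Fintype.card_fin, nsmul_eq_mul,
    ← ENNReal.ofReal_natCast, ← ENNReal.ofReal_mul (by positivity),
    ← ENNReal.ofReal_add (by positivity) (by positivity),
    ← ENNReal.ofReal_add (by positivity) (by positivity)]
  refine ENNReal.ofReal_le_ofReal ?_
  push_cast
  have h1 : (s : ℝ) ≤ (s : ℝ) ^ 3 := le_self_pow₀ hs1' (by norm_num)
  calc 4 * k * s * Real.exp (-(d * m)) + 4 * k * s * Real.exp (-(d * m)) +
        k * k * (s * (Real.exp 2 * Real.exp (-(d * m))))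
      = (8 * k + k * k * Real.exp 2) * s * Real.exp (-(d * m)) := by ring
    _ ≤ (8 * k + k * k * Real.exp 2) * (s : ℝ) ^ 3 * Real.exp (-(d * m)) := by gcongr
    _ ≤ Real.exp (d / 2 * m) * Real.exp (-(d * m)) := by gcongr
    _ = Real.exp (-(d / 2 * m)) := by rw [← Real.exp_add]; congr 1; ring

/-- Summing over all late times. -/
lemma eventually_measure_exists_le {bad : ℕ → Set Ω} {d c : ℝ} (hd : 0 < d) (hc : 0 < c)
    (h : ∀ᶠ s : ℕ in atTop, P (bad s) ≤
      ENNReal.ofReal (Real.exp (-(d * (s : ℝ) ^ (3 / 11 : ℝ))))) :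
    ∃ d' : ℝ, 0 < d' ∧ ∀ᶠ t : ℕ in atTop, P {ω | ∃ s : ℕ, c * (t : ℝ) ≤ s ∧ ω ∈ bad s} ≤
      ENNReal.ofReal (Real.exp (-(d' * (t : ℝ) ^ (3 / 11 : ℝ)))) := by
  obtain ⟨S, hS⟩ := eventually_atTop.1 (h.and (eventually_mul_cube_le_exp 1 (half_pos hd)))
  have hsum : Summable fun s : ℕ => ((s : ℝ) ^ 3)⁻¹ := Real.summable_nat_pow_inv.2 (by norm_num)
  set M := ∑' s : ℕ, ((s : ℝ) ^ 3)⁻¹ with hM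
  set d₁ := d / 2 * c ^ (3 / 11 : ℝ) with hd₁
  have hd₁0 : 0 < d₁ := by positivity
  refine ⟨d₁ / 2, by positivity, ?_⟩
  filter_upwards [eventually_le_linear (S : ℝ) hc, eventually_ge_atTop 1,
    eventually_mul_cube_le_exp M (half_pos hd₁0)] with t htS ht1 htM
  have ht1' : (1 : ℝ) ≤ t := by exact_mod_cast ht1
  have ht0 : (0 : ℝ) < t := by linarith
  set D := Real.exp (-(d₁ * (t : ℝ) ^ (3 / 11 : ℝ))) with hD
  have hsub : {ω | ∃ s : ℕ, c * (t : ℝ) ≤ s ∧ ω ∈ bad s} ⊆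
      ⋃ s : ℕ, {ω | c * (t : ℝ) ≤ s ∧ ω ∈ bad s} := fun ω ⟨s, hs⟩ => Set.mem_iUnion.2 ⟨s, hs⟩
  have hone : ∀ s : ℕ, P {ω | c * (t : ℝ) ≤ s ∧ ω ∈ bad s} ≤
      ENNReal.ofReal (D * ((s : ℝ) ^ 3)⁻¹) := by
    intro s
    by_cases hs : c * (t : ℝ) ≤ s
    · obtain ⟨h1, h2⟩ := hS s (by exact_mod_cast htS.trans hs)
      refine (measure_mono fun ω hω => hω.2).trans (h1.trans (ENNReal.ofReal_le_ofReal ?_))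
      have hs0 : (0 : ℝ) < s := lt_of_lt_of_le (by positivity) hs
      rw [one_mul] at h2
      have e : Real.exp (-(d * (s : ℝ) ^ (3 / 11 : ℝ))) =
          Real.exp (-(d / 2 * (s : ℝ) ^ (3 / 11 : ℝ))) *
            (Real.exp (d / 2 * (s : ℝ) ^ (3 / 11 : ℝ)))⁻¹ := by
        rw [← Real.exp_neg, ← Real.exp_add]; congr 1; ring
      rw [e]
      gcongr
      have h3 : (c * t) ^ (3 / 11 : ℝ) ≤ (s : ℝ) ^ (3 / 11 : ℝ) := by gcongr
      rw [Real.mul_rpow hc.le ht0.le] at h3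
      rw [hD]
      refine Real.exp_le_exp.2 (neg_le_neg ?_)
      rw [hd₁, mul_assoc]
      gcongr
    · have : {ω | c * (t : ℝ) ≤ s ∧ ω ∈ bad s} = ∅ := by
        ext ω; simp [hs]
      rw [this, measure_empty]
      exact zero_le
  refine (measure_mono hsub).trans ((measure_iUnion_le _).trans
    ((ENNReal.tsum_le_tsum hone).trans ?_))
  rw [← ENNReal.ofReal_tsum_of_nonneg (fun s => by positivity) (hsum.mul_left D), tsum_mul_left]
  refine ENNReal.ofReal_le_ofReal ?_
  have hM0 : 0 ≤ M := tsum_nonneg fun s => by positivity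
  have h1 : M ≤ Real.exp (d₁ / 2 * (t : ℝ) ^ (3 / 11 : ℝ)) := by
    refine le_trans ?_ htM
    exact le_mul_of_one_le_right hM0 (one_le_pow₀ ht1')
  calc D * M ≤ D * Real.exp (d₁ / 2 * (t : ℝ) ^ (3 / 11 : ℝ)) := by gcongr
    _ = _ := by rw [hD, ← Real.exp_add]; congr 1; ring

/-! ### The target probability -/

lemma le_sigmaMax (σ : Fin k → ℝ) (i : Fin k) : σ i ≤ sigmaMax σ :=
  le_ciSup (Set.finite_range σ).bddAbove i

/-- `q (3 t / 4)` decays like `exp (-B t ^ (1 / 4))`, more slowly than `exp (-d t ^ (3 / 11))`. -/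
lemma eventually_exp_le_q (hk : 2 ≤ k) (hσ : ∀ i, 0 < σ i) {d : ℝ} (hd : 0 < d) :
    ∀ᶠ t : ℕ in atTop, Real.exp (-(d * (t : ℝ) ^ (3 / 11 : ℝ))) ≤ q σ (3 / 4 * (t : ℝ)) ∧
      q σ (3 / 4 * (t : ℝ)) ≤ 1 := by
  have hS : 0 < sigmaMax σ := (hσ ⟨0, by omega⟩).trans_le (le_sigmaMax σ _)
  have hk0 : (0 : ℝ) < k := by positivity
  set A := 4 * sigmaMax σ * (k : ℝ) ^ (-(1 / 8) : ℝ) * (3 / 4 : ℝ) ^ (-(1 / 8) : ℝ) with hA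
  have hA0 : 0 < A := by positivity
  set B := (k : ℝ) ^ (1 / 4 : ℝ) * (3 / 4 : ℝ) ^ (1 / 4 : ℝ) / (8 * sigmaMax σ ^ 2) with hB
  filter_upwards [eventually_le_mul_rpow B (half_pos hd) (show (1 / 4 : ℝ) < 3 / 11 by norm_num),
    eventually_mul_cube_le_exp A⁻¹ (half_pos hd), eventually_ge_atTop 1,
    eventually_le_rpow A one_pos (show (0 : ℝ) < 1 / 8 by norm_num)] with t hBt hAt ht1 hA1
  have ht1' : (1 : ℝ) ≤ t := by exact_mod_cast ht1
  have ht0 : (0 : ℝ) < t := by linarith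
  have e : q σ (3 / 4 * (t : ℝ)) =
      A * (t : ℝ) ^ (-(1 / 8) : ℝ) * Real.exp (-(B * (t : ℝ) ^ (1 / 4 : ℝ))) := by
    rw [q, Real.mul_rpow (by norm_num) ht0.le, Real.mul_rpow (by norm_num) ht0.le, hA, hB]
    congr 1
    · ring
    · congr 1; ring
  rw [e]
  constructor
  · have h1 : ((t : ℝ) ^ 3)⁻¹ ≤ (t : ℝ) ^ (-(1 / 8) : ℝ) := by
      rw [← Real.rpow_natCast, ← Real.rpow_neg ht0.le]
      exact Real.rpow_le_rpow_of_exponent_le ht1' (by norm_num)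
    have h2 : Real.exp (-(d / 2 * (t : ℝ) ^ (3 / 11 : ℝ))) ≤ A * ((t : ℝ) ^ 3)⁻¹ := by
      rw [Real.exp_neg, inv_le_comm₀ (Real.exp_pos _) (by positivity), mul_inv, inv_inv]
      exact hAt
    calc Real.exp (-(d * (t : ℝ) ^ (3 / 11 : ℝ)))
        = Real.exp (-(d / 2 * (t : ℝ) ^ (3 / 11 : ℝ))) *
          Real.exp (-(d / 2 * (t : ℝ) ^ (3 / 11 : ℝ))) := by
          rw [← Real.exp_add]; congr 1; ring
      _ ≤ (A * (t : ℝ) ^ (-(1 / 8) : ℝ)) * Real.exp (-(B * (t : ℝ) ^ (1 / 4 : ℝ))) := by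
          gcongr
          exact h2.trans (by gcongr)
  · rw [one_mul] at hA1
    have h1 : A * (t : ℝ) ^ (-(1 / 8) : ℝ) ≤ 1 := by
      rw [Real.rpow_neg ht0.le, ← div_eq_mul_inv, div_le_one (by positivity)]
      exact hA1
    have h2 : Real.exp (-(B * (t : ℝ) ^ (1 / 4 : ℝ))) ≤ 1 :=
      Real.exp_le_one_iff.2 (neg_nonpos.2 (by positivity))
    exact mul_le_one₀ h1 (Real.exp_pos _).le h2

end

end KGBandit

end

open KGBandit Filter in
theorem theorem1 {k : ℕ} (hk : 2 ≤ k) (μ σ : Fin k → ℝ) (hσ : ∀ i, 0 < σ i)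
    (b : Fin k) (hb : ∀ i, i ≠ b → μ i < μ b)
    {Ω : Type*} [MeasurableSpace Ω] (P : Measure Ω) [IsProbabilityMeasure P]
    (X : Fin k → ℕ → Ω → ℝ) (hX : ∀ i t, Measurable (X i t))
    (hlaw : ∀ i t, P.map (X i t) = gaussianReal (μ i) (Real.toNNReal (σ i ^ 2)))
    (hindep : iIndepFun (fun (p : Fin k × ℕ) => X p.1 p.2) P)
    (rule : KGBandit.Knowledge k → Fin k) (hrule : KGBandit.IsKGRule σ rule) :
    ∃ T₀ : Ω → ℕ, Measurable T₀ ∧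
      (∀ᵐ ω ∂P, ∀ t : ℕ, T₀ ω ≤ t → ∀ i,
        ((t : ℝ) / (k : ℝ)) ^ (3 / 4 : ℝ) ≤
          (KGBandit.pulls σ rule (fun i s => X i s ω) i t : ℝ)) ∧
      ∃ T : ℕ, ∀ t : ℕ, T < t →
        (1 - KGBandit.q σ (3 / 4 * (t : ℝ))) ^ k ≤
          P.real {ω | T₀ ω < t ∧
            KGBandit.RateBounds μ σ b (t : ℝ)
              (fun i => KGBandit.rate σ rule (fun i s => X i s ω) i t)} := by
  classical
  have hr := hrule.measurable
  -- bounds on the parameters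
  have : Nonempty (Fin k) := ⟨b⟩
  obtain ⟨iₘ, hiₘ⟩ := Finite.exists_min σ
  obtain ⟨iₓ, hiₓ⟩ := Finite.exists_max σ
  obtain ⟨iB, hiB⟩ := Finite.exists_max fun i => |μ i|
  have hlo := hσ iₘ
  set K := σ iₓ / σ iₘ with hK
  have hK1 : 1 ≤ K := (one_le_div hlo).2 (hiₘ iₓ)
  have hKσ : ∀ i j, σ i ≤ K * σ j := fun i j => by
    rw [hK, div_mul_eq_mul_div, le_div_iff₀ hlo]
    exact mul_le_mul (hiₓ i) (hiₘ j) hlo.le (hσ _).le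
  obtain ⟨ε, C, c, hε, hC, hc, hev⟩ :=
    eventually_of_isTypical hk hrule hb hlo hiₘ hiₓ hK1 hKσ hiB
  obtain ⟨d, hd, hbad⟩ :=
    eventually_measure_not_isTypical hX hlaw hindep hr hk hlo hiₘ hiₓ hK1 hε hC
  obtain ⟨d', hd', hbad'⟩ := eventually_measure_exists_le hd hc hbad
  -- `G s`: all arms have been pulled often at time `s`
  set G : ℕ → Set Ω := fun s => {ω | ∀ i, ((s : ℝ) / k) ^ (3 / 4 : ℝ) ≤
    (pulls σ rule (fun i s => X i s ω) i s : ℝ)} with hG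
  have hXm : Measurable fun ω => fun i s => X i s ω :=
    measurable_pi_lambda _ fun i => measurable_pi_lambda _ fun s => hX i s
  have hGm : ∀ s, MeasurableSet (G s) := fun s => by
    simp only [hG, Set.ofPred_forall]
    exact MeasurableSet.iInter fun i =>
      measurableSet_le measurable_const ((measurable_pulls_real hr i s).comp hXm)
  set F : ℕ → Set Ω := fun T => ⋂ s ≥ T, G s with hF
  have hFm : ∀ T, MeasurableSet (F T) := fun T =>
    MeasurableSet.iInter fun s => MeasurableSet.iInter fun _ => hGm s
  -- the second alternative makes the minimum exist on the null set where the pulls are too few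
  have hex : ∀ ω, ∃ T, ω ∈ F T ∨ ω ∉ ⋃ T, F T := fun ω => by
    by_cases h : ω ∈ ⋃ T, F T
    · obtain ⟨T, hT⟩ := Set.mem_iUnion.1 h
      exact ⟨T, Or.inl hT⟩
    · exact ⟨0, Or.inr h⟩
  have hgood : ∀ᶠ t : ℕ in atTop, ∀ ω,
      ω ∉ {ω | ∃ s : ℕ, c * (t : ℝ) ≤ s ∧
        ω ∈ {ω | ¬ IsTypical μ σ rule ε C K s (fun i s => X i s ω)}} →
      ω ∈ F (t - 1) ∧ RateBounds μ σ b (t : ℝ) (fun i => rate σ rule (fun i s => X i s ω) i t) := by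
    filter_upwards [hev] with t ht ω hω
    obtain ⟨h1, h2⟩ := ht (fun i s => X i s ω) fun s hs => by
      by_contra hn
      exact hω ⟨s, hs, hn⟩
    refine ⟨?_, h2⟩
    simp only [hF, Set.mem_iInter]
    exact fun s hs => h1 s (by omega)
  refine ⟨fun ω => Nat.find (hex ω), ?_, ?_, ?_⟩
  · exact measurable_find hex fun T => (hFm T).union (MeasurableSet.iUnion hFm).compl
  · have hnull : P (⋃ T, F T)ᶜ = 0 := by
      have hlim : Tendsto (fun t : ℕ => ENNReal.ofReal (Real.exp (-(d' * (t : ℝ) ^ (3 / 11 : ℝ)))))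
          atTop (nhds 0) := by
        rw [← ENNReal.ofReal_zero]
        refine ENNReal.tendsto_ofReal (Real.tendsto_exp_neg_atTop_nhds_zero.comp ?_)
        exact ((tendsto_rpow_atTop (by norm_num)).comp
          tendsto_natCast_atTop_atTop).const_mul_atTop hd'
      refine le_antisymm (ge_of_tendsto hlim ?_) zero_le
      filter_upwards [hbad', hgood] with t h1 h2
      refine (measure_mono fun ω hω => ?_).trans h1
      by_contra hn
      exact hω (Set.mem_iUnion.2 ⟨_, (h2 ω hn).1⟩)
    filter_upwards [compl_mem_ae_iff.2 hnull] with ω hω t ht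
    have hω' : ω ∈ ⋃ T, F T := by simpa using hω
    have h1 := (Nat.find_spec (hex ω)).resolve_right (not_not.2 hω')
    exact Set.mem_iInter₂.1 h1 t ht
  · obtain ⟨T, hT⟩ := eventually_atTop.1
      ((hbad'.and hgood).and ((eventually_exp_le_q hk hσ hd').and (eventually_ge_atTop 1)))
    refine ⟨T, fun t ht => ?_⟩
    obtain ⟨⟨h1, h2⟩, ⟨h3, h4⟩, h5⟩ := hT t ht.le
    set E := {ω | ∃ s : ℕ, c * (t : ℝ) ≤ s ∧
        ω ∈ {ω | ¬ IsTypical μ σ rule ε C K s (fun i s => X i s ω)}} with hE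
    have hq0 : 0 ≤ q σ (3 / 4 * (t : ℝ)) := (Real.exp_pos _).le.trans h3
    have hPE : P.real E ≤ q σ (3 / 4 * (t : ℝ)) :=
      (ENNReal.toReal_le_of_le_ofReal (Real.exp_pos _).le h1).trans h3
    have hcov : 1 ≤ P.real {ω | Nat.find (hex ω) < t ∧ RateBounds μ σ b (t : ℝ)
        (fun i => rate σ rule (fun i s => X i s ω) i t)} + P.real E := by
      refine le_trans ?_ (measureReal_union_le _ _)
      rw [← probReal_univ (μ := P)]
      refine measureReal_mono fun ω _ => ?_
      by_cases hω : ω ∈ E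
      · exact Or.inr hω
      · obtain ⟨h6, h7⟩ := h2 ω hω
        refine Or.inl ⟨?_, h7⟩
        have := Nat.find_min' (hex ω) (Or.inl h6)
        omega
    have hpow : (1 - q σ (3 / 4 * (t : ℝ))) ^ k ≤ 1 - q σ (3 / 4 * (t : ℝ)) :=
      pow_le_of_le_one (by linarith) (by linarith) (by omega)
    linarith
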